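/- Let $k$ be a unital commutative $\mathbb{Q}$-algebra and $A$ a unital associative $k$-algebra such that the natural map $k\to A$ is a $k$-split injection. Let $(\Omega A,d)$ be the dg algebra of noncommutative differential forms, i.e. the quotient of the tensor algebra $T_k(A\oplus A/k)$ (with $da$ denoting the class of $a$ in $A/k$) by the relations $a\otimes b=ab$, $1_A=1$ and $d(ab)=da\otimes b+a\otimes db$. Let $\overline{DR}=\Omega A/(k+[\Omega A,\Omega A])$, where $[\;,\;]$ is the span of supercommutators, with the induced differential $d$, and let $\overline{HD}_p(A)$ be the cohomology of $(\overline{DR},d)$ in degree $p$. Let $\Omega_t=\Omega(A*_k k[t])/(dt)$, bigraded by de Rham degree $p$ and degree $q$ in $t$, and let $\overline{DR}_t=\Omega_t/(k[t]+[\Omega_t,\Omega_t])$, with components $\overline{DR}_t^{p,q}$. It carries the anticommuting differentials $d$ and $i_t$ induced by the superderivations of $\Omega_t$ with $d(a)=da$, $d(da)=0$, $d(t)=0$, and $i_t(a)=0$, $i_t(da)=[a,t]$, $i_t(t)=0$ for $a\in A$. Let $\widehat{\overline{DR}}_t$ be the $t$-adic completion, a graded module with components $\widehat{\overline{DR}}{}_t^{\,p}=\prod_{q\ge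 0}\overline{DR}_t^{p,q}$. For a graded module $M=(M^p)$, zero for $p<0$, let $M((u))$ be the graded module of Laurent series in a variable $u$ of degree $-2$: its component of homological degree $\ell\in\mathbb{Z}$ consists of the series $\sum_r f_r u^r$ with $f_r\in M^{\ell+2r}$. Consider the complexes $(\widehat{\overline{DR}}_t((u)),\,i_t-u\,d)$ and $(\overline{DR}((u)),\,-u\,d)$, whose differentials have homological degree $-1$; the homology of the former is the $t$-adically completed extended periodic cyclic homology $\overline{EHC}^{per,\wedge}_\bullet(A)$. Then the projection modulo $t$, $\widehat{\overline{DR}}_t((u))\to\overline{DR}((u))$ (which applies to each coefficient the map induced by $t\mapsto 0$), is a morphism of complexes. It induces an isomorphism on homology, and the induced map $$\overline{EHC}^{per,\wedge}_\ell(A)\;\longrightarrow\;\bigl(\overline{HD}(A)((u))\bigr)_\ell,\qquad \Bigl[\sum_r f_r u^r\Bigr]\longmapsto\sum_r\,[f_r \bmod t]\,u^r,$$ is an isomorphism of $k$-modules for every $\ell\in\mathbb{Z}$. -/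

import Mathlib

universe u v w

noncomputable section

namespace ExtendedDR

/-! ### Free products of algebras -/

section FreeProd

variable (k : Type u) [CommRing k] (B : Type v) [Ring B] [Algebra k B]
  (C : Type w) [Ring C] [Algebra k C]

/-- The relations which make the tensor algebra of `B ⊕ C` the free product of the unital
algebras `B` and `C`. -/
inductive FreeProd.Rel : TensorAlgebra k (B × C) → TensorAlgebra k (B × C) → Prop
  | one_left : Rel (TensorAlgebra.ι k (1, 0)) 1
  | one_right : Rel (TensorAlgebra.ι k (0, 1)) 1
  | mul_left (b b' : B) :
      Rel (TensorAlgebra.ι k (b, 0) * TensorAlgebra.ι k (b', 0)) (TensorAlgebra.ι k (b * b', 0))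
  | mul_right (c c' : C) :
      Rel (TensorAlgebra.ι k (0, c) * TensorAlgebra.ι k (0, c')) (TensorAlgebra.ι k (0, c * c'))

/-- The free product `B *_k C` of unital `k`-algebras. -/
def FreeProd : Type (max u v w) := RingQuot (FreeProd.Rel k B C)

instance : Ring (FreeProd k B C) := inferInstanceAs (Ring (RingQuot (FreeProd.Rel k B C)))

instance : Algebra k (FreeProd k B C) :=
  inferInstanceAs (Algebra k (RingQuot (FreeProd.Rel k B C)))

/-- The quotient map from the tensor algebra. -/
def FreeProd.mk : TensorAlgebra k (B × C) →ₐ[k] FreeProd k B C :=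
  RingQuot.mkAlgHom k (FreeProd.Rel k B C)

variable {B C} in
/-- The canonical homomorphism `B → B *_k C`. -/
def FreeProd.inl : B →ₐ[k] FreeProd k B C :=
  AlgHom.ofLinearMap
    ((FreeProd.mk k B C).toLinearMap ∘ₗ TensorAlgebra.ι k ∘ₗ LinearMap.inl k B C)
    ((RingQuot.mkAlgHom_rel k FreeProd.Rel.one_left).trans (map_one _))
    (fun b b' => ((RingQuot.mkAlgHom_rel k (FreeProd.Rel.mul_left b b')).symm).trans
      (map_mul _ _ _))

variable {B C} in
/-- The canonical homomorphism `C → B *_k C`. -/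
def FreeProd.inr : C →ₐ[k] FreeProd k B C :=
  AlgHom.ofLinearMap
    ((FreeProd.mk k B C).toLinearMap ∘ₗ TensorAlgebra.ι k ∘ₗ LinearMap.inr k B C)
    ((RingQuot.mkAlgHom_rel k FreeProd.Rel.one_right).trans (map_one _))
    (fun c c' => ((RingQuot.mkAlgHom_rel k (FreeProd.Rel.mul_right c c')).symm).trans
      (map_mul _ _ _))

variable {k B C} in
/-- The homomorphism from the free product given by its two restrictions. -/
def FreeProd.lift {S : Type*} [Ring S] [Algebra k S] (f : B →ₐ[k] S) (g : C →ₐ[k] S) :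
    FreeProd k B C →ₐ[k] S :=
  RingQuot.liftAlgHom k ⟨TensorAlgebra.lift k (f.toLinearMap.coprod g.toLinearMap), by
    intro x y h
    cases h <;> simp⟩

variable {k B C} in
theorem FreeProd.lift_inl {S : Type*} [Ring S] [Algebra k S] (f : B →ₐ[k] S) (g : C →ₐ[k] S)
    (b : B) : FreeProd.lift f g (FreeProd.inl k b) = f b := by
  refine (RingQuot.liftAlgHom_mkAlgHom_apply k _ _ (TensorAlgebra.ι k (b, 0))).trans ?_
  simp

variable {k B C} in
theorem FreeProd.lift_inr {S : Type*} [Ring S] [Algebra k S] (f : B →ₐ[k] S) (g : C →ₐ[k] S)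
    (c : C) : FreeProd.lift f g (FreeProd.inr k c) = g c := by
  refine (RingQuot.liftAlgHom_mkAlgHom_apply k _ _ (TensorAlgebra.ι k (0, c))).trans ?_
  simp

end FreeProd

/-! ### Noncommutative differential forms -/

section Forms

variable (k : Type u) [CommRing k] (B : Type v) [Ring B] [Algebra k B]

/-- The quotient module `B / k`. -/
abbrev Bar : Type v := B ⧸ LinearMap.range (Algebra.linearMap k B)

/-- The class of `b` in `B / k`. -/
abbrev bar : B →ₗ[k] Bar k B := (LinearMap.range (Algebra.linearMap k B)).mkQ

/-- The relations `a ⊗ b = ab` (and `1_B = 1`) and `d(ab) = da ⊗ b + a ⊗ db` in the tensor algebra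
of `B ⊕ B/k`. -/
inductive Omega.Rel : TensorAlgebra k (B × Bar k B) → TensorAlgebra k (B × Bar k B) → Prop
  | one : Rel (TensorAlgebra.ι k (1, 0)) 1
  | mul (a b : B) :
      Rel (TensorAlgebra.ι k (a, 0) * TensorAlgebra.ι k (b, 0)) (TensorAlgebra.ι k (a * b, 0))
  | leibniz (a b : B) :
      Rel (TensorAlgebra.ι k (0, bar k B (a * b)))
        (TensorAlgebra.ι k (0, bar k B a) * TensorAlgebra.ι k (b, 0) +
          TensorAlgebra.ι k (a, 0) * TensorAlgebra.ι k (0, bar k B b))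

/-- The algebra `Ω B` of noncommutative differential forms. -/
def Omega : Type (max u v) := RingQuot (Omega.Rel k B)

instance : Ring (Omega k B) := inferInstanceAs (Ring (RingQuot (Omega.Rel k B)))

instance : Algebra k (Omega k B) := inferInstanceAs (Algebra k (RingQuot (Omega.Rel k B)))

/-- The quotient map from the tensor algebra. -/
def Omega.mk : TensorAlgebra k (B × Bar k B) →ₐ[k] Omega k B :=
  RingQuot.mkAlgHom k (Omega.Rel k B)

variable {B} in
/-- The canonical homomorphism `B → Ω B`. -/
def Omega.of : B →ₐ[k] Omega k B :=
  AlgHom.ofLinearMap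
    ((Omega.mk k B).toLinearMap ∘ₗ TensorAlgebra.ι k ∘ₗ LinearMap.inl k B (Bar k B))
    ((RingQuot.mkAlgHom_rel k Omega.Rel.one).trans (map_one _))
    (fun a b => ((RingQuot.mkAlgHom_rel k (Omega.Rel.mul a b)).symm).trans (map_mul _ _ _))

variable {B} in
/-- The linear map `b ↦ db` from `B` to `Ω B`. -/
def Omega.dOf : B →ₗ[k] Omega k B :=
  (Omega.mk k B).toLinearMap ∘ₗ TensorAlgebra.ι k ∘ₗ LinearMap.inr k B (Bar k B) ∘ₗ bar k B

variable {k B} in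
theorem Omega.dOf_mul (a b : B) :
    Omega.dOf k (a * b) = Omega.dOf k a * Omega.of k b + Omega.of k a * Omega.dOf k b := by
  refine (RingQuot.mkAlgHom_rel k (Omega.Rel.leibniz a b)).trans ?_
  rw [map_add, map_mul, map_mul]
  rfl

variable {k B} in
theorem Omega.dOf_algebraMap (c : k) : Omega.dOf k (algebraMap k B c) = 0 := by
  have h : bar k B (algebraMap k B c) = 0 := by
    rw [Submodule.mkQ_apply, Submodule.Quotient.mk_eq_zero]
    exact ⟨c, rfl⟩
  simp only [Omega.dOf, LinearMap.comp_apply, h, map_zero]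

variable {k B} in
/-- The homomorphism from `Ω B` given by its values `f b` on `b` and `δ b` on `db`. -/
def Omega.lift {S : Type*} [Ring S] [Algebra k S] (f : B →ₐ[k] S) (δ : B →ₗ[k] S)
    (hδ : ∀ a b, δ (a * b) = δ a * f b + f a * δ b) : Omega k B →ₐ[k] S :=
  have h1 : δ 1 = 0 := by simpa using hδ 1 1
  have hk : LinearMap.range (Algebra.linearMap k B) ≤ LinearMap.ker δ := by
    rintro _ ⟨c, rfl⟩
    rw [LinearMap.mem_ker, Algebra.linearMap_apply, Algebra.algebraMap_eq_smul_one, map_smul, h1,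
      smul_zero]
  RingQuot.liftAlgHom k
    ⟨TensorAlgebra.lift k (f.toLinearMap.coprod (Submodule.liftQ _ δ hk)), by
      intro x y h
      cases h <;> simp [hδ]⟩

variable {k B} in
theorem Omega.lift_of {S : Type*} [Ring S] [Algebra k S] (f : B →ₐ[k] S) (δ : B →ₗ[k] S)
    (hδ : ∀ a b, δ (a * b) = δ a * f b + f a * δ b) (b : B) :
    Omega.lift f δ hδ (Omega.of k b) = f b := by
  refine (RingQuot.liftAlgHom_mkAlgHom_apply k _ _ (TensorAlgebra.ι k (b, 0))).trans ?_
  simp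

variable {k B} in
theorem Omega.lift_dOf {S : Type*} [Ring S] [Algebra k S] (f : B →ₐ[k] S) (δ : B →ₗ[k] S)
    (hδ : ∀ a b, δ (a * b) = δ a * f b + f a * δ b) (b : B) :
    Omega.lift f δ hδ (Omega.dOf k b) = δ b := by
  refine (RingQuot.liftAlgHom_mkAlgHom_apply k _ _ (TensorAlgebra.ι k (0, bar k B b))).trans ?_
  simp

variable {B} in
/-- Elements `x₁ ⋯ x_m` of `Ω B`, each factor being some `b` or some `db`, with `p` factors of the
second kind. -/
inductive Omega.IsMonomial : ℤ → Omega k B → Prop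
  | one : IsMonomial 0 1
  | of_mul (b : B) {p : ℤ} {x : Omega k B} : IsMonomial p x → IsMonomial p (Omega.of k b * x)
  | dOf_mul (b : B) {p : ℤ} {x : Omega k B} :
      IsMonomial p x → IsMonomial (p + 1) (Omega.dOf k b * x)

/-- The component `Ω^p B` of de Rham degree `p` (zero for `p < 0`). -/
def Omega.deg (p : ℤ) : Submodule k (Omega k B) := Submodule.span k {x | Omega.IsMonomial k p x}

/-- The upper triangular matrix `((x, y), (0, z))`. -/
def utri {S : Type*} [Ring S] (x y z : S) : Matrix (Fin 2) (Fin 2) S := !![x, y; 0, z]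

theorem utri_add {S : Type*} [Ring S] (x y z x' y' z' : S) :
    utri (x + x') (y + y') (z + z') = utri x y z + utri x' y' z' := by
  ext i j; fin_cases i <;> fin_cases j <;> simp [utri]

theorem utri_smul {S : Type*} [Ring S] [Algebra k S] (c : k) (x y z : S) :
    utri (c • x) (c • y) (c • z) = c • utri x y z := by
  ext i j; fin_cases i <;> fin_cases j <;> simp [utri]

theorem utri_mul {S : Type*} [Ring S] (x y z x' y' z' : S) :
    utri x y z * utri x' y' z' = utri (x * x') (x * y' + y * z') (z * z') := by
  simp [utri]

theorem utri_zero {S : Type*} [Ring S] : utri (0 : S) 0 0 = 0 := by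
  ext i j; fin_cases i <;> fin_cases j <;> simp [utri]

theorem utri_one {S : Type*} [Ring S] : utri (1 : S) 0 1 = 1 := Matrix.one_fin_two.symm

variable {k B} in
/-- Let `φ : Ω B → S` be a homomorphism and let `α`, `β` be the prescribed values of a
superderivation `D : Ω B → S` over `φ` on the generators `b` and `db`; the hypotheses are the Leibniz
rules for `D (ab)` and for `D (d(ab)) = D (da b + a db)`. This is the homomorphism
`x ↦ ((φ (ε x), D x), (0, φ x))` to `2 × 2` matrices, where `ε` is the parity involution. -/
def Omega.superHom {S : Type*} [Ring S] [Algebra k S] (φ : Omega k B →ₐ[k] S) (α β : B →ₗ[k] S)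
    (hα : ∀ a b, α (a * b) = α a * φ (Omega.of k b) + φ (Omega.of k a) * α b)
    (hβ : ∀ a b, β (a * b) = β a * φ (Omega.of k b) - φ (Omega.dOf k a) * α b
      + α a * φ (Omega.dOf k b) + φ (Omega.of k a) * β b) :
    Omega k B →ₐ[k] Matrix (Fin 2) (Fin 2) S :=
  have h1 : α 1 = 0 := by simpa using hα 1 1
  Omega.lift
    (AlgHom.ofLinearMap
      (R := k) (A := B) (B := Matrix (Fin 2) (Fin 2) S)
      { toFun := fun b => utri (φ (Omega.of k b)) (α b) (φ (Omega.of k b))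
        map_add' := fun a b => by simp only [map_add, utri_add]
        map_smul' := fun c b => by simp only [map_smul, utri_smul, RingHom.id_apply] }
      (by simp only [LinearMap.coe_mk, AddHom.coe_mk, map_one, h1, utri_one])
      (fun a b => by
        simp only [LinearMap.coe_mk, AddHom.coe_mk, utri_mul, map_mul, hα,
          add_comm (α a * φ (Omega.of k b))]))
    { toFun := fun b => utri (-φ (Omega.dOf k b)) (β b) (φ (Omega.dOf k b))
      map_add' := fun a b => by simp only [map_add, neg_add, utri_add]
      map_smul' := fun c b => by simp only [map_smul, ← smul_neg, utri_smul, RingHom.id_apply] }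
    (fun a b => by
      simp only [LinearMap.coe_mk, AddHom.coe_mk, AlgHom.ofLinearMap_apply, utri_mul, ← utri_add]
      congr 1
      · rw [Omega.dOf_mul, map_add, map_mul, map_mul, neg_add, neg_mul, mul_neg]
      · rw [hβ, neg_mul]; abel
      · rw [Omega.dOf_mul, map_add, map_mul, map_mul])

variable {k B} in
theorem Omega.superHom_of {S : Type*} [Ring S] [Algebra k S] (φ : Omega k B →ₐ[k] S)
    (α β : B →ₗ[k] S) (hα) (hβ) (b : B) : Omega.superHom φ α β hα hβ (Omega.of k b) =
      utri (φ (Omega.of k b)) (α b) (φ (Omega.of k b)) :=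
  by rw [Omega.superHom, Omega.lift_of]; rfl

variable {k B} in
theorem Omega.superHom_dOf {S : Type*} [Ring S] [Algebra k S] (φ : Omega k B →ₐ[k] S)
    (α β : B →ₗ[k] S) (hα) (hβ) (b : B) : Omega.superHom φ α β hα hβ (Omega.dOf k b) =
      utri (-φ (Omega.dOf k b)) (β b) (φ (Omega.dOf k b)) :=
  by rw [Omega.superHom, Omega.lift_dOf]; rfl

variable {k B} in
/-- The case of the superderivation `d`: it sends `b` to `db` and `db` to `0`. -/
def Omega.dHom {S : Type*} [Ring S] [Algebra k S] (φ : Omega k B →ₐ[k] S) :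
    Omega k B →ₐ[k] Matrix (Fin 2) (Fin 2) S :=
  Omega.superHom φ (φ.toLinearMap ∘ₗ Omega.dOf k) 0
    (fun a b => by simp [Omega.dOf_mul]) (fun a b => by simp)

variable {k B} in
/-- The case of the contraction with a derivation `θ` of `B`: it sends `b` to `0` and `db` to
`θ b`. -/
def Omega.contrHom {S : Type*} [Ring S] [Algebra k S] (φ : Omega k B →ₐ[k] S) (θ : B →ₗ[k] B)
    (hθ : ∀ a b, θ (a * b) = θ a * b + a * θ b) :
    Omega k B →ₐ[k] Matrix (Fin 2) (Fin 2) S :=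
  Omega.superHom φ 0 (φ.toLinearMap ∘ₗ (Omega.of k).toLinearMap ∘ₗ θ)
    (fun a b => by simp) (fun a b => by simp [hθ])

variable {k B} in
theorem Omega.dHom_of {S : Type*} [Ring S] [Algebra k S] (φ : Omega k B →ₐ[k] S) (b : B) :
    Omega.dHom φ (Omega.of k b) =
      utri (φ (Omega.of k b)) (φ (Omega.dOf k b)) (φ (Omega.of k b)) :=
  Omega.superHom_of _ _ _ _ _ _

variable {k B} in
theorem Omega.dHom_dOf {S : Type*} [Ring S] [Algebra k S] (φ : Omega k B →ₐ[k] S) (b : B) :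
    Omega.dHom φ (Omega.dOf k b) = utri (-φ (Omega.dOf k b)) 0 (φ (Omega.dOf k b)) :=
  Omega.superHom_dOf _ _ _ _ _ _

/-- The de Rham differential `d : Ω B → Ω B`. -/
def Omega.d : Omega k B →ₗ[k] Omega k B :=
  Matrix.entryLinearMap k (Omega k B) 0 1 ∘ₗ (Omega.dHom (AlgHom.id k (Omega k B))).toLinearMap

end Forms

/-! ### Supercommutators -/

section SuperComm

variable (k : Type u) [CommRing k] {S : Type v} [Ring S] [Algebra k S] {ι : Type w}

/-- The linear span of the supercommutators `[x, y] = xy - (-1)^{|x||y|} yx` of homogeneous elements;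
here `G` is a family of submodules and `par i` is the degree (that governs signs) of `G i`. -/
def superComm (G : ι → Submodule k S) (par : ι → ℤ) : Submodule k S :=
  Submodule.span k {z | ∃ i j, ∃ x ∈ G i, ∃ y ∈ G j,
    z = x * y - (par i * par j).negOnePow • (y * x)}

variable {k}

theorem negOnePow_aux {a b : ℤ} (h : Odd (a - b)) (c : ℤ) :
    (a * c).negOnePow = (b * c).negOnePow * c.negOnePow := by
  rw [← Int.negOnePow_add, Int.negOnePow_eq_iff]
  obtain ⟨m, hm⟩ := h
  have : a = b + (2 * m + 1) := by omega
  exact ⟨m * c, by rw [this]; ring⟩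

theorem superComm_stable (G : ι → Submodule k S) (par : ι → ℤ) (s : ι → ι) (D : S →ₗ[k] S)
    (hs : ∀ i, Odd (par (s i) - par i)) (hD : ∀ i, ∀ x ∈ G i, D x ∈ G (s i))
    (hmul : ∀ i j, ∀ x ∈ G i, ∀ y ∈ G j, D (x * y) = D x * y + (par i).negOnePow • (x * D y)) :
    superComm k G par ≤ (superComm k G par).comap D := by
  refine Submodule.span_le.2 ?_
  rintro _ ⟨i, j, x, hx, y, hy, rfl⟩
  have e1 : D x * y - (par (s i) * par j).negOnePow • (y * D x) ∈ superComm k G par :=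
    Submodule.subset_span ⟨s i, j, D x, hD i x hx, y, hy, rfl⟩
  have e2 : x * D y - (par i * par (s j)).negOnePow • (D y * x) ∈ superComm k G par :=
    Submodule.subset_span ⟨i, s j, x, hx, D y, hD j y hy, rfl⟩
  have e3 : (par i).negOnePow • (x * D y - (par i * par (s j)).negOnePow • (D y * x))
      ∈ superComm k G par := by
    rcases Int.units_eq_one_or (par i).negOnePow with h | h
    · rw [h, one_smul]; exact e2
    · rw [h, Units.neg_smul, one_smul]; exact neg_mem e2
  have key : D (x * y - (par i * par j).negOnePow • (y * x)) =
      (D x * y - (par (s i) * par j).negOnePow • (y * D x)) +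
      (par i).negOnePow • (x * D y - (par i * par (s j)).negOnePow • (D y * x)) := by
    have hsm : ∀ (c : ℤˣ) (z : S), D (c • z) = c • D z := by
      intro c z
      rcases Int.units_eq_one_or c with h | h <;> simp [h, Units.neg_smul]
    rw [map_sub, hsm, hmul i j x hx y hy, hmul j i y hy x hx, negOnePow_aux (hs i) (par j),
      mul_comm (par i) (par (s j)), negOnePow_aux (hs j) (par i), mul_comm (par j) (par i)]
    rcases Int.units_eq_one_or (par i).negOnePow with h | h <;>
    rcases Int.units_eq_one_or (par j).negOnePow with h' | h' <;>
    rcases Int.units_eq_one_or (par i * par j).negOnePow with h'' | h'' <;>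
    simp [h, h', h'', Units.neg_smul] <;> abel
  rw [SetLike.mem_coe, Submodule.mem_comap, key]
  exact add_mem e1 e3

end SuperComm

/-! ### The reduced Karoubi-de Rham complex -/

theorem mul_mem_span {k : Type u} [CommRing k] {S : Type v} [Ring S] [Algebra k S] (g : S)
    {s s' : Set S} (h : ∀ x ∈ s, g * x ∈ s') {x : S} (hx : x ∈ Submodule.span k s) :
    g * x ∈ Submodule.span k s' := by
  have : Submodule.span k s ≤ (Submodule.span k s').comap (LinearMap.mulLeft k g) :=
    Submodule.span_le.2 fun x hx => Submodule.subset_span (h x hx)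
  exact this hx

theorem negOnePow_smul_comm {k : Type u} [CommRing k] {S : Type v} [AddCommGroup S] [Module k S]
    (p : ℤ) (c : k) (x : S) : p.negOnePow • c • x = c • p.negOnePow • x := by
  rcases Int.units_eq_one_or p.negOnePow with h | h <;> simp [h, Units.neg_smul]

section KdR

variable (k : Type u) [CommRing k] (A : Type v) [Ring A] [Algebra k A]

variable {k A} in
theorem Omega.of_mul_mem (a : A) {p : ℤ} {x : Omega k A} (hx : x ∈ Omega.deg k A p) :
    Omega.of k a * x ∈ Omega.deg k A p :=
  mul_mem_span _ (fun _ h => .of_mul a h) hx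

variable {k A} in
theorem Omega.dOf_mul_mem (a : A) {p : ℤ} {x : Omega k A} (hx : x ∈ Omega.deg k A p) :
    Omega.dOf k a * x ∈ Omega.deg k A (p + 1) :=
  mul_mem_span _ (fun _ h => .dOf_mul a h) hx

variable {k A} in
theorem Omega.dHom_deg {p : ℤ} {x : Omega k A} (hx : x ∈ Omega.deg k A p) :
    ∃ y ∈ Omega.deg k A (p + 1),
      Omega.dHom (AlgHom.id k (Omega k A)) x = utri (p.negOnePow • x) y x := by
  induction hx using Submodule.span_induction with
  | mem x hx =>
    induction hx with
    | one => exact ⟨0, zero_mem _, by simp [utri_one]⟩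
    | @of_mul b p x hx ih =>
      obtain ⟨y, hy, e⟩ := ih
      refine ⟨Omega.of k b * y + Omega.dOf k b * x,
        add_mem (Omega.of_mul_mem b hy) (Omega.dOf_mul_mem b (Submodule.subset_span hx)), ?_⟩
      rw [map_mul, e, Omega.dHom_of, utri_mul]
      simp [mul_smul_comm]
    | @dOf_mul b p x hx ih =>
      obtain ⟨y, hy, e⟩ := ih
      refine ⟨-(Omega.dOf k b * y), neg_mem (Omega.dOf_mul_mem b hy), ?_⟩
      rw [map_mul, e, Omega.dHom_dOf, utri_mul]
      simp [mul_smul_comm, Int.negOnePow_succ, Units.neg_smul]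
  | zero => exact ⟨0, zero_mem _, by simp [utri_zero]⟩
  | add x x' _ _ h h' =>
    obtain ⟨y, hy, e⟩ := h
    obtain ⟨y', hy', e'⟩ := h'
    exact ⟨y + y', add_mem hy hy', by rw [map_add, e, e', ← utri_add, smul_add]⟩
  | smul c x _ h =>
    obtain ⟨y, hy, e⟩ := h
    exact ⟨c • y, Submodule.smul_mem _ _ hy, by
      rw [map_smul, e, ← utri_smul, negOnePow_smul_comm]⟩

variable {k A} in
theorem Omega.dHom_eq {p : ℤ} {x : Omega k A} (hx : x ∈ Omega.deg k A p) :
    Omega.dHom (AlgHom.id k (Omega k A)) x = utri (p.negOnePow • x) (Omega.d k A x) x := by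
  obtain ⟨y, -, e⟩ := Omega.dHom_deg hx
  have : Omega.d k A x = y := by simp [Omega.d, e, utri]
  rw [this, e]

variable {k A} in
theorem Omega.d_mem {p : ℤ} {x : Omega k A} (hx : x ∈ Omega.deg k A p) :
    Omega.d k A x ∈ Omega.deg k A (p + 1) := by
  obtain ⟨y, hy, e⟩ := Omega.dHom_deg hx
  have : Omega.d k A x = y := by simp [Omega.d, e, utri]
  rwa [this]

variable {k A} in
theorem Omega.d_mul {p q : ℤ} {x y : Omega k A} (hx : x ∈ Omega.deg k A p)
    (hy : y ∈ Omega.deg k A q) :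
    Omega.d k A (x * y) = Omega.d k A x * y + p.negOnePow • (x * Omega.d k A y) := by
  have h : Omega.d k A (x * y) = Omega.dHom (AlgHom.id k (Omega k A)) (x * y) 0 1 := rfl
  rw [h, map_mul, Omega.dHom_eq hx, Omega.dHom_eq hy, utri_mul]
  simp [utri, smul_mul_assoc, add_comm]

variable {k A} in
theorem Omega.d_of_mul (a : A) {p : ℤ} {x : Omega k A} (hx : x ∈ Omega.deg k A p) :
    Omega.d k A (Omega.of k a * x) = Omega.of k a * Omega.d k A x + Omega.dOf k a * x := by
  have h : Omega.d k A (Omega.of k a * x) =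
    Omega.dHom (AlgHom.id k (Omega k A)) (Omega.of k a * x) 0 1 := rfl
  rw [h, map_mul, Omega.dHom_eq hx, Omega.dHom_of, utri_mul]
  simp [utri]

variable {k A} in
theorem Omega.d_dOf_mul (a : A) {p : ℤ} {x : Omega k A} (hx : x ∈ Omega.deg k A p) :
    Omega.d k A (Omega.dOf k a * x) = -(Omega.dOf k a * Omega.d k A x) := by
  have h : Omega.d k A (Omega.dOf k a * x) =
    Omega.dHom (AlgHom.id k (Omega k A)) (Omega.dOf k a * x) 0 1 := rfl
  rw [h, map_mul, Omega.dHom_eq hx, Omega.dHom_dOf, utri_mul]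
  simp [utri]

theorem Omega.d_one : Omega.d k A 1 = 0 := by
  simp [Omega.d]

variable {k A} in
theorem Omega.d_d {p : ℤ} {x : Omega k A} (hx : x ∈ Omega.deg k A p) :
    Omega.d k A (Omega.d k A x) = 0 := by
  induction hx using Submodule.span_induction with
  | mem x hx =>
    induction hx with
    | one => rw [Omega.d_one, map_zero]
    | @of_mul b p x hx ih =>
      have hx' : x ∈ Omega.deg k A p := Submodule.subset_span hx
      rw [Omega.d_of_mul b hx', map_add, Omega.d_of_mul b (Omega.d_mem hx'), ih,
        Omega.d_dOf_mul b hx']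
      simp
    | @dOf_mul b p x hx ih =>
      have hx' : x ∈ Omega.deg k A p := Submodule.subset_span hx
      rw [Omega.d_dOf_mul b hx', map_neg, Omega.d_dOf_mul b (Omega.d_mem hx'), ih]
      simp
  | zero => simp
  | add x x' _ _ h h' => rw [map_add, map_add, h, h', add_zero]
  | smul c x _ h => rw [map_smul, map_smul, h, smul_zero]

/-- The submodule `k + [Ω A, Ω A]` of `Ω A`. -/
def oDR.rel : Submodule k (Omega k A) :=
  superComm k (Omega.deg k A) id ⊔ LinearMap.range (Algebra.linearMap k (Omega k A))

/-- The reduced noncommutative de Rham complex `Ω A / (k + [Ω A, Ω A])`. -/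
abbrev oDR : Type (max u v) := Omega k A ⧸ oDR.rel k A

/-- The component of de Rham degree `p` (zero for `p < 0`). -/
def oDR.deg (p : ℤ) : Submodule k (oDR k A) := (Omega.deg k A p).map (oDR.rel k A).mkQ

theorem oDR.rel_le : oDR.rel k A ≤ (oDR.rel k A).comap (Omega.d k A) := by
  refine sup_le ?_ ?_
  · refine (superComm_stable (Omega.deg k A) id (· + 1) (Omega.d k A) (fun i => ⟨0, by simp⟩)
      (fun i x hx => Omega.d_mem hx) (fun i j x hx y hy => Omega.d_mul hx hy)).trans ?_
    exact Submodule.comap_mono le_sup_left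
  · rintro _ ⟨c, rfl⟩
    rw [Submodule.mem_comap, Algebra.linearMap_apply, Algebra.algebraMap_eq_smul_one, map_smul,
      Omega.d_one, smul_zero]
    exact zero_mem _

/-- The Karoubi-de Rham differential. -/
def oDR.d : oDR k A →ₗ[k] oDR k A := Submodule.mapQ _ _ (Omega.d k A) (oDR.rel_le k A)

/-- The (total) reduced Karoubi-de Rham homology: closed modulo exact elements. -/
abbrev oHD : Type (max u v) :=
  LinearMap.ker (oDR.d k A) ⧸ (LinearMap.range (oDR.d k A)).submoduleOf (LinearMap.ker (oDR.d k A))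

/-- The class of a closed element. -/
abbrev oHD.mk : LinearMap.ker (oDR.d k A) →ₗ[k] oHD k A :=
  ((LinearMap.range (oDR.d k A)).submoduleOf (LinearMap.ker (oDR.d k A))).mkQ

/-- The component of degree `p` of the reduced Karoubi-de Rham homology: the classes of the closed
elements of degree `p`. -/
def oHD.deg (p : ℤ) : Submodule k (oHD k A) :=
  ((oDR.deg k A p).submoduleOf (LinearMap.ker (oDR.d k A))).map (oHD.mk k A)

end KdR

/-! ### The extended complex -/

section Extended

variable (k : Type u) [CommRing k] (A : Type v) [Ring A] [Algebra k A]

/-- The free product `A *_k k[t]`. -/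
abbrev FreeT : Type (max u v) := FreeProd k A (Polynomial k)

/-- The element `t` of `A *_k k[t]`. -/
def FreeT.t : FreeT k A := FreeProd.inr k Polynomial.X

/-- The derivation `-ad t : b ↦ [b, t] = bt - tb` of `A *_k k[t]`. -/
def FreeT.negAd : FreeT k A →ₗ[k] FreeT k A :=
  LinearMap.mulRight k (FreeT.t k A) - LinearMap.mulLeft k (FreeT.t k A)

theorem FreeT.negAd_mul (a b : FreeT k A) :
    FreeT.negAd k A (a * b) = FreeT.negAd k A a * b + a * FreeT.negAd k A b := by
  simp only [FreeT.negAd, LinearMap.sub_apply, LinearMap.mulRight_apply, LinearMap.mulLeft_apply]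
  noncomm_ring

/-- The relation `dt = 0`. -/
inductive OmegaT.Rel : Omega k (FreeT k A) → Omega k (FreeT k A) → Prop
  | dt : Rel (Omega.dOf k (FreeT.t k A)) 0

/-- The algebra `Ω_t A = Ω (A *_k k[t]) / (dt)`. -/
def OmegaT : Type (max u v) := RingQuot (OmegaT.Rel k A)

instance : Ring (OmegaT k A) := inferInstanceAs (Ring (RingQuot (OmegaT.Rel k A)))

instance : Algebra k (OmegaT k A) := inferInstanceAs (Algebra k (RingQuot (OmegaT.Rel k A)))

/-- The quotient map `Ω (A *_k k[t]) → Ω_t A`. -/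
def OmegaT.mk : Omega k (FreeT k A) →ₐ[k] OmegaT k A := RingQuot.mkAlgHom k (OmegaT.Rel k A)

theorem OmegaT.mk_dt : OmegaT.mk k A (Omega.dOf k (FreeT.t k A)) = 0 :=
  (RingQuot.mkAlgHom_rel k OmegaT.Rel.dt).trans (map_zero _)

variable {k A} in
/-- The homomorphism from `Ω_t A` induced by a homomorphism from `Ω (A *_k k[t])` that kills `dt`. -/
def OmegaT.lift {S : Type*} [Ring S] [Algebra k S] (F : Omega k (FreeT k A) →ₐ[k] S)
    (hF : F (Omega.dOf k (FreeT.t k A)) = 0) : OmegaT k A →ₐ[k] S :=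
  RingQuot.liftAlgHom k ⟨F, by
    rintro _ _ ⟨⟩
    rw [hF, map_zero]⟩

variable {k A} in
theorem OmegaT.lift_mk {S : Type*} [Ring S] [Algebra k S] (F : Omega k (FreeT k A) →ₐ[k] S)
    (hF : F (Omega.dOf k (FreeT.t k A)) = 0) (x : Omega k (FreeT k A)) :
    OmegaT.lift F hF (OmegaT.mk k A x) = F x :=
  RingQuot.liftAlgHom_mkAlgHom_apply k _ _ x

variable {A} in
/-- The image of `a` in `Ω_t A`. -/
def OmegaT.of : A →ₐ[k] OmegaT k A :=
  (OmegaT.mk k A).comp ((Omega.of k).comp (FreeProd.inl k))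

variable {A} in
/-- The image of `da` in `Ω_t A`. -/
def OmegaT.dOf : A →ₗ[k] OmegaT k A :=
  (OmegaT.mk k A).toLinearMap ∘ₗ Omega.dOf k ∘ₗ (FreeProd.inl k : A →ₐ[k] FreeT k A).toLinearMap

/-- The image of `t` in `Ω_t A`. -/
def OmegaT.t : OmegaT k A := OmegaT.mk k A (Omega.of k (FreeT.t k A))

variable {A} in
/-- Elements `x₁ ⋯ x_m` of `Ω_t A`, each factor being some `a`, some `da`, or `t`, with `p` factors
of the second kind and `q` factors `t`. -/
inductive OmegaT.IsMonomial : ℤ → ℕ → OmegaT k A → Prop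
  | one : IsMonomial 0 0 1
  | of_mul (a : A) {p : ℤ} {q : ℕ} {x : OmegaT k A} :
      IsMonomial p q x → IsMonomial p q (OmegaT.of k a * x)
  | dOf_mul (a : A) {p : ℤ} {q : ℕ} {x : OmegaT k A} :
      IsMonomial p q x → IsMonomial (p + 1) q (OmegaT.dOf k a * x)
  | t_mul {p : ℤ} {q : ℕ} {x : OmegaT k A} :
      IsMonomial p q x → IsMonomial p (q + 1) (OmegaT.t k A * x)

/-- The component `Ω_t^{p,q}` of de Rham degree `p` and of degree `q` in `t`
(zero for `p < 0`). -/
def OmegaT.deg (i : ℤ × ℕ) : Submodule k (OmegaT k A) :=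
  Submodule.span k {x | OmegaT.IsMonomial k i.1 i.2 x}

/-- The homomorphism to matrices whose upper right entry is `d`. -/
def OmegaT.dHom : OmegaT k A →ₐ[k] Matrix (Fin 2) (Fin 2) (OmegaT k A) :=
  OmegaT.lift (Omega.dHom (OmegaT.mk k A)) (by
    rw [Omega.dHom_dOf, OmegaT.mk_dt, neg_zero]
    exact utri_zero)

/-- The homomorphism to matrices whose upper right entry is the contraction. -/
def OmegaT.iHom : OmegaT k A →ₐ[k] Matrix (Fin 2) (Fin 2) (OmegaT k A) :=
  OmegaT.lift (Omega.contrHom (OmegaT.mk k A) (FreeT.negAd k A) (FreeT.negAd_mul k A)) (by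
    rw [Omega.contrHom, Omega.superHom_dOf, OmegaT.mk_dt, neg_zero]
    simp [FreeT.negAd, utri_zero])

/-- The differential `d` of `Ω_t A`: the superderivation with `a ↦ da`, `da ↦ 0`, `t ↦ 0`. -/
def OmegaT.d : OmegaT k A →ₗ[k] OmegaT k A :=
  Matrix.entryLinearMap k (OmegaT k A) 0 1 ∘ₗ (OmegaT.dHom k A).toLinearMap

/-- The contraction `i_t` of `Ω_t A` with the derivation `-ad t`: the superderivation with `a ↦ 0`,
`da ↦ [a, t]`, `t ↦ 0`. -/
def OmegaT.i : OmegaT k A →ₗ[k] OmegaT k A :=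
  Matrix.entryLinearMap k (OmegaT k A) 0 1 ∘ₗ (OmegaT.iHom k A).toLinearMap

variable {k A}

theorem OmegaT.dHom_of (a : A) : OmegaT.dHom k A (OmegaT.of k a) =
    utri (OmegaT.of k a) (OmegaT.dOf k a) (OmegaT.of k a) :=
  (OmegaT.lift_mk _ _ _).trans (Omega.superHom_of _ _ _ _ _ _)

theorem OmegaT.dHom_dOf (a : A) : OmegaT.dHom k A (OmegaT.dOf k a) =
    utri (-OmegaT.dOf k a) 0 (OmegaT.dOf k a) :=
  (OmegaT.lift_mk _ _ _).trans (Omega.superHom_dOf _ _ _ _ _ _)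

theorem OmegaT.dHom_t : OmegaT.dHom k A (OmegaT.t k A) =
    utri (OmegaT.t k A) 0 (OmegaT.t k A) := by
  refine ((OmegaT.lift_mk _ _ _).trans (Omega.dHom_of _ _)).trans ?_
  rw [OmegaT.mk_dt]
  rfl

theorem OmegaT.iHom_of (a : A) : OmegaT.iHom k A (OmegaT.of k a) =
    utri (OmegaT.of k a) 0 (OmegaT.of k a) :=
  (OmegaT.lift_mk _ _ _).trans (Omega.superHom_of _ _ _ _ _ _)

theorem OmegaT.iHom_dOf (a : A) : OmegaT.iHom k A (OmegaT.dOf k a) =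
    utri (-OmegaT.dOf k a) (OmegaT.of k a * OmegaT.t k A - OmegaT.t k A * OmegaT.of k a)
      (OmegaT.dOf k a) := by
  refine ((OmegaT.lift_mk _ _ _).trans (Omega.superHom_dOf _ _ _ _ _ _)).trans ?_
  simp [FreeT.negAd, OmegaT.of, OmegaT.dOf, OmegaT.t]

theorem OmegaT.iHom_t : OmegaT.iHom k A (OmegaT.t k A) =
    utri (OmegaT.t k A) 0 (OmegaT.t k A) :=
  (OmegaT.lift_mk _ _ _).trans (Omega.superHom_of _ _ _ _ _ _)

theorem OmegaT.of_mul_mem (a : A) {p : ℤ} {q : ℕ} {x : OmegaT k A}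
    (hx : x ∈ OmegaT.deg k A (p, q)) : OmegaT.of k a * x ∈ OmegaT.deg k A (p, q) :=
  mul_mem_span _ (fun _ h => .of_mul a h) hx

theorem OmegaT.dOf_mul_mem (a : A) {p : ℤ} {q : ℕ} {x : OmegaT k A}
    (hx : x ∈ OmegaT.deg k A (p, q)) : OmegaT.dOf k a * x ∈ OmegaT.deg k A (p + 1, q) :=
  mul_mem_span _ (fun _ h => .dOf_mul a h) hx

theorem OmegaT.t_mul_mem {p : ℤ} {q : ℕ} {x : OmegaT k A}
    (hx : x ∈ OmegaT.deg k A (p, q)) : OmegaT.t k A * x ∈ OmegaT.deg k A (p, q + 1) :=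
  mul_mem_span _ (fun _ h => .t_mul h) hx

theorem OmegaT.dHom_deg {p : ℤ} {q : ℕ} {x : OmegaT k A} (hx : x ∈ OmegaT.deg k A (p, q)) :
    ∃ y ∈ OmegaT.deg k A (p + 1, q), OmegaT.dHom k A x = utri (p.negOnePow • x) y x := by
  induction hx using Submodule.span_induction with
  | mem x hx =>
    dsimp only [Set.mem_ofPred_eq] at hx
    induction hx with
    | one => exact ⟨0, zero_mem _, by simp [utri_one]⟩
    | @of_mul b p q x hx ih =>
      obtain ⟨y, hy, e⟩ := ih
      refine ⟨OmegaT.of k b * y + OmegaT.dOf k b * x,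
        add_mem (OmegaT.of_mul_mem b hy) (OmegaT.dOf_mul_mem b (Submodule.subset_span hx)), ?_⟩
      rw [map_mul, e, OmegaT.dHom_of, utri_mul, mul_smul_comm]
    | @dOf_mul b p q x hx ih =>
      obtain ⟨y, hy, e⟩ := ih
      refine ⟨-(OmegaT.dOf k b * y), neg_mem (OmegaT.dOf_mul_mem b hy), ?_⟩
      rw [map_mul, e, OmegaT.dHom_dOf, utri_mul]
      simp [mul_smul_comm, Int.negOnePow_succ, Units.neg_smul]
    | @t_mul p q x hx ih =>
      obtain ⟨y, hy, e⟩ := ih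
      refine ⟨OmegaT.t k A * y, OmegaT.t_mul_mem hy, ?_⟩
      rw [map_mul, e, OmegaT.dHom_t, utri_mul, mul_smul_comm, zero_mul, add_zero]
  | zero => exact ⟨0, zero_mem _, by simp [utri_zero]⟩
  | add x x' _ _ h h' =>
    obtain ⟨y, hy, e⟩ := h
    obtain ⟨y', hy', e'⟩ := h'
    exact ⟨y + y', add_mem hy hy', by rw [map_add, e, e', ← utri_add, smul_add]⟩
  | smul c x _ h =>
    obtain ⟨y, hy, e⟩ := h
    exact ⟨c • y, Submodule.smul_mem _ _ hy, by
      rw [map_smul, e, ← utri_smul, negOnePow_smul_comm]⟩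

theorem OmegaT.iHom_deg {p : ℤ} {q : ℕ} {x : OmegaT k A} (hx : x ∈ OmegaT.deg k A (p, q)) :
    ∃ y ∈ OmegaT.deg k A (p - 1, q + 1), OmegaT.iHom k A x = utri (p.negOnePow • x) y x := by
  induction hx using Submodule.span_induction with
  | mem x hx =>
    dsimp only [Set.mem_ofPred_eq] at hx
    induction hx with
    | one => exact ⟨0, zero_mem _, by simp [utri_one]⟩
    | @of_mul b p q x hx ih =>
      obtain ⟨y, hy, e⟩ := ih
      refine ⟨OmegaT.of k b * y, OmegaT.of_mul_mem b hy, ?_⟩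
      rw [map_mul, e, OmegaT.iHom_of, utri_mul, mul_smul_comm, zero_mul, add_zero]
    | @dOf_mul b p q x hx ih =>
      obtain ⟨y, hy, e⟩ := ih
      have hx' : x ∈ OmegaT.deg k A (p, q) := Submodule.subset_span hx
      refine ⟨-(OmegaT.dOf k b * y) +
        (OmegaT.of k b * (OmegaT.t k A * x) - OmegaT.t k A * (OmegaT.of k b * x)), ?_, ?_⟩
      · have h1 := OmegaT.dOf_mul_mem b hy
        rw [sub_add_cancel] at h1
        rw [add_sub_cancel_right]
        exact add_mem (neg_mem h1) (sub_mem (OmegaT.of_mul_mem b (OmegaT.t_mul_mem hx'))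
          (OmegaT.t_mul_mem (OmegaT.of_mul_mem b hx')))
      · rw [map_mul, e, OmegaT.iHom_dOf, utri_mul]
        simp [mul_smul_comm, Int.negOnePow_succ, Units.neg_smul, sub_mul, mul_assoc]
    | @t_mul p q x hx ih =>
      obtain ⟨y, hy, e⟩ := ih
      refine ⟨OmegaT.t k A * y, OmegaT.t_mul_mem hy, ?_⟩
      rw [map_mul, e, OmegaT.iHom_t, utri_mul, mul_smul_comm, zero_mul, add_zero]
  | zero => exact ⟨0, zero_mem _, by simp [utri_zero]⟩
  | add x x' _ _ h h' =>
    obtain ⟨y, hy, e⟩ := h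
    obtain ⟨y', hy', e'⟩ := h'
    exact ⟨y + y', add_mem hy hy', by rw [map_add, e, e', ← utri_add, smul_add]⟩
  | smul c x _ h =>
    obtain ⟨y, hy, e⟩ := h
    exact ⟨c • y, Submodule.smul_mem _ _ hy, by
      rw [map_smul, e, ← utri_smul, negOnePow_smul_comm]⟩

theorem OmegaT.d_apply (x : OmegaT k A) : OmegaT.d k A x = OmegaT.dHom k A x 0 1 := rfl

theorem OmegaT.i_apply (x : OmegaT k A) : OmegaT.i k A x = OmegaT.iHom k A x 0 1 := rfl

theorem OmegaT.d_mem {p : ℤ} {q : ℕ} {x : OmegaT k A} (hx : x ∈ OmegaT.deg k A (p, q)) :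
    OmegaT.d k A x ∈ OmegaT.deg k A (p + 1, q) := by
  obtain ⟨y, hy, e⟩ := OmegaT.dHom_deg hx
  rw [OmegaT.d_apply, e]
  exact hy

theorem OmegaT.i_mem {p : ℤ} {q : ℕ} {x : OmegaT k A} (hx : x ∈ OmegaT.deg k A (p, q)) :
    OmegaT.i k A x ∈ OmegaT.deg k A (p - 1, q + 1) := by
  obtain ⟨y, hy, e⟩ := OmegaT.iHom_deg hx
  rw [OmegaT.i_apply, e]
  exact hy

theorem OmegaT.dHom_eq {p : ℤ} {q : ℕ} {x : OmegaT k A} (hx : x ∈ OmegaT.deg k A (p, q)) :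
    OmegaT.dHom k A x = utri (p.negOnePow • x) (OmegaT.d k A x) x := by
  obtain ⟨y, -, e⟩ := OmegaT.dHom_deg hx
  rw [OmegaT.d_apply, e]
  rfl

theorem OmegaT.iHom_eq {p : ℤ} {q : ℕ} {x : OmegaT k A} (hx : x ∈ OmegaT.deg k A (p, q)) :
    OmegaT.iHom k A x = utri (p.negOnePow • x) (OmegaT.i k A x) x := by
  obtain ⟨y, -, e⟩ := OmegaT.iHom_deg hx
  rw [OmegaT.i_apply, e]
  rfl

theorem OmegaT.d_mul {i j : ℤ × ℕ} {x y : OmegaT k A} (hx : x ∈ OmegaT.deg k A i)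
    (hy : y ∈ OmegaT.deg k A j) :
    OmegaT.d k A (x * y) = OmegaT.d k A x * y + i.1.negOnePow • (x * OmegaT.d k A y) := by
  rw [OmegaT.d_apply (x * y), map_mul, OmegaT.dHom_eq hx, OmegaT.dHom_eq hy, utri_mul]
  simp [utri, smul_mul_assoc, add_comm]

theorem OmegaT.i_mul {i j : ℤ × ℕ} {x y : OmegaT k A} (hx : x ∈ OmegaT.deg k A i)
    (hy : y ∈ OmegaT.deg k A j) :
    OmegaT.i k A (x * y) = OmegaT.i k A x * y + i.1.negOnePow • (x * OmegaT.i k A y) := by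
  rw [OmegaT.i_apply (x * y), map_mul, OmegaT.iHom_eq hx, OmegaT.iHom_eq hy, utri_mul]
  simp [utri, smul_mul_assoc, add_comm]

theorem OmegaT.d_one : OmegaT.d k A 1 = 0 := by simp [OmegaT.d]

theorem OmegaT.i_one : OmegaT.i k A 1 = 0 := by simp [OmegaT.i]

theorem OmegaT.d_of_mul {p : ℤ} {q : ℕ} {x : OmegaT k A} (hx : x ∈ OmegaT.deg k A (p, q)) (a : A) :
    OmegaT.d k A (OmegaT.of k a * x) =
    OmegaT.of k a * OmegaT.d k A x + OmegaT.dOf k a * x := by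
  rw [OmegaT.d_apply (_ * x), map_mul, OmegaT.dHom_eq hx, OmegaT.dHom_of, utri_mul]
  rfl

theorem OmegaT.d_dOf_mul {p : ℤ} {q : ℕ} {x : OmegaT k A} (hx : x ∈ OmegaT.deg k A (p, q)) (a : A) :
    OmegaT.d k A (OmegaT.dOf k a * x) =
    -(OmegaT.dOf k a * OmegaT.d k A x) := by
  rw [OmegaT.d_apply (_ * x), map_mul, OmegaT.dHom_eq hx, OmegaT.dHom_dOf, utri_mul]
  simp [utri]

theorem OmegaT.d_t_mul {p : ℤ} {q : ℕ} {x : OmegaT k A} (hx : x ∈ OmegaT.deg k A (p, q)) :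
    OmegaT.d k A (OmegaT.t k A * x) = OmegaT.t k A * OmegaT.d k A x := by
  rw [OmegaT.d_apply (_ * x), map_mul, OmegaT.dHom_eq hx, OmegaT.dHom_t, utri_mul]
  simp [utri]

theorem OmegaT.i_of_mul {p : ℤ} {q : ℕ} {x : OmegaT k A} (hx : x ∈ OmegaT.deg k A (p, q)) (a : A) :
    OmegaT.i k A (OmegaT.of k a * x) = OmegaT.of k a * OmegaT.i k A x := by
  rw [OmegaT.i_apply (_ * x), map_mul, OmegaT.iHom_eq hx, OmegaT.iHom_of, utri_mul]
  simp [utri]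

theorem OmegaT.i_dOf_mul {p : ℤ} {q : ℕ} {x : OmegaT k A} (hx : x ∈ OmegaT.deg k A (p, q)) (a : A) :
    OmegaT.i k A (OmegaT.dOf k a * x) =
    OmegaT.of k a * (OmegaT.t k A * x) - OmegaT.t k A * (OmegaT.of k a * x)
      - OmegaT.dOf k a * OmegaT.i k A x := by
  rw [OmegaT.i_apply (_ * x), map_mul, OmegaT.iHom_eq hx, OmegaT.iHom_dOf, utri_mul]
  simp [utri]
  noncomm_ring

theorem OmegaT.i_t_mul {p : ℤ} {q : ℕ} {x : OmegaT k A} (hx : x ∈ OmegaT.deg k A (p, q)) :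
    OmegaT.i k A (OmegaT.t k A * x) = OmegaT.t k A * OmegaT.i k A x := by
  rw [OmegaT.i_apply (_ * x), map_mul, OmegaT.iHom_eq hx, OmegaT.iHom_t, utri_mul]
  simp [utri]

theorem OmegaT.d_d {p : ℤ} {q : ℕ} {x : OmegaT k A} (hx : x ∈ OmegaT.deg k A (p, q)) :
    OmegaT.d k A (OmegaT.d k A x) = 0 := by
  induction hx using Submodule.span_induction with
  | mem x hx =>
    dsimp only [Set.mem_ofPred_eq] at hx
    induction hx with
    | one => rw [OmegaT.d_one, map_zero]
    | @of_mul b p q x hx ih =>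
      have hx' : x ∈ OmegaT.deg k A (p, q) := Submodule.subset_span hx
      rw [OmegaT.d_of_mul hx', map_add, OmegaT.d_of_mul (OmegaT.d_mem hx'), ih,
        OmegaT.d_dOf_mul hx']
      simp
    | @dOf_mul b p q x hx ih =>
      have hx' : x ∈ OmegaT.deg k A (p, q) := Submodule.subset_span hx
      rw [OmegaT.d_dOf_mul hx', map_neg, OmegaT.d_dOf_mul (OmegaT.d_mem hx'), ih]
      simp
    | @t_mul p q x hx ih =>
      have hx' : x ∈ OmegaT.deg k A (p, q) := Submodule.subset_span hx
      rw [OmegaT.d_t_mul hx', OmegaT.d_t_mul (OmegaT.d_mem hx'), ih, mul_zero]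
  | zero => simp
  | add x x' _ _ h h' => rw [map_add, map_add, h, h', add_zero]
  | smul c x _ h => rw [map_smul, map_smul, h, smul_zero]

theorem OmegaT.i_i {p : ℤ} {q : ℕ} {x : OmegaT k A} (hx : x ∈ OmegaT.deg k A (p, q)) :
    OmegaT.i k A (OmegaT.i k A x) = 0 := by
  induction hx using Submodule.span_induction with
  | mem x hx =>
    dsimp only [Set.mem_ofPred_eq] at hx
    induction hx with
    | one => rw [OmegaT.i_one, map_zero]
    | @of_mul b p q x hx ih =>
      have hx' : x ∈ OmegaT.deg k A (p, q) := Submodule.subset_span hx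
      rw [OmegaT.i_of_mul hx', OmegaT.i_of_mul (OmegaT.i_mem hx'), ih, mul_zero]
    | @dOf_mul b p q x hx ih =>
      have hx' : x ∈ OmegaT.deg k A (p, q) := Submodule.subset_span hx
      rw [OmegaT.i_dOf_mul hx', map_sub, map_sub, OmegaT.i_of_mul (OmegaT.t_mul_mem hx'),
        OmegaT.i_t_mul hx', OmegaT.i_t_mul (OmegaT.of_mul_mem b hx'), OmegaT.i_of_mul hx',
        OmegaT.i_dOf_mul (OmegaT.i_mem hx'), ih]
      simp
    | @t_mul p q x hx ih =>
      have hx' : x ∈ OmegaT.deg k A (p, q) := Submodule.subset_span hx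
      rw [OmegaT.i_t_mul hx', OmegaT.i_t_mul (OmegaT.i_mem hx'), ih, mul_zero]
  | zero => simp
  | add x x' _ _ h h' => rw [map_add, map_add, h, h', add_zero]
  | smul c x _ h => rw [map_smul, map_smul, h, smul_zero]

theorem OmegaT.i_d {p : ℤ} {q : ℕ} {x : OmegaT k A} (hx : x ∈ OmegaT.deg k A (p, q)) :
    OmegaT.i k A (OmegaT.d k A x) + OmegaT.d k A (OmegaT.i k A x) =
    x * OmegaT.t k A - OmegaT.t k A * x := by
  induction hx using Submodule.span_induction with
  | mem x hx =>
    dsimp only [Set.mem_ofPred_eq] at hx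
    induction hx with
    | one => rw [OmegaT.i_one, OmegaT.d_one]; simp
    | @of_mul b p q x hx ih =>
      have hx' : x ∈ OmegaT.deg k A (p, q) := Submodule.subset_span hx
      rw [OmegaT.i_of_mul hx', OmegaT.d_of_mul hx', map_add, OmegaT.i_of_mul (OmegaT.d_mem hx'),
        OmegaT.d_of_mul (OmegaT.i_mem hx'), OmegaT.i_dOf_mul hx']
      rw [← sub_eq_zero] at ih
      have := congrArg (fun z => OmegaT.of k b * z) ih
      rw [← sub_eq_zero, ← sub_eq_zero.2 this]
      noncomm_ring
    | @dOf_mul b p q x hx ih =>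
      have hx' : x ∈ OmegaT.deg k A (p, q) := Submodule.subset_span hx
      rw [OmegaT.i_dOf_mul hx', OmegaT.d_dOf_mul hx', map_neg, map_sub, map_sub,
        OmegaT.i_dOf_mul (OmegaT.d_mem hx'), OmegaT.d_dOf_mul (OmegaT.i_mem hx'),
        OmegaT.d_of_mul (OmegaT.t_mul_mem hx'), OmegaT.d_t_mul hx',
        OmegaT.d_t_mul (OmegaT.of_mul_mem b hx'), OmegaT.d_of_mul hx']
      rw [← sub_eq_zero] at ih
      have := congrArg (fun z => OmegaT.dOf k b * z) ih
      rw [← sub_eq_zero, ← sub_eq_zero.2 this]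
      noncomm_ring
    | @t_mul p q x hx ih =>
      have hx' : x ∈ OmegaT.deg k A (p, q) := Submodule.subset_span hx
      rw [OmegaT.i_t_mul hx', OmegaT.d_t_mul hx', OmegaT.i_t_mul (OmegaT.d_mem hx'),
        OmegaT.d_t_mul (OmegaT.i_mem hx'), ← mul_add, ih, mul_sub, mul_assoc]
  | zero => simp
  | add x x' _ _ h h' =>
    simp only [map_add, add_mul, mul_add]
    rw [add_sub_add_comm, ← h, ← h']
    abel
  | smul c x _ h =>
    simp only [map_smul, smul_mul_assoc, mul_smul_comm]
    rw [← smul_add, ← smul_sub, h]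

variable (k A)

/-- The submodule `k[t] + [Ω_t, Ω_t]` of `Ω_t A`. -/
def oDRt.rel : Submodule k (OmegaT k A) :=
  superComm k (OmegaT.deg k A) Prod.fst ⊔
    LinearMap.range (Polynomial.aeval (R := k) (OmegaT.t k A)).toLinearMap

/-- The reduced extended noncommutative de Rham complex `Ω_t A / (k[t] + [Ω_t, Ω_t])`. -/
abbrev oDRt : Type (max u v) := OmegaT k A ⧸ oDRt.rel k A

/-- The component of de Rham degree `p` and of degree `q` in `t` (zero for `p < 0`). -/
def oDRt.deg (p : ℤ) (q : ℕ) : Submodule k (oDRt k A) :=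
  (OmegaT.deg k A (p, q)).map (oDRt.rel k A).mkQ

theorem OmegaT.t_pow_mem (n : ℕ) : OmegaT.t k A ^ n ∈ OmegaT.deg k A (0, n) := by
  induction n with
  | zero => rw [pow_zero]; exact Submodule.subset_span OmegaT.IsMonomial.one
  | succ n ih => rw [pow_succ']; exact OmegaT.t_mul_mem ih

theorem OmegaT.d_t_pow (n : ℕ) : OmegaT.d k A (OmegaT.t k A ^ n) = 0 := by
  induction n with
  | zero => rw [pow_zero, OmegaT.d_one]
  | succ n ih => rw [pow_succ', OmegaT.d_t_mul (OmegaT.t_pow_mem k A n), ih, mul_zero]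

theorem OmegaT.i_t_pow (n : ℕ) : OmegaT.i k A (OmegaT.t k A ^ n) = 0 := by
  induction n with
  | zero => rw [pow_zero, OmegaT.i_one]
  | succ n ih => rw [pow_succ', OmegaT.i_t_mul (OmegaT.t_pow_mem k A n), ih, mul_zero]

theorem oDRt.rel_le_d : oDRt.rel k A ≤ (oDRt.rel k A).comap (OmegaT.d k A) := by
  refine sup_le ?_ ?_
  · refine (superComm_stable (OmegaT.deg k A) Prod.fst (fun i => (i.1 + 1, i.2)) (OmegaT.d k A)
      (fun i => ⟨0, by simp⟩) (fun i x hx => OmegaT.d_mem hx)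
      (fun i j x hx y hy => OmegaT.d_mul hx hy)).trans ?_
    exact Submodule.comap_mono le_sup_left
  · rintro _ ⟨f, rfl⟩
    rw [Submodule.mem_comap, AlgHom.toLinearMap_apply, Polynomial.aeval_eq_sum_range]
    simp only [map_sum, map_smul, OmegaT.d_t_pow, smul_zero, Finset.sum_const_zero]
    exact zero_mem _

theorem oDRt.rel_le_i : oDRt.rel k A ≤ (oDRt.rel k A).comap (OmegaT.i k A) := by
  refine sup_le ?_ ?_
  · refine (superComm_stable (OmegaT.deg k A) Prod.fst (fun i => (i.1 - 1, i.2 + 1)) (OmegaT.i k A)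
      (fun i => ⟨-1, by simp⟩) (fun i x hx => OmegaT.i_mem hx)
      (fun i j x hx y hy => OmegaT.i_mul hx hy)).trans ?_
    exact Submodule.comap_mono le_sup_left
  · rintro _ ⟨f, rfl⟩
    rw [Submodule.mem_comap, AlgHom.toLinearMap_apply, Polynomial.aeval_eq_sum_range]
    simp only [map_sum, map_smul, OmegaT.i_t_pow, smul_zero, Finset.sum_const_zero]
    exact zero_mem _

/-- The differential `d` on the reduced extended de Rham complex. -/
def oDRt.d : oDRt k A →ₗ[k] oDRt k A := Submodule.mapQ _ _ (OmegaT.d k A) (oDRt.rel_le_d k A)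

/-- The differential `i_t` on the reduced extended de Rham complex. -/
def oDRt.i : oDRt k A →ₗ[k] oDRt k A := Submodule.mapQ _ _ (OmegaT.i k A) (oDRt.rel_le_i k A)

/-- The homomorphism `A *_k k[t] → A` that is the identity on `A` and sends `t` to `0`. -/
def FreeT.modT : FreeT k A →ₐ[k] A := FreeProd.lift (AlgHom.id k A) (Polynomial.aeval 0)

theorem FreeT.modT_t : FreeT.modT k A (FreeT.t k A) = 0 := by
  rw [FreeT.modT, FreeT.t, FreeProd.lift_inr, Polynomial.aeval_X]

theorem FreeT.modT_inl (a : A) : FreeT.modT k A (FreeProd.inl k a) = a := by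
  rw [FreeT.modT, FreeProd.lift_inl, AlgHom.id_apply]

/-- The homomorphism `Ω (A *_k k[t]) → Ω A` induced by `A *_k k[t] → A`. -/
def FreeT.modTForms : Omega k (FreeT k A) →ₐ[k] Omega k A :=
  Omega.lift ((Omega.of k).comp (FreeT.modT k A)) (Omega.dOf k ∘ₗ (FreeT.modT k A).toLinearMap)
    (fun a b => by
      rw [LinearMap.comp_apply, AlgHom.toLinearMap_apply, map_mul, Omega.dOf_mul]
      rfl)

theorem FreeT.modTForms_of (b : FreeT k A) :
    FreeT.modTForms k A (Omega.of k b) = Omega.of k (FreeT.modT k A b) :=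
  Omega.lift_of _ _ _ b

theorem FreeT.modTForms_dOf (b : FreeT k A) :
    FreeT.modTForms k A (Omega.dOf k b) = Omega.dOf k (FreeT.modT k A b) :=
  Omega.lift_dOf _ _ _ b

/-- The homomorphism `Ω_t A → Ω A`, reduction modulo `t`: it sends `a` to `a`, `da` to `da`, and `t`
to `0`. -/
def OmegaT.modT : OmegaT k A →ₐ[k] Omega k A :=
  OmegaT.lift (FreeT.modTForms k A) (by rw [FreeT.modTForms_dOf, FreeT.modT_t, map_zero])

variable {k A}

theorem OmegaT.modT_of (a : A) : OmegaT.modT k A (OmegaT.of k a) = Omega.of k a :=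
  (OmegaT.lift_mk _ _ _).trans ((FreeT.modTForms_of k A _).trans
    (congrArg _ (FreeT.modT_inl k A a)))

theorem OmegaT.modT_dOf (a : A) : OmegaT.modT k A (OmegaT.dOf k a) = Omega.dOf k a :=
  (OmegaT.lift_mk _ _ _).trans ((FreeT.modTForms_dOf k A _).trans
    (congrArg _ (FreeT.modT_inl k A a)))

theorem OmegaT.modT_t : OmegaT.modT k A (OmegaT.t k A) = 0 :=
  (OmegaT.lift_mk _ _ _).trans ((FreeT.modTForms_of k A _).trans
    ((congrArg _ (FreeT.modT_t k A)).trans (map_zero _)))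

theorem OmegaT.modT_mem {p : ℤ} {q : ℕ} {x : OmegaT k A} (hx : x ∈ OmegaT.deg k A (p, q)) :
    OmegaT.modT k A x ∈ Omega.deg k A p := by
  induction hx using Submodule.span_induction with
  | mem x hx =>
    dsimp only [Set.mem_ofPred_eq] at hx
    induction hx with
    | one => rw [map_one]; exact Submodule.subset_span Omega.IsMonomial.one
    | of_mul b _ ih => rw [map_mul, OmegaT.modT_of]; exact Omega.of_mul_mem b ih
    | dOf_mul b _ ih => rw [map_mul, OmegaT.modT_dOf]; exact Omega.dOf_mul_mem b ih
    | t_mul _ ih => rw [map_mul, OmegaT.modT_t, zero_mul]; exact zero_mem _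
  | zero => rw [map_zero]; exact zero_mem _
  | add x x' _ _ h h' => rw [map_add]; exact add_mem h h'
  | smul c x _ h => rw [map_smul]; exact Submodule.smul_mem _ _ h

theorem oDRt.rel_le_modT :
    oDRt.rel k A ≤ (oDR.rel k A).comap (OmegaT.modT k A).toLinearMap := by
  refine sup_le (Submodule.span_le.2 ?_) ?_
  · rintro _ ⟨i, j, x, hx, y, hy, rfl⟩
    refine Submodule.mem_sup_left (Submodule.subset_span
      ⟨i.1, j.1, OmegaT.modT k A x, OmegaT.modT_mem hx, OmegaT.modT k A y, OmegaT.modT_mem hy, ?_⟩)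
    rw [AlgHom.toLinearMap_apply, map_sub, map_mul, id, id]
    rcases Int.units_eq_one_or (i.1 * j.1).negOnePow with h | h <;> simp [h, Units.neg_smul]
  · rintro _ ⟨f, rfl⟩
    refine Submodule.mem_sup_right ⟨Polynomial.aeval (0 : k) f, ?_⟩
    refine Eq.trans ?_ (Polynomial.aeval_algHom_apply (OmegaT.modT k A) (OmegaT.t k A) f)
    rw [OmegaT.modT_t, Algebra.linearMap_apply, Polynomial.coe_aeval_eq_eval,
      ← Polynomial.aeval_algebraMap_apply_eq_algebraMap_eval, map_zero]

variable (k A)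

/-- The projection modulo `t` from the reduced extended de Rham complex to the reduced de Rham
complex. -/
def oDRt.modT : oDRt k A →ₗ[k] oDR k A :=
  Submodule.mapQ _ _ (OmegaT.modT k A).toLinearMap oDRt.rel_le_modT

/-- The component of de Rham degree `p` of the `t`-adic completion: the product over `q` of the
components of bidegree `(p, q)`, inside the module of all sequences `(x_q)_{q ≥ 0}`. -/
def hDRt.deg (p : ℤ) : Submodule k (ℕ → oDRt k A) :=
  Submodule.pi Set.univ (fun q => oDRt.deg k A p q)

/-- The differential `d` on the completion. -/
def hDRt.d : (ℕ → oDRt k A) →ₗ[k] (ℕ → oDRt k A) :=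
  LinearMap.pi fun q => oDRt.d k A ∘ₗ LinearMap.proj q

/-- The differential `i_t` on the completion; it raises the degree `q` in `t` by one. -/
def hDRt.i : (ℕ → oDRt k A) →ₗ[k] (ℕ → oDRt k A) :=
  LinearMap.pi fun
    | 0 => 0
    | q + 1 => oDRt.i k A ∘ₗ LinearMap.proj q

/-- The projection modulo `t` from the completion: all components with `q > 0` are dropped. -/
def hDRt.modT : (ℕ → oDRt k A) →ₗ[k] oDR k A := oDRt.modT k A ∘ₗ LinearMap.proj 0

end Extended

/-! ### Laurent series in `u` and periodic complexes -/

section Laurent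

variable (k : Type u) [CommRing k] {M : Type v} [AddCommGroup M] [Module k M]
  {N : Type w} [AddCommGroup N] [Module k N]

/-- The homogeneous component of homological degree `l` of the module `M((u))` of formal Laurent
series in `u`, where `M` is graded with components `G p` and `u` has degree `-2`: the coefficient
of `u ^ r` lies in `G (l + 2 * r)`. -/
def laurentDeg (G : ℤ → Submodule k M) (l : ℤ) : Submodule k (HahnSeries ℤ M) where
  carrier := {x | ∀ r, x.coeff r ∈ G (l + 2 * r)}
  add_mem' := fun hx hy r => add_mem (hx r) (hy r)
  zero_mem' := fun _ => zero_mem _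
  smul_mem' := fun c _ hx r => Submodule.smul_mem _ c (hx r)

variable {k}

/-- Apply a linear map to all coefficients of a Laurent series. -/
def laurentMap (f : M →ₗ[k] N) : HahnSeries ℤ M →ₗ[k] HahnSeries ℤ N where
  toFun x := x.map f
  map_add' x y := by ext r; simp
  map_smul' c x := by ext r; simp

/-- Multiplication of Laurent series by `u`. -/
def mulU : HahnSeries ℤ M →ₗ[k] HahnSeries ℤ M where
  toFun x :=
    { coeff := fun r => x.coeff (r - 1)
      isPWO_support' := by
        have h : Function.support (fun r => x.coeff (r - 1)) ⊆ (fun r => r + 1) '' x.support := by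
          intro r hr
          exact ⟨r - 1, hr, by simp⟩
        exact (x.isPWO_support.image_of_monotone (fun a b h => by simpa using h)).mono h }
  map_add' x y := by ext r; simp
  map_smul' c x := by ext r; simp

/-- The operator `i - u d` on Laurent series. -/
def laurentD (i d : M →ₗ[k] M) : HahnSeries ℤ M →ₗ[k] HahnSeries ℤ M :=
  laurentMap i - mulU ∘ₗ laurentMap d

theorem laurentD_coeff (i d : M →ₗ[k] M) (x : HahnSeries ℤ M) (r : ℤ) :
    (laurentD i d x).coeff r = i (x.coeff r) - d (x.coeff (r - 1)) := rfl

/-- On the graded module with components `G p`, the maps `i` and `d` are anticommuting differentials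
of degrees `-1` and `1`. -/
structure IsMixed (G : ℤ → Submodule k M) (i d : M →ₗ[k] M) : Prop where
  i_mem : ∀ p, ∀ x ∈ G p, i x ∈ G (p - 1)
  d_mem : ∀ p, ∀ x ∈ G p, d x ∈ G (p + 1)
  i_i : ∀ p, ∀ x ∈ G p, i (i x) = 0
  d_d : ∀ p, ∀ x ∈ G p, d (d x) = 0
  i_d : ∀ p, ∀ x ∈ G p, i (d x) + d (i x) = 0

variable {G : ℤ → Submodule k M} {i d : M →ₗ[k] M}

theorem IsMixed.laurentD_mem (h : IsMixed G i d) {l m : ℤ} (e : m + 1 = l) {x : HahnSeries ℤ M}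
    (hx : x ∈ laurentDeg k G l) : laurentD i d x ∈ laurentDeg k G m := by
  intro r
  rw [laurentD_coeff]
  have h1 := h.i_mem _ _ (hx r)
  have h2 := h.d_mem _ _ (hx (r - 1))
  have e1 : l + 2 * r - 1 = m + 2 * r := by omega
  have e2 : l + 2 * (r - 1) + 1 = m + 2 * r := by omega
  rw [e1] at h1
  rw [e2] at h2
  exact sub_mem h1 h2

theorem IsMixed.laurentD_laurentD (h : IsMixed G i d) {l : ℤ} {x : HahnSeries ℤ M}
    (hx : x ∈ laurentDeg k G l) : laurentD i d (laurentD i d x) = 0 := by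
  ext r
  have h1 := h.i_i _ _ (hx r)
  have h2 := h.d_d _ _ (hx (r - 1 - 1))
  have h3 := h.i_d _ _ (hx (r - 1))
  rw [laurentD_coeff, laurentD_coeff, laurentD_coeff, map_sub, map_sub, h1, h2, sub_zero, zero_sub,
    ← neg_add', h3, neg_zero]
  rfl

/-- The complex `(M((u)), i - u d)`, graded by the homological degree. -/
def laurentComplex (h : IsMixed G i d) : ChainComplex (ModuleCat.{v} k) ℤ where
  X l := ModuleCat.of k (laurentDeg k G l)
  d l m := if e : m + 1 = l then
      ModuleCat.ofHom ((laurentD i d).restrict (fun _ hx => h.laurentD_mem e hx)) else 0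
  shape l m e := dif_neg e
  d_comp_d' l m n e e' := by
    have e1 : m + 1 = l := e
    have e2 : n + 1 = m := e'
    rw [dif_pos e1, dif_pos e2]
    refine ModuleCat.hom_ext (LinearMap.ext fun x => Subtype.ext ?_)
    exact h.laurentD_laurentD x.2

/-- The map which a degree-preserving linear map induces on homogeneous Laurent series. -/
def laurentDegMap (f : M →ₗ[k] N) {G : ℤ → Submodule k M} {G' : ℤ → Submodule k N}
    (hf : ∀ p, ∀ x ∈ G p, f x ∈ G' p) (l : ℤ) : laurentDeg k G l →ₗ[k] laurentDeg k G' l :=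
  (laurentMap f).restrict (fun _ hx r => hf _ _ (hx r))

end Laurent

section Per

variable (k : Type u) [CommRing k] (A : Type v) [Ring A] [Algebra k A]

theorem hDRt.isMixed : IsMixed (hDRt.deg k A) (hDRt.i k A) (hDRt.d k A) where
  i_mem := by
    rintro p x hx (_ | q) -
    · exact zero_mem _
    · obtain ⟨y, hy, e⟩ := hx q trivial
      refine ⟨OmegaT.i k A y, OmegaT.i_mem hy, ?_⟩
      change _ = oDRt.i k A (x q)
      rw [← e]
      rfl
  d_mem := by
    rintro p x hx q -
    obtain ⟨y, hy, e⟩ := hx q trivial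
    refine ⟨OmegaT.d k A y, OmegaT.d_mem hy, ?_⟩
    change _ = oDRt.d k A (x q)
    rw [← e]
    rfl
  i_i := by
    rintro p x hx
    ext q
    rcases q with _ | _ | q
    · rfl
    · exact map_zero (oDRt.i k A)
    · obtain ⟨y, hy, e⟩ := hx q trivial
      change oDRt.i k A (oDRt.i k A (x q)) = 0
      rw [← e]
      exact (congrArg (oDRt.rel k A).mkQ (OmegaT.i_i hy)).trans (map_zero _)
  d_d := by
    rintro p x hx
    ext q
    obtain ⟨y, hy, e⟩ := hx q trivial
    change oDRt.d k A (oDRt.d k A (x q)) = 0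
    rw [← e]
    exact (congrArg (oDRt.rel k A).mkQ (OmegaT.d_d hy)).trans (map_zero _)
  i_d := by
    rintro p x hx
    ext q
    rcases q with _ | q
    · exact (zero_add (oDRt.d k A 0)).trans (map_zero (oDRt.d k A))
    · obtain ⟨y, hy, e⟩ := hx q trivial
      change oDRt.i k A (oDRt.d k A (x q)) + oDRt.d k A (oDRt.i k A (x q)) = 0
      rw [← e]
      refine (congrArg (oDRt.rel k A).mkQ (OmegaT.i_d hy)).trans ?_
      rw [Submodule.mkQ_apply, Submodule.Quotient.mk_eq_zero]
      refine Submodule.mem_sup_left (Submodule.subset_span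
        ⟨(p, q), (0, 1), y, hy, OmegaT.t k A, ?_, by simp⟩)
      simpa using OmegaT.t_pow_mem k A 1

theorem oDR.isMixed : IsMixed (oDR.deg k A) 0 (oDR.d k A) where
  i_mem _ _ _ := zero_mem _
  d_mem := by
    rintro p _ ⟨y, hy, rfl⟩
    exact ⟨Omega.d k A y, Omega.d_mem hy, rfl⟩
  i_i _ _ _ := rfl
  d_d := by
    rintro p _ ⟨y, hy, rfl⟩
    exact (congrArg (oDR.rel k A).mkQ (Omega.d_d hy)).trans (map_zero _)
  i_d _ _ _ := by simp

/-- The complex `(M((u)), i_t - u d)`, for `M` the `t`-adic completion of the reduced extended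
de Rham complex. Its homology is the `t`-adically completed reduced extended periodic cyclic homology
of `A`. -/
def extPerComplex : ChainComplex (ModuleCat.{max u v} k) ℤ := laurentComplex (hDRt.isMixed k A)

/-- The complex `(M((u)), - u d)`, for `M` the reduced de Rham complex. -/
def perComplex : ChainComplex (ModuleCat.{max u v} k) ℤ := laurentComplex (oDR.isMixed k A)

theorem hDRt.modT_mem (p : ℤ) (x : ℕ → oDRt k A) (hx : x ∈ hDRt.deg k A p) :
    hDRt.modT k A x ∈ oDR.deg k A p := by
  obtain ⟨y, hy, e⟩ := hx 0 trivial
  refine ⟨OmegaT.modT k A y, OmegaT.modT_mem hy, ?_⟩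
  change _ = oDRt.modT k A (x 0)
  rw [← e]
  rfl

/-- Reduction modulo `t`, in homological degree `l`: it is applied to each coefficient of a Laurent
series. -/
def perModT (l : ℤ) : (extPerComplex k A).X l ⟶ (perComplex k A).X l :=
  ModuleCat.ofHom (laurentDegMap (hDRt.modT k A) (hDRt.modT_mem k A) l)

/-- The Laurent series that underlies an element of degree `l` of `perComplex`. -/
def perComplex.toLaurent (l : ℤ) : (perComplex k A).X l →ₗ[k] HahnSeries ℤ (oDR k A) :=
  (laurentDeg k (oDR.deg k A) l).subtype

/-- The Laurent series of a cycle `z` of `extPerComplex`, reduced modulo `t`. -/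
def cycleModT (l : ℤ) (z : (extPerComplex k A).cycles l) : HahnSeries ℤ (oDR k A) :=
  perComplex.toLaurent k A l ((perModT k A l).hom (((extPerComplex k A).iCycles l).hom z))

end Per

end ExtendedDR

end

/-! Filter the completed complex by powers of `t`. The differential `d` preserves the degree in `t`
and `i_t` raises it by one, so on the associated graded pieces only `-u d` survives. The projection
modulo `t` is therefore a quasi-isomorphism as soon as `d` is exact on every component of positive
degree in `t`; the correction by `i_t` is then absorbed one power of `t` at a time, and completeness
in `t` gives a place to all the terms of this unending recursion.

For the exactness, `Ω_t` is generated by `Ω A` and `t`, so a class of positive degree in `t` is a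
combination of cyclic words `t w₁ t w₂ ⋯ t w_n` with blocks `w_i` in `Ω A`. A retraction `s : A → k`
gives a homotopy `h(a₀ da₁ ⋯ da_n) = s(a₀) (a₁ - s(a₁)) da₂ ⋯ da_n`, and `d h + h d` is the identity
on forms which, together with `1`, span `Ω A`. Let `E` apply `h` to each block in turn, with Koszul
signs. Then `d E + E d` multiplies a word by the number of its blocks that are not `1`
(`IsBlockWord.homotopy`). This operator descends to cyclic words (`oDRt.rel_le_cyclicHomotopy`). A
word with no block other than `1` is a power of `t`, which vanishes in the quotient by `k[t]`; all
other numbers of blocks are invertible in a `ℚ`-algebra. Hence closed classes are exact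
(`oDRt.exists_d_eq`).

The recursion in powers of `t` is `oDRt.exists_lift`. It yields at once that cycles lift along the
projection and that a cycle with bounding reduction bounds. Finally, the homology of `-u d` is
computed coefficient by coefficient (`perComplex.classMap_eq_zero_iff`): a homogeneous family of
coefficients is automatically a Laurent series, since forms of negative degree vanish, so
representatives and primitives may be chosen independently for each power of `u`. -/

noncomputable section

namespace ExtendedDR

/-! ### Generators and degrees of `Ω A` and `Ω_t A`. -/

section Generators

variable {k : Type u} [CommRing k] {A : Type v} [Ring A] [Algebra k A]

theorem FreeT.subalgebra_eq_top (U : Subalgebra k (FreeT k A))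
    (hof : ∀ a, FreeProd.inl k a ∈ U) (ht : FreeT.t k A ∈ U) : U = ⊤ := by
  refine eq_top_iff.2 fun x _ => ?_
  obtain ⟨y, rfl⟩ := RingQuot.mkAlgHom_surjective k (FreeProd.Rel k A (Polynomial k)) x
  have hr : ∀ f : Polynomial k, (FreeProd.inr k f : FreeT k A) ∈ U := by
    have h : Algebra.adjoin k {(Polynomial.X : Polynomial k)} ≤
        U.comap (FreeProd.inr k : Polynomial k →ₐ[k] FreeT k A) :=
      Algebra.adjoin_le (Set.singleton_subset_iff.2 ht)
    rw [Polynomial.adjoin_X] at h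
    exact fun f => h trivial
  induction y using TensorAlgebra.induction with
  | algebraMap r => rw [AlgHom.commutes]; exact U.algebraMap_mem r
  | ι z =>
    have hz : z = (z.1, 0) + (0, z.2) := by simp
    rw [hz, map_add, map_add]
    exact U.add_mem (hof z.1) (hr z.2)
  | mul a b ha hb => rw [map_mul]; exact U.mul_mem (ha trivial) (hb trivial)
  | add a b ha hb => rw [map_add]; exact U.add_mem (ha trivial) (hb trivial)

theorem Omega.subalgebra_eq_top (U : Subalgebra k (Omega k A))
    (hof : ∀ a, Omega.of k a ∈ U) (hd : ∀ a, Omega.dOf k a ∈ U) : U = ⊤ := by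
  refine eq_top_iff.2 fun x _ => ?_
  obtain ⟨y, rfl⟩ := RingQuot.mkAlgHom_surjective k (Omega.Rel k A) x
  induction y using TensorAlgebra.induction with
  | algebraMap r => rw [AlgHom.commutes]; exact U.algebraMap_mem r
  | ι z =>
    have hz : z = (z.1, 0) + (0, z.2) := by simp
    rw [hz, map_add, map_add]
    obtain ⟨b, hb⟩ := Submodule.mkQ_surjective _ z.2
    exact U.add_mem (hof z.1) (hb ▸ hd b)
  | mul a b ha hb => rw [map_mul]; exact U.mul_mem (ha trivial) (hb trivial)
  | add a b ha hb => rw [map_add]; exact U.add_mem (ha trivial) (hb trivial)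

theorem OmegaT.subalgebra_eq_top (U : Subalgebra k (OmegaT k A))
    (hof : ∀ a, OmegaT.of k a ∈ U) (hd : ∀ a, OmegaT.dOf k a ∈ U) (ht : OmegaT.t k A ∈ U) :
    U = ⊤ := by
  have hV (b : FreeT k A) : OmegaT.mk k A (Omega.of k b) ∈ U ∧
      OmegaT.mk k A (Omega.dOf k b) ∈ U := by
    -- Membership of `b` and of `db` must be required together: by the Leibniz rule `d(ab)` involves
    -- `a` and `b` themselves, so the condition on `db` alone is not visibly closed under products.
    let V : Subalgebra k (FreeT k A) :=
      { carrier := {b | OmegaT.mk k A (Omega.of k b) ∈ U ∧ OmegaT.mk k A (Omega.dOf k b) ∈ U}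
        mul_mem' := by
          rintro a b ⟨ha, ha'⟩ ⟨hb, hb'⟩
          refine ⟨by rw [map_mul, map_mul]; exact U.mul_mem ha hb, ?_⟩
          rw [Omega.dOf_mul, map_add, map_mul, map_mul]
          exact U.add_mem (U.mul_mem ha' hb) (U.mul_mem ha hb')
        add_mem' := by
          rintro a b ⟨ha, ha'⟩ ⟨hb, hb'⟩
          exact ⟨by rw [map_add, map_add]; exact U.add_mem ha hb,
            by rw [map_add, map_add]; exact U.add_mem ha' hb'⟩
        algebraMap_mem' := fun r => ⟨by rw [AlgHom.commutes, AlgHom.commutes]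
                                        exact U.algebraMap_mem r,
          by rw [Omega.dOf_algebraMap, map_zero]; exact U.zero_mem⟩ }
    have h : V = ⊤ := FreeT.subalgebra_eq_top V (fun a => ⟨hof a, hd a⟩)
      ⟨ht, by rw [OmegaT.mk_dt]; exact U.zero_mem⟩
    have hb : b ∈ V := h ▸ Algebra.mem_top
    exact hb
  have h : U.comap (OmegaT.mk k A) = ⊤ :=
    Omega.subalgebra_eq_top _ (fun b => (hV b).1) (fun b => (hV b).2)
  refine eq_top_iff.2 fun x _ => ?_
  obtain ⟨y, rfl⟩ := RingQuot.mkAlgHom_surjective k (OmegaT.Rel k A) x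
  have hy : y ∈ U.comap (OmegaT.mk k A) := h ▸ Algebra.mem_top
  exact hy

/-- The subalgebra of elements whose left multiplication preserves a submodule. -/
def leftStabilizer {S : Type*} [Ring S] [Algebra k S] (N : Submodule k S) : Subalgebra k S where
  carrier := {x | ∀ y ∈ N, x * y ∈ N}
  mul_mem' := fun {a b} ha hb y hy => by rw [mul_assoc]; exact ha _ (hb y hy)
  add_mem' := fun {a b} ha hb y hy => by rw [add_mul]; exact add_mem (ha y hy) (hb y hy)
  algebraMap_mem' := fun r y hy => by
    rw [← Algebra.smul_def]; exact N.smul_mem r hy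

/-- The elements that preserve `N` by left multiplication form a subalgebra containing the
generators, hence everything; apply them to `1`. -/
theorem Omega.submodule_eq_top (N : Submodule k (Omega k A)) (h1 : (1 : Omega k A) ∈ N)
    (hof : ∀ a, ∀ x ∈ N, Omega.of k a * x ∈ N) (hd : ∀ a, ∀ x ∈ N, Omega.dOf k a * x ∈ N) :
    N = ⊤ := by
  have h := Omega.subalgebra_eq_top (leftStabilizer N) hof hd
  refine eq_top_iff.2 fun x _ => ?_
  have hx : x ∈ leftStabilizer N := h ▸ Algebra.mem_top
  simpa using hx 1 h1

/-- This allows identities of linear maps on `Ω A` to be checked on homogeneous forms. Independence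
of the components is a separate matter, settled by `Omega.gradeHom`. -/
theorem Omega.iSup_deg : ⨆ p, Omega.deg k A p = ⊤ := by
  have hmul (g : Omega k A) (s : ℤ → ℤ)
      (hg : ∀ p, ∀ x ∈ Omega.deg k A p, g * x ∈ Omega.deg k A (s p)) :
      ∀ x ∈ ⨆ p, Omega.deg k A p, g * x ∈ ⨆ p, Omega.deg k A p := by
    intro x hx
    have : ⨆ p, Omega.deg k A p ≤ (⨆ p, Omega.deg k A p).comap (LinearMap.mulLeft k g) :=
      iSup_le fun p y hy => Submodule.mem_iSup_of_mem (s p) (hg p y hy)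
    exact this hx
  refine Omega.submodule_eq_top _ (Submodule.mem_iSup_of_mem 0 (Submodule.subset_span .one))
    (fun a => hmul _ id fun p x hx => Omega.of_mul_mem a hx)
    (fun a => hmul _ (· + 1) fun p x hx => Omega.dOf_mul_mem a hx)

theorem Omega.isMonomial_nonneg {p : ℤ} {x : Omega k A} (hx : Omega.IsMonomial k p x) :
    0 ≤ p := by
  induction hx <;> omega

theorem OmegaT.isMonomial_nonneg {p : ℤ} {q : ℕ} {x : OmegaT k A}
    (hx : OmegaT.IsMonomial k p q x) : 0 ≤ p := by
  induction hx <;> omega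

theorem Omega.deg_eq_bot {p : ℤ} (hp : p < 0) : Omega.deg k A p = ⊥ := by
  refine Submodule.span_eq_bot.2 fun x hx => ?_
  have := Omega.isMonomial_nonneg hx
  omega

theorem OmegaT.deg_eq_bot {p : ℤ} {q : ℕ} (hp : p < 0) : OmegaT.deg k A (p, q) = ⊥ := by
  refine Submodule.span_eq_bot.2 fun x hx => ?_
  have := OmegaT.isMonomial_nonneg hx
  dsimp only at this
  omega

theorem Omega.mul_mem {p p' : ℤ} {x y : Omega k A} (hx : x ∈ Omega.deg k A p)
    (hy : y ∈ Omega.deg k A p') : x * y ∈ Omega.deg k A (p + p') := by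
  induction hx using Submodule.span_induction with
  | mem x hx =>
    induction hx with
    | one => simpa using hy
    | of_mul a _ ih => rw [mul_assoc]; exact Omega.of_mul_mem a ih
    | dOf_mul a _ ih => rw [mul_assoc, add_right_comm]; exact Omega.dOf_mul_mem a ih
  | zero => rw [zero_mul]; exact zero_mem _
  | add x x' _ _ h h' => rw [add_mul]; exact add_mem h h'
  | smul c x _ h => rw [smul_mul_assoc]; exact Submodule.smul_mem _ _ h

theorem OmegaT.mul_mem {p p' : ℤ} {q q' : ℕ} {x y : OmegaT k A} (hx : x ∈ OmegaT.deg k A (p, q))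
    (hy : y ∈ OmegaT.deg k A (p', q')) : x * y ∈ OmegaT.deg k A (p + p', q + q') := by
  induction hx using Submodule.span_induction with
  | mem x hx =>
    dsimp only [Set.mem_ofPred_eq] at hx
    induction hx with
    | one => simpa using hy
    | of_mul a _ ih => rw [mul_assoc]; exact OmegaT.of_mul_mem a ih
    | dOf_mul a _ ih => rw [mul_assoc, add_right_comm]; exact OmegaT.dOf_mul_mem a ih
    | t_mul _ ih => rw [mul_assoc, Nat.add_right_comm]; exact OmegaT.t_mul_mem ih
  | zero => rw [zero_mul]; exact zero_mem _
  | add x x' _ _ h h' => rw [add_mul]; exact add_mem h h'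
  | smul c x _ h => rw [smul_mul_assoc]; exact Submodule.smul_mem _ _ h

theorem OmegaT.one_mem_deg : (1 : OmegaT k A) ∈ OmegaT.deg k A (0, 0) :=
  Submodule.subset_span .one

theorem Omega.one_mem_deg : (1 : Omega k A) ∈ Omega.deg k A 0 :=
  Submodule.subset_span .one

theorem Omega.of_mem (a : A) : Omega.of k a ∈ Omega.deg k A 0 := by
  simpa using Omega.of_mul_mem a (Omega.one_mem_deg (k := k) (A := A))

theorem Omega.dOf_mem (a : A) : Omega.dOf k a ∈ Omega.deg k A 1 := by
  simpa using Omega.dOf_mul_mem a (Omega.one_mem_deg (k := k) (A := A))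

theorem OmegaT.t_mem : OmegaT.t k A ∈ OmegaT.deg k A (0, 1) := by
  simpa using OmegaT.t_pow_mem k A 1

end Generators

/-! ### `Ω_t A` as the algebra obtained from `Ω A` by freely adjoining `t`. -/

section UniversalProperty

variable {k : Type u} [CommRing k] {A : Type v} [Ring A] [Algebra k A]

theorem OmegaT.dOf_mul (a b : A) : OmegaT.dOf k (a * b) =
    OmegaT.dOf k a * OmegaT.of k b + OmegaT.of k a * OmegaT.dOf k b := by
  simp [OmegaT.dOf, OmegaT.of, Omega.dOf_mul]

variable (k A) in
/-- The inclusion of the forms on `A` into the extended forms. -/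
def OmegaT.incl : Omega k A →ₐ[k] OmegaT k A :=
  Omega.lift (OmegaT.of k) (OmegaT.dOf k) OmegaT.dOf_mul

theorem OmegaT.incl_of (a : A) : OmegaT.incl k A (Omega.of k a) = OmegaT.of k a :=
  Omega.lift_of _ _ _ a

theorem OmegaT.incl_dOf (a : A) : OmegaT.incl k A (Omega.dOf k a) = OmegaT.dOf k a :=
  Omega.lift_dOf _ _ _ a

theorem OmegaT.incl_mem {p : ℤ} {x : Omega k A} (hx : x ∈ Omega.deg k A p) :
    OmegaT.incl k A x ∈ OmegaT.deg k A (p, 0) := by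
  induction hx using Submodule.span_induction with
  | mem x hx =>
    induction hx with
    | one => rw [map_one]; exact OmegaT.one_mem_deg
    | of_mul a _ ih => rw [map_mul, OmegaT.incl_of]; exact OmegaT.of_mul_mem a ih
    | dOf_mul a _ ih => rw [map_mul, OmegaT.incl_dOf]; exact OmegaT.dOf_mul_mem a ih
  | zero => rw [map_zero]; exact zero_mem _
  | add x x' _ _ h h' => rw [map_add]; exact add_mem h h'
  | smul c x _ h => rw [map_smul]; exact Submodule.smul_mem _ _ h

theorem OmegaT.d_incl (x : Omega k A) :
    OmegaT.d k A (OmegaT.incl k A x) = OmegaT.incl k A (Omega.d k A x) := by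
  have hx : x ∈ ⨆ p, Omega.deg k A p := Omega.iSup_deg (k := k) (A := A) ▸ trivial
  have h : ⨆ p, Omega.deg k A p ≤ LinearMap.eqLocus
      (OmegaT.d k A ∘ₗ (OmegaT.incl k A).toLinearMap)
      ((OmegaT.incl k A).toLinearMap ∘ₗ Omega.d k A) := by
    refine iSup_le fun p => Submodule.span_le.2 fun x hx => ?_
    simp only [SetLike.mem_coe, LinearMap.mem_eqLocus, LinearMap.comp_apply,
      AlgHom.toLinearMap_apply]
    induction hx with
    | one => rw [map_one, OmegaT.d_one, Omega.d_one, map_zero]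
    | @of_mul a p x hx ih =>
      have hx' : x ∈ Omega.deg k A p := Submodule.subset_span hx
      rw [map_mul, OmegaT.incl_of, OmegaT.d_of_mul (OmegaT.incl_mem hx'), ih,
        Omega.d_of_mul a hx', map_add, map_mul, map_mul, OmegaT.incl_of, OmegaT.incl_dOf]
    | @dOf_mul a p x hx ih =>
      have hx' : x ∈ Omega.deg k A p := Submodule.subset_span hx
      rw [map_mul, OmegaT.incl_dOf, OmegaT.d_dOf_mul (OmegaT.incl_mem hx'), ih,
        Omega.d_dOf_mul a hx', map_neg, map_mul, OmegaT.incl_dOf]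
  exact h hx

theorem OmegaT.modT_incl (x : Omega k A) : OmegaT.modT k A (OmegaT.incl k A x) = x := by
  have h := Omega.subalgebra_eq_top
    (AlgHom.equalizer ((OmegaT.modT k A).comp (OmegaT.incl k A)) (AlgHom.id k _))
    (fun a => by simp [AlgHom.mem_equalizer, OmegaT.incl_of, OmegaT.modT_of])
    (fun a => by simp [AlgHom.mem_equalizer, OmegaT.incl_dOf, OmegaT.modT_dOf])
  have hx : x ∈ AlgHom.equalizer ((OmegaT.modT k A).comp (OmegaT.incl k A)) (AlgHom.id k _) :=
    h ▸ Algebra.mem_top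
  simpa [AlgHom.mem_equalizer] using hx

/-- Induction on the number of factors `t`: the components of `Ω_t` are generated by products
`w₀ t w₁ ⋯ t w_q` with `w_i` in `Ω A`. -/
theorem OmegaT.deg_le_of_blocks (S : ℤ → ℕ → Submodule k (OmegaT k A))
    (hbase : ∀ p, ∀ w ∈ Omega.deg k A p, OmegaT.incl k A w ∈ S p 0)
    (hstep : ∀ p p' q, ∀ w ∈ Omega.deg k A p, ∀ x ∈ OmegaT.deg k A (p', q), x ∈ S p' q →
      OmegaT.incl k A w * (OmegaT.t k A * x) ∈ S (p + p') (q + 1)) (p : ℤ) (q : ℕ) :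
    OmegaT.deg k A (p, q) ≤ S p q := by
  -- The auxiliary form `w` is an accumulator: each letter `a` or `da` at the front of the monomial
  -- is absorbed into it, and a letter `t` closes the block. The claim itself is the case `w = 1`.
  have key {p : ℤ} {q : ℕ} {x : OmegaT k A} (hx : OmegaT.IsMonomial k p q x) :
      ∀ p', ∀ w ∈ Omega.deg k A p', OmegaT.incl k A w * x ∈ S (p' + p) q := by
    induction hx with
    | one => intro p' w hw; simpa using hbase p' w hw
    | of_mul a _ ih =>
      intro p' w hw
      rw [← mul_assoc, ← OmegaT.incl_of, ← map_mul]
      refine ih p' _ ?_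
      simpa using Omega.mul_mem hw (Omega.of_mem a)
    | @dOf_mul a p q x _ ih =>
      intro p' w hw
      rw [← mul_assoc, ← OmegaT.incl_dOf, ← map_mul, add_comm p 1, ← add_assoc]
      exact ih (p' + 1) _ (Omega.mul_mem hw (Omega.dOf_mem a))
    | @t_mul p q x hx ih =>
      intro p' w hw
      refine hstep p' p q w hw x (Submodule.subset_span hx) ?_
      simpa using ih 0 1 Omega.one_mem_deg
  refine Submodule.span_le.2 fun x hx => ?_
  simpa using key hx 0 1 Omega.one_mem_deg

variable {S : Type*} [Ring S] [Algebra k S]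

/-- The homomorphism to triangular matrices which encodes the derivation of `A *_k k[t]` given by
`a ↦ f (da)` and `t ↦ 0`. -/
def FreeT.derivHom (f : Omega k A →ₐ[k] S) (s : S) : FreeT k A →ₐ[k] Matrix (Fin 2) (Fin 2) S :=
  FreeProd.lift
    (AlgHom.ofLinearMap
      { toFun := fun a => utri (f (Omega.of k a)) (f (Omega.dOf k a)) (f (Omega.of k a))
        map_add' := fun a b => by simp only [map_add, utri_add]
        map_smul' := fun c b => by simp only [map_smul, utri_smul, RingHom.id_apply] }
      (by
        have h : Omega.dOf k (1 : A) = 0 := by simpa using Omega.dOf_algebraMap (B := A) (1 : k)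
        simp only [LinearMap.coe_mk, AddHom.coe_mk, map_one, h, map_zero, utri_one])
      (fun a b => by
        simp only [LinearMap.coe_mk, AddHom.coe_mk, utri_mul, map_mul, Omega.dOf_mul, map_add,
          add_comm (f (Omega.dOf k a) * f (Omega.of k b))]))
    (Polynomial.aeval (utri s 0 s))

theorem FreeT.derivHom_inl (f : Omega k A →ₐ[k] S) (s : S) (a : A) :
    FreeT.derivHom f s (FreeProd.inl k a) =
      utri (f (Omega.of k a)) (f (Omega.dOf k a)) (f (Omega.of k a)) :=
  FreeProd.lift_inl _ _ a

theorem FreeT.derivHom_t (f : Omega k A →ₐ[k] S) (s : S) :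
    FreeT.derivHom f s (FreeT.t k A) = utri s 0 s := by
  rw [FreeT.derivHom, FreeT.t, FreeProd.lift_inr, Polynomial.aeval_X]

/-- The homomorphism on `A *_k k[t]` given by its values on `A` and `t`. -/
def FreeT.liftForms (f : Omega k A →ₐ[k] S) (s : S) : FreeT k A →ₐ[k] S :=
  FreeProd.lift (f.comp (Omega.of k)) (Polynomial.aeval s)

theorem FreeT.liftForms_inl (f : Omega k A →ₐ[k] S) (s : S) (a : A) :
    FreeT.liftForms f s (FreeProd.inl k a) = f (Omega.of k a) :=
  FreeProd.lift_inl _ _ a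

theorem FreeT.liftForms_t (f : Omega k A →ₐ[k] S) (s : S) :
    FreeT.liftForms f s (FreeT.t k A) = s := by
  rw [FreeT.liftForms, FreeT.t, FreeProd.lift_inr, Polynomial.aeval_X]

/-- With equal diagonal entries given by an algebra homomorphism, multiplicativity of the matrix is
exactly the Leibniz rule for its upper right entry. This supplies the derivation needed to extend
`f` to the forms on `A *_k k[t]`. -/
theorem FreeT.derivHom_eq (f : Omega k A →ₐ[k] S) (s : S) (b : FreeT k A) :
    FreeT.derivHom f s b =
      utri (FreeT.liftForms f s b) (FreeT.derivHom f s b 0 1) (FreeT.liftForms f s b) := by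
  let V : Subalgebra k (FreeT k A) :=
    { carrier := {b | ∃ y, FreeT.derivHom f s b =
        utri (FreeT.liftForms f s b) y (FreeT.liftForms f s b)}
      mul_mem' := by
        rintro a b ⟨y, hy⟩ ⟨z, hz⟩
        exact ⟨_, by rw [map_mul, hy, hz, utri_mul, map_mul]⟩
      add_mem' := by
        rintro a b ⟨y, hy⟩ ⟨z, hz⟩
        exact ⟨_, by rw [map_add, hy, hz, ← utri_add, map_add]⟩
      algebraMap_mem' := fun r => ⟨0, by
        rw [Algebra.algebraMap_eq_smul_one, map_smul, map_smul, map_one, map_one,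
          ← utri_one, ← utri_smul, smul_zero]⟩ }
  have h : V = ⊤ := FreeT.subalgebra_eq_top V
    (fun a => ⟨_, by rw [FreeT.derivHom_inl, FreeT.liftForms_inl]⟩)
    ⟨_, by rw [FreeT.derivHom_t, FreeT.liftForms_t]⟩
  have hb : b ∈ V := h ▸ Algebra.mem_top
  obtain ⟨y, hy⟩ := hb
  rw [hy]
  rfl

/-- The homomorphism from `Ω_t A` given by its restriction to `Ω A` and its value on `t`. -/
def OmegaT.liftForms (f : Omega k A →ₐ[k] S) (s : S) : OmegaT k A →ₐ[k] S :=
  OmegaT.lift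
    (Omega.lift (FreeT.liftForms f s)
      (Matrix.entryLinearMap k S 0 1 ∘ₗ (FreeT.derivHom f s).toLinearMap)
      (fun a b => by
        simp only [LinearMap.comp_apply, AlgHom.toLinearMap_apply, Matrix.entryLinearMap_apply]
        rw [map_mul, FreeT.derivHom_eq f s a, FreeT.derivHom_eq f s b, utri_mul]
        simp [utri, add_comm]))
    (by
      rw [Omega.lift_dOf]
      simp [FreeT.derivHom_t, utri])

theorem OmegaT.liftForms_t (f : Omega k A →ₐ[k] S) (s : S) :
    OmegaT.liftForms f s (OmegaT.t k A) = s :=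
  (OmegaT.lift_mk _ _ _).trans ((Omega.lift_of _ _ _ _).trans (FreeT.liftForms_t f s))

theorem OmegaT.liftForms_incl (f : Omega k A →ₐ[k] S) (s : S) (w : Omega k A) :
    OmegaT.liftForms f s (OmegaT.incl k A w) = f w := by
  have h := Omega.subalgebra_eq_top
    (AlgHom.equalizer ((OmegaT.liftForms f s).comp (OmegaT.incl k A)) f)
    (fun a => by
      rw [AlgHom.mem_equalizer, AlgHom.comp_apply, OmegaT.incl_of]
      exact (OmegaT.lift_mk _ _ _).trans
        ((Omega.lift_of _ _ _ _).trans (FreeT.liftForms_inl f s a)))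
    (fun a => by
      rw [AlgHom.mem_equalizer, AlgHom.comp_apply, OmegaT.incl_dOf]
      refine (OmegaT.lift_mk _ _ _).trans ((Omega.lift_dOf _ _ _ _).trans ?_)
      simp [FreeT.derivHom_inl, utri])
  have hw : w ∈ AlgHom.equalizer ((OmegaT.liftForms f s).comp (OmegaT.incl k A)) f :=
    h ▸ Algebra.mem_top
  exact hw

end UniversalProperty

/-! ### The contracting homotopy of `Ω A` given by a retraction of `A` onto `k`. -/

section Homotopy

open TensorProduct

variable {k : Type u} [CommRing k] {A : Type v} [Ring A] [Algebra k A]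

variable (k A) in
/-- The normal form of noncommutative forms: `a₀ da₁ ⋯ da_n` corresponds to
`a₀ ⊗ (a₁ ⊗ ⋯ ⊗ a_n)`. -/
abbrev NormalForm : Type (max u v) := A ⊗[k] TensorAlgebra k (Bar k A)

variable (k A) in
/-- The differential on normal forms, `a ⊗ y ↦ 1 ⊗ (a ⊗ y)`. -/
def NormalForm.d : NormalForm k A →ₗ[k] NormalForm k A :=
  TensorProduct.mk k A (TensorAlgebra k (Bar k A)) 1 ∘ₗ
    TensorProduct.lift (LinearMap.mul k (TensorAlgebra k (Bar k A)) ∘ₗ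
      TensorAlgebra.ι k ∘ₗ bar k A)

theorem NormalForm.d_tmul (a : A) (y : TensorAlgebra k (Bar k A)) :
    NormalForm.d k A (a ⊗ₜ y) = 1 ⊗ₜ (TensorAlgebra.ι k (bar k A a) * y) := rfl

variable (k A) in
/-- Left multiplication by elements of `A` on normal forms. -/
def NormalForm.mulLeft : A →ₐ[k] Module.End k (NormalForm k A) :=
  (Module.End.rTensorAlgHom k A (TensorAlgebra k (Bar k A))).comp (Algebra.lmul k A)

theorem NormalForm.mulLeft_tmul (a b : A) (y : TensorAlgebra k (Bar k A)) :
    NormalForm.mulLeft k A a (b ⊗ₜ y) = (a * b) ⊗ₜ y := rfl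

variable (k A) in
/-- The action of forms on normal forms; `da` acts as the commutator of `d` with `a`. -/
def NormalForm.action : Omega k A →ₐ[k] Module.End k (NormalForm k A) :=
  Omega.lift (NormalForm.mulLeft k A)
    ((LinearMap.mulLeft k (NormalForm.d k A) - LinearMap.mulRight k (NormalForm.d k A)) ∘ₗ
      (NormalForm.mulLeft k A).toLinearMap)
    -- The commutator with a fixed operator is a derivation, whatever the operator is; the sign
    -- convention for forms plays no role here.
    (fun a b => by
      simp only [LinearMap.comp_apply, LinearMap.sub_apply, LinearMap.mulLeft_apply,
        LinearMap.mulRight_apply, AlgHom.toLinearMap_apply, map_mul, sub_mul, mul_sub, mul_assoc]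
      abel)

theorem bar_one : bar k A 1 = 0 := by
  rw [Submodule.mkQ_apply, Submodule.Quotient.mk_eq_zero]
  exact ⟨1, map_one (algebraMap k A)⟩

theorem NormalForm.action_of (a b : A) (y : TensorAlgebra k (Bar k A)) :
    NormalForm.action k A (Omega.of k a) (b ⊗ₜ y) = (a * b) ⊗ₜ y := by
  rw [NormalForm.action, Omega.lift_of, NormalForm.mulLeft_tmul]

/-- The second term of the commutator applies `d` to `1 ⊗ y` first, and this vanishes because `1` is
zero in `A / k`. -/
theorem NormalForm.action_dOf (a : A) (y : TensorAlgebra k (Bar k A)) :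
    NormalForm.action k A (Omega.dOf k a) (1 ⊗ₜ y) =
      1 ⊗ₜ (TensorAlgebra.ι k (bar k A a) * y) := by
  rw [NormalForm.action, Omega.lift_dOf]
  simp only [LinearMap.comp_apply, LinearMap.sub_apply, LinearMap.mulLeft_apply,
    LinearMap.mulRight_apply, AlgHom.toLinearMap_apply, Module.End.mul_apply,
    NormalForm.mulLeft_tmul, NormalForm.d_tmul, bar_one, map_zero, zero_mul,
    TensorProduct.tmul_zero, sub_zero, mul_one]

variable (k A) in
/-- The linear map `a₁ ⊗ ⋯ ⊗ a_n ↦ da₁ ⋯ da_n`. -/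
def dWords : TensorAlgebra k (Bar k A) →ₐ[k] Omega k A :=
  TensorAlgebra.lift k ((Omega.mk k A).toLinearMap ∘ₗ TensorAlgebra.ι k ∘ₗ
    LinearMap.inr k A (Bar k A))

theorem dWords_ι (a : A) : dWords k A (TensorAlgebra.ι k (bar k A a)) = Omega.dOf k a := by
  rw [dWords, TensorAlgebra.lift_ι_apply]; rfl

/-- The projection of `A / k` onto the complement of `k` given by a retraction `s : A → k`. -/
def barSection (s : A →ₗ[k] k) (hs : s 1 = 1) : Bar k A →ₗ[k] A :=
  Submodule.liftQ _ (LinearMap.id - (Algebra.linearMap k A) ∘ₗ s) (by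
    rintro _ ⟨c, rfl⟩
    simp [Algebra.algebraMap_eq_smul_one, hs])

theorem barSection_bar (s : A →ₗ[k] k) (hs : s 1 = 1) (a : A) :
    barSection s hs (bar k A a) = a - algebraMap k A (s a) := rfl

/-- The homomorphism of matrices whose upper right entry is
`a₁ ⊗ ⋯ ⊗ a_n ↦ (a₁ - s a₁) da₂ ⋯ da_n`. -/
def integrateHom (s : A →ₗ[k] k) (hs : s 1 = 1) :
    TensorAlgebra k (Bar k A) →ₐ[k] Matrix (Fin 2) (Fin 2) (Omega k A) :=
  TensorAlgebra.lift k
    -- The zero in the upper left corner makes the upper right entry of a product see only its first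
    -- letter: that letter loses its `d`, and all later ones keep theirs.
    { toFun := fun v => utri 0 (Omega.of k (barSection s hs v)) (dWords k A (TensorAlgebra.ι k v))
      map_add' := fun a b => by simp only [map_add, ← utri_add, add_zero]
      map_smul' := fun c b => by simp only [map_smul, ← utri_smul, smul_zero, RingHom.id_apply] }

theorem integrateHom_ι_mul (s : A →ₗ[k] k) (hs : s 1 = 1) (a : A)
    (y : TensorAlgebra k (Bar k A)) :
    integrateHom s hs (TensorAlgebra.ι k (bar k A a) * y) 0 1 =
      Omega.of k (a - algebraMap k A (s a)) * integrateHom s hs y 1 1 := by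
  rw [map_mul, integrateHom, TensorAlgebra.lift_ι_apply]
  simp [utri, Matrix.mul_apply, barSection_bar, -Submodule.mkQ_apply]

/-- The contracting homotopy of the forms on `A` given by a retraction `s : A → k`. -/
def homotopy (s : A →ₗ[k] k) (hs : s 1 = 1) : Omega k A →ₗ[k] Omega k A :=
  -- Acting on `1 ⊗ 1` turns a form into its normal form `a ⊗ y`, which is what makes a formula on
  -- the words `a₀ da₁ ⋯ da_n` well defined. The inverse map from normal forms to forms is not
  -- needed.
  TensorProduct.lift
      ((LinearMap.lsmul k (TensorAlgebra k (Bar k A) →ₗ[k] Omega k A)).flip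
        (Matrix.entryLinearMap k (Omega k A) 0 1 ∘ₗ (integrateHom s hs).toLinearMap) ∘ₗ s) ∘ₗ
    LinearMap.applyₗ (1 ⊗ₜ 1) ∘ₗ (NormalForm.action k A).toLinearMap

theorem homotopy_eq (s : A →ₗ[k] k) (hs : s 1 = 1) {x : Omega k A} {a : A}
    {y : TensorAlgebra k (Bar k A)} (h : NormalForm.action k A x (1 ⊗ₜ 1) = a ⊗ₜ y) :
    homotopy s hs x = s a • integrateHom s hs y 0 1 := by
  simp only [homotopy, LinearMap.comp_apply, AlgHom.toLinearMap_apply, LinearMap.applyₗ_apply_apply,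
    h]
  rfl

variable (k) in
/-- The products `da₁ ⋯ da_n`. -/
inductive IsExactWord : ℤ → Omega k A → Prop
  | one : IsExactWord 0 1
  | dOf_mul (a : A) {p : ℤ} {x : Omega k A} :
      IsExactWord p x → IsExactWord (p + 1) (Omega.dOf k a * x)

theorem IsExactWord.mem_deg {p : ℤ} {x : Omega k A} (hx : IsExactWord k p x) :
    x ∈ Omega.deg k A p := by
  induction hx with
  | one => exact Omega.one_mem_deg
  | dOf_mul a _ ih => exact Omega.dOf_mul_mem a ih

theorem IsExactWord.d_eq {p : ℤ} {x : Omega k A} (hx : IsExactWord k p x) :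
    Omega.d k A x = 0 := by
  induction hx with
  | one => exact Omega.d_one k A
  | dOf_mul a hx ih => rw [Omega.d_dOf_mul a hx.mem_deg, ih, mul_zero, neg_zero]

/-- The lower right entry of `integrateHom` rebuilds the form from its normal form, so the homotopy
can be evaluated on words without ever displaying the tensor `y`. -/
theorem IsExactWord.normalForm (s : A →ₗ[k] k) (hs : s 1 = 1) {p : ℤ} {x : Omega k A}
    (hx : IsExactWord k p x) : ∃ y : TensorAlgebra k (Bar k A),
      NormalForm.action k A x (1 ⊗ₜ 1) = 1 ⊗ₜ y ∧ integrateHom s hs y 1 1 = x := by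
  induction hx with
  | one => exact ⟨1, by simp, by simp⟩
  | @dOf_mul a p x hx ih =>
    obtain ⟨y, hy, e⟩ := ih
    refine ⟨TensorAlgebra.ι k (bar k A a) * y, ?_, ?_⟩
    · rw [map_mul, Module.End.mul_apply, hy, NormalForm.action_dOf]
    · rw [map_mul, integrateHom, TensorAlgebra.lift_ι_apply, ← integrateHom]
      simp [utri, Matrix.mul_apply, e, dWords_ι, -Submodule.mkQ_apply]

theorem homotopy_one (s : A →ₗ[k] k) (hs : s 1 = 1) : homotopy s hs 1 = 0 := by
  rw [homotopy_eq s hs (a := 1) (y := 1) (by simp)]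
  simp

theorem homotopy_of_mul (s : A →ₗ[k] k) (hs : s 1 = 1) (a : A) {p : ℤ} {x : Omega k A}
    (hx : IsExactWord k p x) :
    homotopy s hs (Omega.of k a * x) = s a • homotopy s hs x := by
  obtain ⟨y, hy, -⟩ := hx.normalForm s hs
  rw [homotopy_eq s hs hy, hs, one_smul, homotopy_eq s hs (a := a) (y := y)]
  rw [map_mul, Module.End.mul_apply, hy, NormalForm.action_of, mul_one]

theorem homotopy_dOf_mul (s : A →ₗ[k] k) (hs : s 1 = 1) (a : A) {p : ℤ} {x : Omega k A}
    (hx : IsExactWord k p x) :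
    homotopy s hs (Omega.dOf k a * x) = Omega.of k a * x - s a • x := by
  obtain ⟨y, hy, e⟩ := hx.normalForm s hs
  rw [homotopy_eq s hs (a := 1) (y := TensorAlgebra.ι k (bar k A a) * y), hs, one_smul,
    integrateHom_ι_mul, e, map_sub, AlgHom.commutes, sub_mul, Algebra.smul_def]
  rw [map_mul, Module.End.mul_apply, hy, NormalForm.action_dOf]

/-- Coefficients move to the left by `db · a = d(ba) - b · da`. -/
theorem Omega.deg_le_span (p : ℤ) : Omega.deg k A p ≤
    Submodule.span k {z | ∃ (a : A) (x : Omega k A), IsExactWord k p x ∧ z = Omega.of k a * x} := by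
  refine Submodule.span_le.2 fun z hz => ?_
  induction hz with
  | one => exact Submodule.subset_span ⟨1, 1, .one, by simp⟩
  | of_mul b _ ih =>
    refine mul_mem_span _ ?_ ih
    rintro _ ⟨a, x, hx, rfl⟩
    exact ⟨b * a, x, hx, by rw [map_mul, mul_assoc]⟩
  | @dOf_mul b p x _ ih =>
    have : Submodule.span k {z | ∃ (a : A) (x : Omega k A), IsExactWord k p x ∧
        z = Omega.of k a * x} ≤ (Submodule.span k {z | ∃ (a : A) (x : Omega k A),
          IsExactWord k (p + 1) x ∧ z = Omega.of k a * x}).comap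
            (LinearMap.mulLeft k (Omega.dOf k b)) := by
      refine Submodule.span_le.2 ?_
      rintro _ ⟨a, x, hx, rfl⟩
      have e : Omega.dOf k b * (Omega.of k a * x) = Omega.of k 1 * (Omega.dOf k (b * a) * x) -
          Omega.of k b * (Omega.dOf k a * x) := by
        rw [Omega.dOf_mul, map_one]; noncomm_ring
      rw [SetLike.mem_coe, Submodule.mem_comap, LinearMap.mulLeft_apply, e]
      exact sub_mem (Submodule.subset_span ⟨1, _, .dOf_mul _ hx, rfl⟩)
        (Submodule.subset_span ⟨b, _, .dOf_mul _ hx, rfl⟩)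
    exact this ih

theorem IsExactWord.cases_zero {p : ℤ} {x : Omega k A} (hx : IsExactWord k p x) :
    (p = 0 ∧ x = 1) ∨ ∃ (a : A) (y : Omega k A), IsExactWord k (p - 1) y ∧
      x = Omega.dOf k a * y := by
  cases hx with
  | one => exact .inl ⟨rfl, rfl⟩
  | dOf_mul a hx => exact .inr ⟨a, _, by simpa using hx, rfl⟩

theorem homotopy_mem (s : A →ₗ[k] k) (hs : s 1 = 1) {p : ℤ} {x : Omega k A}
    (hx : x ∈ Omega.deg k A p) : homotopy s hs x ∈ Omega.deg k A (p - 1) := by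
  have h : Submodule.span k {z | ∃ (a : A) (x : Omega k A), IsExactWord k p x ∧
      z = Omega.of k a * x} ≤ (Omega.deg k A (p - 1)).comap (homotopy s hs) := by
    refine Submodule.span_le.2 ?_
    rintro _ ⟨a, x, hx, rfl⟩
    rw [SetLike.mem_coe, Submodule.mem_comap, homotopy_of_mul s hs a hx]
    refine Submodule.smul_mem _ _ ?_
    rcases hx.cases_zero with ⟨rfl, rfl⟩ | ⟨b, y, hy, rfl⟩
    · rw [homotopy_one]; exact zero_mem _
    · rw [homotopy_dOf_mul s hs b hy]
      exact sub_mem (Omega.of_mul_mem b hy.mem_deg) (Submodule.smul_mem _ _ hy.mem_deg)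
  exact h (Omega.deg_le_span p hx)

/-- The defect `x - d h x` vanishes when `x = db · y`, because `h x = (b - s(b)) y` and `y` is
closed; for `x = 1` it is `1`. Thus `d h + h d` fails to be the identity only through the constant
`s(a)` in degree zero. -/
theorem homotopy_d (s : A →ₗ[k] k) (hs : s 1 = 1) (a : A) {p : ℤ} {x : Omega k A}
    (hx : IsExactWord k p x) :
    Omega.d k A (homotopy s hs (Omega.of k a * x)) + homotopy s hs (Omega.d k A (Omega.of k a * x))
      = Omega.of k a * x - s a • (x - Omega.d k A (homotopy s hs x)) := by
  rw [homotopy_of_mul s hs a hx, Omega.d_of_mul a hx.mem_deg, hx.d_eq, mul_zero, zero_add,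
    homotopy_dOf_mul s hs a hx, map_smul, smul_sub]
  abel

/-- The forms are spanned by `1` and the forms on which `d h + h d` is the identity. -/
theorem Omega.deg_le_one_sup (s : A →ₗ[k] k) (hs : s 1 = 1) (p : ℤ) : Omega.deg k A p ≤
    Submodule.span k ({z | p = 0 ∧ z = 1} ∪ {w | w ∈ Omega.deg k A p ∧
      Omega.d k A (homotopy s hs w) + homotopy s hs (Omega.d k A w) = w}) := by
  refine (Omega.deg_le_span p).trans (Submodule.span_le.2 ?_)
  rintro _ ⟨a, x, hx, rfl⟩
  rcases hx.cases_zero with ⟨rfl, rfl⟩ | ⟨b, y, hy, rfl⟩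
  -- In degree zero, split `a` along `A = ker s ⊕ k`: the homotopy identity holds on the first part,
  -- and the second is a multiple of `1`.
  · have e : Omega.of k a * 1 = (Omega.of k a - s a • 1) + s a • 1 := by simp
    rw [e]
    refine add_mem (Submodule.subset_span (.inr ⟨sub_mem (Omega.of_mem a)
      (Submodule.smul_mem _ _ Omega.one_mem_deg), ?_⟩))
      (Submodule.smul_mem _ _ (Submodule.subset_span (.inl ⟨rfl, rfl⟩)))
    have h := homotopy_d s hs a (IsExactWord.one (k := k) (A := A))
    simp only [mul_one, homotopy_one, map_zero, sub_zero] at h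
    simp only [map_sub, map_smul, homotopy_one, Omega.d_one, smul_zero, sub_zero, h]
  · refine Submodule.subset_span (.inr ⟨Omega.of_mul_mem a hx.mem_deg, ?_⟩)
    rw [homotopy_d s hs a hx, homotopy_dOf_mul s hs b hy, map_sub, Omega.d_of_mul b hy.mem_deg,
      map_smul, hy.d_eq]
    simp

end Homotopy

/-! ### Maps on `Ω_t` defined by recursion on the first `t`, and the homotopy on linear words. -/

section Recursion

open TensorProduct

variable {k : Type u} [CommRing k] {A : Type v} [Ring A] [Algebra k A]

variable {N : Type*} [AddCommGroup N] [Module k N]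

/-- The action of `Ω_t` on `Ω_t × N` which encodes a linear map `F : Ω_t → N` given recursively by
`F 1 = 0`, `F (w x) = w F x` for `w` in `Ω A` and `F (t x) = α x + γ (F x)`. -/
def OmegaT.recHom (ρ : Omega k A →ₐ[k] Module.End k N) (α : OmegaT k A →ₗ[k] N) (γ : N →ₗ[k] N) :
    OmegaT k A →ₐ[k] Module.End k (OmegaT k A × N) :=
  OmegaT.liftForms
    ((LinearMap.prodMapAlgHom k (OmegaT k A) N).comp
      (((Algebra.lmul k (OmegaT k A)).comp (OmegaT.incl k A)).prod ρ))
    -- The first coordinate carries the word read so far, from right to left, because `α` needs the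
    -- whole remaining word and not only the value of the recursion on it.
    (LinearMap.prod (LinearMap.mulLeft k (OmegaT.t k A) ∘ₗ LinearMap.fst k _ _)
      (α ∘ₗ LinearMap.fst k _ _ + γ ∘ₗ LinearMap.snd k _ _))

theorem OmegaT.recHom_incl (ρ : Omega k A →ₐ[k] Module.End k N) (α : OmegaT k A →ₗ[k] N)
    (γ : N →ₗ[k] N) (w : Omega k A) (v : OmegaT k A × N) :
    OmegaT.recHom ρ α γ (OmegaT.incl k A w) v = (OmegaT.incl k A w * v.1, ρ w v.2) := by
  rw [OmegaT.recHom, OmegaT.liftForms_incl]; rfl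

theorem OmegaT.recHom_t (ρ : Omega k A →ₐ[k] Module.End k N) (α : OmegaT k A →ₗ[k] N)
    (γ : N →ₗ[k] N) (v : OmegaT k A × N) :
    OmegaT.recHom ρ α γ (OmegaT.t k A) v = (OmegaT.t k A * v.1, α v.1 + γ v.2) := by
  rw [OmegaT.recHom, OmegaT.liftForms_t]; rfl

theorem OmegaT.recHom_fst (ρ : Omega k A →ₐ[k] Module.End k N) (α : OmegaT k A →ₗ[k] N)
    (γ : N →ₗ[k] N) (x : OmegaT k A) (v : OmegaT k A × N) :
    (OmegaT.recHom ρ α γ x v).1 = x * v.1 := by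
  let V : Subalgebra k (OmegaT k A) :=
    { carrier := {x | ∀ v, (OmegaT.recHom ρ α γ x v).1 = x * v.1}
      mul_mem' := fun {a b} ha hb v => by
        rw [map_mul, Module.End.mul_apply, ha, hb, mul_assoc]
      add_mem' := fun {a b} ha hb v => by
        rw [map_add, LinearMap.add_apply, Prod.fst_add, ha, hb, add_mul]
      algebraMap_mem' := fun r v => by
        rw [AlgHom.commutes, Module.algebraMap_end_apply, Prod.smul_fst, Algebra.smul_def] }
  have h : V = ⊤ := OmegaT.subalgebra_eq_top V
    (fun a v => by rw [← OmegaT.incl_of, OmegaT.recHom_incl])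
    (fun a v => by rw [← OmegaT.incl_dOf, OmegaT.recHom_incl])
    (fun v => by rw [OmegaT.recHom_t])
  have hx : x ∈ V := h ▸ Algebra.mem_top
  exact hx v

/-- The linear map `F : Ω_t → N` with `F 1 = 0`, `F (w x) = w F x` for `w` in `Ω A` and
`F (t x) = α x + γ (F x)`. -/
def OmegaT.recMap (ρ : Omega k A →ₐ[k] Module.End k N) (α : OmegaT k A →ₗ[k] N) (γ : N →ₗ[k] N) :
    OmegaT k A →ₗ[k] N :=
  LinearMap.snd k _ _ ∘ₗ LinearMap.applyₗ (1, 0) ∘ₗ (OmegaT.recHom ρ α γ).toLinearMap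

theorem OmegaT.recMap_apply (ρ : Omega k A →ₐ[k] Module.End k N) (α : OmegaT k A →ₗ[k] N)
    (γ : N →ₗ[k] N) (x : OmegaT k A) :
    OmegaT.recMap ρ α γ x = (OmegaT.recHom ρ α γ x (1, 0)).2 := rfl

theorem OmegaT.recMap_incl (ρ : Omega k A →ₐ[k] Module.End k N) (α : OmegaT k A →ₗ[k] N)
    (γ : N →ₗ[k] N) (w : Omega k A) : OmegaT.recMap ρ α γ (OmegaT.incl k A w) = 0 := by
  rw [OmegaT.recMap_apply, OmegaT.recHom_incl, map_zero]

theorem OmegaT.recMap_incl_mul (ρ : Omega k A →ₐ[k] Module.End k N) (α : OmegaT k A →ₗ[k] N)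
    (γ : N →ₗ[k] N) (w : Omega k A) (x : OmegaT k A) :
    OmegaT.recMap ρ α γ (OmegaT.incl k A w * x) = ρ w (OmegaT.recMap ρ α γ x) := by
  rw [OmegaT.recMap_apply, map_mul, Module.End.mul_apply, OmegaT.recHom_incl,
    ← OmegaT.recMap_apply]

theorem OmegaT.recMap_t_mul (ρ : Omega k A →ₐ[k] Module.End k N) (α : OmegaT k A →ₗ[k] N)
    (γ : N →ₗ[k] N) (x : OmegaT k A) :
    OmegaT.recMap ρ α γ (OmegaT.t k A * x) = α x + γ (OmegaT.recMap ρ α γ x) := by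
  rw [OmegaT.recMap_apply, map_mul, Module.End.mul_apply, OmegaT.recHom_t, OmegaT.recHom_fst,
    ← OmegaT.recMap_apply, mul_one]

variable (k A) in
/-- The map `w t z ↦ w ⊗ z` which splits a form at its first `t`; it vanishes on `Ω A`. -/
def OmegaT.splitFirst : OmegaT k A →ₗ[k] Omega k A ⊗[k] OmegaT k A :=
  -- With last argument `0` the splittings at later letters `t` are forgotten; only the first `t`
  -- contributes.
  OmegaT.recMap ((Module.End.rTensorAlgHom k (Omega k A) (OmegaT k A)).comp
    (Algebra.lmul k (Omega k A))) (TensorProduct.mk k _ _ 1) 0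

theorem OmegaT.splitFirst_incl (w : Omega k A) :
    OmegaT.splitFirst k A (OmegaT.incl k A w) = 0 :=
  OmegaT.recMap_incl _ _ _ w

theorem OmegaT.splitFirst_incl_mul (w : Omega k A) (z : OmegaT k A) :
    OmegaT.splitFirst k A (OmegaT.incl k A w * (OmegaT.t k A * z)) = w ⊗ₜ z := by
  rw [OmegaT.splitFirst, OmegaT.recMap_incl_mul, OmegaT.recMap_t_mul, LinearMap.zero_apply,
    add_zero]
  change (w * 1) ⊗ₜ[k] z = w ⊗ₜ[k] z
  rw [mul_one]

variable (k A) in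
/-- The parity involution of `Ω A`. -/
def Omega.parity : Omega k A →ₐ[k] Omega k A :=
  Omega.lift (Omega.of k) (-Omega.dOf k) (fun a b => by
    simp only [LinearMap.neg_apply, Omega.dOf_mul, neg_add, neg_mul, mul_neg])

theorem Omega.parity_eq {p : ℤ} {x : Omega k A} (hx : x ∈ Omega.deg k A p) :
    Omega.parity k A x = p.negOnePow • x := by
  induction hx using Submodule.span_induction with
  | mem x hx =>
    induction hx with
    | one => simp
    | of_mul a _ ih => rw [map_mul, ih, Omega.parity, Omega.lift_of, mul_smul_comm]
    | dOf_mul a _ ih =>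
      rw [map_mul, ih, Omega.parity, Omega.lift_dOf, mul_smul_comm, LinearMap.neg_apply, neg_mul,
        Int.negOnePow_succ, Units.neg_smul, smul_neg]
  | zero => simp
  | add x x' _ _ h h' => rw [map_add, h, h', smul_add]
  | smul c x _ h => rw [map_smul, h, negOnePow_smul_comm]

variable (k A) in
/-- The parity involution of `Ω_t A`. -/
def OmegaT.parity : OmegaT k A →ₗ[k] OmegaT k A :=
  Matrix.entryLinearMap k (OmegaT k A) 0 0 ∘ₗ (OmegaT.dHom k A).toLinearMap

theorem OmegaT.parity_eq {p : ℤ} {q : ℕ} {x : OmegaT k A} (hx : x ∈ OmegaT.deg k A (p, q)) :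
    OmegaT.parity k A x = p.negOnePow • x := by
  change OmegaT.dHom k A x 0 0 = _
  rw [OmegaT.dHom_eq hx]
  rfl

variable (s : A →ₗ[k] k) (hs : s 1 = 1)

/-- The homotopy of `Ω A`, applied to the first block of a form `w₀ t w₁ ⋯ t w_q`. -/
def OmegaT.homotopyFirst : OmegaT k A →ₗ[k] OmegaT k A :=
  (OmegaT.incl k A).toLinearMap ∘ₗ homotopy s hs ∘ₗ (OmegaT.modT k A).toLinearMap +
    TensorProduct.lift ((LinearMap.mul k (OmegaT k A)).compl₁₂
      ((OmegaT.incl k A).toLinearMap ∘ₗ homotopy s hs) (LinearMap.mulLeft k (OmegaT.t k A))) ∘ₗ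
        OmegaT.splitFirst k A

theorem OmegaT.homotopyFirst_incl (w : Omega k A) :
    OmegaT.homotopyFirst s hs (OmegaT.incl k A w) = OmegaT.incl k A (homotopy s hs w) := by
  simp [OmegaT.homotopyFirst, OmegaT.modT_incl, OmegaT.splitFirst_incl]

theorem OmegaT.homotopyFirst_incl_mul (w : Omega k A) (z : OmegaT k A) :
    OmegaT.homotopyFirst s hs (OmegaT.incl k A w * (OmegaT.t k A * z)) =
      OmegaT.incl k A (homotopy s hs w) * (OmegaT.t k A * z) := by
  simp [OmegaT.homotopyFirst, OmegaT.splitFirst_incl_mul, OmegaT.modT_t]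

/-- The homotopy of `Ω A`, applied to each block of a form `w₀ t w₁ ⋯ t w_q`. -/
def OmegaT.homotopyBlocks : OmegaT k A →ₗ[k] OmegaT k A :=
  OmegaT.homotopyFirst s hs +
    OmegaT.recMap ((Algebra.lmul k (OmegaT k A)).comp ((OmegaT.incl k A).comp (Omega.parity k A)))
      (LinearMap.mulLeft k (OmegaT.t k A) ∘ₗ OmegaT.homotopyFirst s hs)
      (LinearMap.mulLeft k (OmegaT.t k A))

theorem OmegaT.homotopyBlocks_incl (w : Omega k A) :
    OmegaT.homotopyBlocks s hs (OmegaT.incl k A w) = OmegaT.incl k A (homotopy s hs w) := by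
  rw [OmegaT.homotopyBlocks, LinearMap.add_apply, OmegaT.homotopyFirst_incl, OmegaT.recMap_incl,
    add_zero]

/-- The recursion that characterizes `homotopyBlocks`. The parity of `w` is the Koszul sign for
passing an odd operator across the first block. -/
theorem OmegaT.homotopyBlocks_incl_mul (w : Omega k A) (z : OmegaT k A) :
    OmegaT.homotopyBlocks s hs (OmegaT.incl k A w * (OmegaT.t k A * z)) =
      OmegaT.incl k A (homotopy s hs w) * (OmegaT.t k A * z) +
      OmegaT.incl k A (Omega.parity k A w) *
        (OmegaT.t k A * OmegaT.homotopyBlocks s hs z) := by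
  rw [OmegaT.homotopyBlocks, LinearMap.add_apply, OmegaT.homotopyFirst_incl_mul,
    OmegaT.recMap_incl_mul, OmegaT.recMap_t_mul]
  simp [mul_add]

theorem OmegaT.homotopyBlocks_t_mul (z : OmegaT k A) :
    OmegaT.homotopyBlocks s hs (OmegaT.t k A * z) =
      OmegaT.t k A * OmegaT.homotopyBlocks s hs z := by
  simpa [homotopy_one] using OmegaT.homotopyBlocks_incl_mul s hs 1 z

theorem OmegaT.homotopyBlocks_mem {p : ℤ} {q : ℕ} {x : OmegaT k A}
    (hx : x ∈ OmegaT.deg k A (p, q)) :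
    OmegaT.homotopyBlocks s hs x ∈ OmegaT.deg k A (p - 1, q) := by
  refine OmegaT.deg_le_of_blocks
    (fun p q => (OmegaT.deg k A (p - 1, q)).comap (OmegaT.homotopyBlocks s hs)) ?_ ?_ p q hx
  · intro p w hw
    rw [Submodule.mem_comap, OmegaT.homotopyBlocks_incl]
    exact OmegaT.incl_mem (homotopy_mem s hs hw)
  · intro p p' q w hw x hx ih
    rw [Submodule.mem_comap, OmegaT.homotopyBlocks_incl_mul, Omega.parity_eq hw]
    refine add_mem ?_ ?_
    · have h := OmegaT.mul_mem (OmegaT.incl_mem (homotopy_mem s hs hw)) (OmegaT.t_mul_mem hx)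
      rwa [zero_add, sub_add_eq_add_sub] at h
    · have h := OmegaT.mul_mem (OmegaT.incl_mem hw) (OmegaT.t_mul_mem (Submodule.mem_comap.1 ih))
      rw [zero_add, ← add_sub_assoc] at h
      rcases Int.units_eq_one_or p.negOnePow with e | e
      · rwa [e, one_smul]
      · rw [e, Units.neg_smul, one_smul, map_neg, neg_mul]
        exact neg_mem h

theorem map_negOnePow_smul {M M' : Type*} [AddCommGroup M] [AddCommGroup M']
    {F : Type*} [FunLike F M M'] [AddMonoidHomClass F M M'] (f : F) (p : ℤ) (x : M) :
    f (p.negOnePow • x) = p.negOnePow • f x := by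
  rcases Int.units_eq_one_or p.negOnePow with e | e <;> simp [e, Units.neg_smul]

/-- The recursion at the first `t` propagates to a Leibniz rule at an arbitrary `t` of the word.
This is what allows a cyclic word to be cut at different letters `t`; a cut inside a block is not
covered. -/
theorem OmegaT.homotopyBlocks_mul_t_mul {p : ℤ} {q : ℕ} {x : OmegaT k A}
    (hx : x ∈ OmegaT.deg k A (p, q)) (z : OmegaT k A) :
    OmegaT.homotopyBlocks s hs (x * (OmegaT.t k A * z)) =
      OmegaT.homotopyBlocks s hs x * (OmegaT.t k A * z) +
      p.negOnePow • (x * (OmegaT.t k A * OmegaT.homotopyBlocks s hs z)) := by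
  let S (p : ℤ) (_ : ℕ) : Submodule k (OmegaT k A) :=
    { carrier := {x | OmegaT.homotopyBlocks s hs (x * (OmegaT.t k A * z)) =
        OmegaT.homotopyBlocks s hs x * (OmegaT.t k A * z) +
        p.negOnePow • (x * (OmegaT.t k A * OmegaT.homotopyBlocks s hs z))}
      add_mem' := fun {a b} ha hb => by
        change _ = _ at ha hb
        change _ = _
        rw [add_mul, map_add, ha, hb, map_add, add_mul, add_mul, smul_add]
        abel
      zero_mem' := by simp
      smul_mem' := fun c x hx => by
        change _ = _ at hx
        change _ = _
        rw [smul_mul_assoc, map_smul, hx, map_smul, smul_mul_assoc, smul_mul_assoc,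
          negOnePow_smul_comm, smul_add] }
  refine OmegaT.deg_le_of_blocks S ?_ ?_ p q hx
  · intro p w hw
    change _ = _
    rw [OmegaT.homotopyBlocks_incl_mul, OmegaT.homotopyBlocks_incl, Omega.parity_eq hw,
      map_negOnePow_smul, smul_mul_assoc]
  · intro p p' q w hw x hx ih
    change _ = _ at ih
    change _ = _
    rw [mul_assoc, mul_assoc, OmegaT.homotopyBlocks_incl_mul, ih,
      OmegaT.homotopyBlocks_incl_mul, Omega.parity_eq hw, map_negOnePow_smul,
      Int.negOnePow_add, mul_smul]
    simp only [smul_mul_assoc, mul_add, mul_smul_comm, add_mul, mul_assoc, add_assoc]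
    rw [smul_comm p.negOnePow p'.negOnePow]

end Recursion

/-! ### Descent of the homotopy to cyclic words. -/

section CyclicHomotopy

open TensorProduct

variable {k : Type u} [CommRing k] {A : Type v} [Ring A] [Algebra k A]

variable (k A) in
/-- The class of an extended form in the reduced extended de Rham complex. -/
def oDRt.cls : OmegaT k A →ₗ[k] oDRt k A := (oDRt.rel k A).mkQ

theorem oDRt.cls_mul_comm {p p' : ℤ} {q q' : ℕ} {x y : OmegaT k A}
    (hx : x ∈ OmegaT.deg k A (p, q)) (hy : y ∈ OmegaT.deg k A (p', q')) :
    oDRt.cls k A (x * y) = (p * p').negOnePow • oDRt.cls k A (y * x) := by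
  rw [← map_negOnePow_smul, ← sub_eq_zero, ← map_sub]
  exact (Submodule.Quotient.mk_eq_zero _).2
    (Submodule.mem_sup_left (Submodule.subset_span ⟨_, _, x, hx, y, hy, rfl⟩))

theorem oDRt.cls_t_pow (n : ℕ) : oDRt.cls k A (OmegaT.t k A ^ n) = 0 :=
  (Submodule.Quotient.mk_eq_zero _).2
    (Submodule.mem_sup_right ⟨Polynomial.X ^ n, by simp⟩)

theorem negOnePow_congr {a b : ℤ} (h : Even (a - b)) : a.negOnePow = b.negOnePow :=
  (Int.negOnePow_eq_iff a b).2 h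

theorem oDRt.d_cls (x : OmegaT k A) :
    oDRt.d k A (oDRt.cls k A x) = oDRt.cls k A (OmegaT.d k A x) := rfl

theorem OmegaT.homotopyBlocks_t_pow (s : A →ₗ[k] k) (hs : s 1 = 1) (n : ℕ) :
    OmegaT.homotopyBlocks s hs (OmegaT.t k A ^ n) = 0 := by
  induction n with
  | zero => simpa [homotopy_one] using OmegaT.homotopyBlocks_incl s hs 1
  | succ n ih => rw [pow_succ', OmegaT.homotopyBlocks_t_mul, ih, mul_zero]

variable [Algebra ℚ k]

variable (k A) in
/-- The product in the opposite order, with the sign of the transposition. -/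
def OmegaT.signedSwap : Omega k A →ₗ[k] OmegaT k A →ₗ[k] OmegaT k A :=
  let m : Omega k A →ₗ[k] OmegaT k A →ₗ[k] OmegaT k A :=
    (LinearMap.mul k (OmegaT k A)).flip ∘ₗ (OmegaT.incl k A).toLinearMap
  let m' := m ∘ₗ (Omega.parity k A).toLinearMap
  algebraMap ℚ k (1 / 2) • (m + m.compl₂ (OmegaT.parity k A) + m' - m'.compl₂ (OmegaT.parity k A))

/-- For signs `ε = (-1)^p` and `ε' = (-1)^p'` one has `(-1)^(p p') = (1 + ε + ε' - ε ε') / 2`.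
Written with the parity involutions, the signed swap is bilinear on all forms, so it factors through
the tensor product without reference to degrees. -/
theorem OmegaT.signedSwap_apply {p p' : ℤ} {q : ℕ} {w : Omega k A} (hw : w ∈ Omega.deg k A p)
    {z : OmegaT k A} (hz : z ∈ OmegaT.deg k A (p', q)) :
    OmegaT.signedSwap k A w z = (p * p').negOnePow • (z * OmegaT.incl k A w) := by
  have h2 (y : OmegaT k A) : algebraMap ℚ k (1 / 2) • (y + y) = y := by
    rw [← two_smul k y, smul_smul]
    have : algebraMap ℚ k (1 / 2) * 2 = 1 := by
      rw [← map_ofNat (algebraMap ℚ k) 2, ← map_mul]; norm_num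
    rw [this, one_smul]
  have e : OmegaT.signedSwap k A w z = algebraMap ℚ k (1 / 2) •
      (z * OmegaT.incl k A w + OmegaT.parity k A z * OmegaT.incl k A w
        + z * OmegaT.incl k A (Omega.parity k A w)
        - OmegaT.parity k A z * OmegaT.incl k A (Omega.parity k A w)) := rfl
  rw [e, OmegaT.parity_eq hz, Omega.parity_eq hw, map_negOnePow_smul]
  rcases Int.even_or_odd p with hp | hp <;> rcases Int.even_or_odd p' with hp' | hp'
  · rw [Int.negOnePow_even _ hp, Int.negOnePow_even _ hp', Int.negOnePow_even _ (hp.mul_right _)]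
    simp only [one_smul]
    rw [add_sub_cancel_right, h2]
  · rw [Int.negOnePow_even _ hp, Int.negOnePow_odd _ hp', Int.negOnePow_even _ (hp.mul_right _)]
    simp only [one_smul, Units.neg_smul, neg_mul]
    rw [add_neg_cancel, zero_add, sub_neg_eq_add, h2]
  · rw [Int.negOnePow_odd _ hp, Int.negOnePow_even _ hp', Int.negOnePow_even _ (hp'.mul_left _)]
    simp only [one_smul, Units.neg_smul, mul_neg]
    rw [add_neg_cancel_right, sub_neg_eq_add, h2]
  · rw [Int.negOnePow_odd _ hp, Int.negOnePow_odd _ hp', Int.negOnePow_odd _ (hp.mul hp')]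
    simp only [one_smul, Units.neg_smul, mul_neg, neg_mul, neg_neg]
    have h := h2 (-(z * OmegaT.incl k A w))
    rw [← sub_eq_add_neg] at h
    rw [add_neg_cancel, zero_add, h]

variable (s : A →ₗ[k] k) (hs : s 1 = 1)

/-- The homotopy on cyclic words in `Ω A`, on `Ω_t`: it sends `t x` to the class of `t E x`, where
`E` is the homotopy of `Ω A` applied to each block. -/
def OmegaT.cyclicHomotopy : OmegaT k A →ₗ[k] oDRt k A :=
  TensorProduct.lift ((OmegaT.signedSwap k A).compr₂
    (oDRt.cls k A ∘ₗ LinearMap.mulLeft k (OmegaT.t k A) ∘ₗ OmegaT.homotopyBlocks s hs)) ∘ₗ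
      OmegaT.splitFirst k A

theorem OmegaT.cyclicHomotopy_incl (w : Omega k A) :
    OmegaT.cyclicHomotopy s hs (OmegaT.incl k A w) = 0 := by
  rw [OmegaT.cyclicHomotopy, LinearMap.comp_apply, OmegaT.splitFirst_incl, map_zero]

theorem OmegaT.cyclicHomotopy_incl_mul {p p' : ℤ} {q : ℕ} {w : Omega k A}
    (hw : w ∈ Omega.deg k A p) {z : OmegaT k A} (hz : z ∈ OmegaT.deg k A (p', q)) :
    OmegaT.cyclicHomotopy s hs (OmegaT.incl k A w * (OmegaT.t k A * z)) =
      (p * p').negOnePow • oDRt.cls k A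
        (OmegaT.t k A * OmegaT.homotopyBlocks s hs (z * OmegaT.incl k A w)) := by
  rw [OmegaT.cyclicHomotopy, LinearMap.comp_apply, OmegaT.splitFirst_incl_mul,
    TensorProduct.lift.tmul, LinearMap.compr₂_apply, OmegaT.signedSwap_apply hw hz,
    map_negOnePow_smul]
  rfl

theorem OmegaT.cyclicHomotopy_t_mul {p : ℤ} {q : ℕ} {z : OmegaT k A}
    (hz : z ∈ OmegaT.deg k A (p, q)) :
    OmegaT.cyclicHomotopy s hs (OmegaT.t k A * z) =
      oDRt.cls k A (OmegaT.t k A * OmegaT.homotopyBlocks s hs z) := by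
  simpa using OmegaT.cyclicHomotopy_incl_mul s hs Omega.one_mem_deg hz

/-- Both `w · w' t x` and `w' t x · w` are rotated to the same word `t x w w'`, so only signs have
to be compared. -/
theorem OmegaT.cyclicHomotopy_incl_comm {p p' : ℤ} {q : ℕ} {w : Omega k A}
    (hw : w ∈ Omega.deg k A p) {y : OmegaT k A} (hy : y ∈ OmegaT.deg k A (p', q)) :
    OmegaT.cyclicHomotopy s hs (OmegaT.incl k A w * y) =
      (p * p').negOnePow • OmegaT.cyclicHomotopy s hs (y * OmegaT.incl k A w) := by
  let S (p' : ℤ) (_ : ℕ) : Submodule k (OmegaT k A) :=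
    { carrier := {y | OmegaT.cyclicHomotopy s hs (OmegaT.incl k A w * y) =
        (p * p').negOnePow • OmegaT.cyclicHomotopy s hs (y * OmegaT.incl k A w)}
      add_mem' := fun {a b} ha hb => by
        change _ = _ at ha hb
        change _ = _
        rw [mul_add, map_add, ha, hb, add_mul, map_add, smul_add]
      zero_mem' := by simp
      smul_mem' := fun c x hx => by
        change _ = _ at hx
        change _ = _
        rw [mul_smul_comm, map_smul, hx, smul_mul_assoc, map_smul, negOnePow_smul_comm] }
  refine OmegaT.deg_le_of_blocks S ?_ ?_ p' q hy
  · intro p' w' hw'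
    change _ = _
    rw [← map_mul, ← map_mul, OmegaT.cyclicHomotopy_incl, OmegaT.cyclicHomotopy_incl, smul_zero]
  · intro p₁ p₂ q w' hw' x hx _
    change _ = _
    have hx' : x * OmegaT.incl k A w ∈ OmegaT.deg k A (p₂ + p, q + 0) :=
      OmegaT.mul_mem hx (OmegaT.incl_mem hw)
    rw [← mul_assoc, ← map_mul, mul_assoc, mul_assoc,
      OmegaT.cyclicHomotopy_incl_mul s hs (Omega.mul_mem hw hw') hx,
      OmegaT.cyclicHomotopy_incl_mul s hs hw' hx', map_mul (OmegaT.incl k A), mul_assoc, smul_smul,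
      ← Int.negOnePow_add]
    congr 1
    refine negOnePow_congr ⟨-(p * p₁), by ring⟩

/-- The heart of the descent: a cyclic word `t w t z` may be opened at either `t`. One choice gives
`t h(w) t z ± t w t E(z)`, the other `t E(z) t w ± t z t h(w)` up to a sign, and these agree in the
quotient by supercommutators. -/
theorem OmegaT.cyclicHomotopy_t_comm {p : ℤ} {q : ℕ} {y : OmegaT k A}
    (hy : y ∈ OmegaT.deg k A (p, q)) :
    OmegaT.cyclicHomotopy s hs (OmegaT.t k A * y) =
      OmegaT.cyclicHomotopy s hs (y * OmegaT.t k A) := by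
  let S (_ : ℤ) (_ : ℕ) : Submodule k (OmegaT k A) :=
    LinearMap.eqLocus (OmegaT.cyclicHomotopy s hs ∘ₗ LinearMap.mulLeft k (OmegaT.t k A))
      (OmegaT.cyclicHomotopy s hs ∘ₗ LinearMap.mulRight k (OmegaT.t k A))
  refine OmegaT.deg_le_of_blocks S ?_ ?_ p q hy
  · intro p w hw
    change OmegaT.cyclicHomotopy s hs (OmegaT.t k A * OmegaT.incl k A w) =
      OmegaT.cyclicHomotopy s hs (OmegaT.incl k A w * OmegaT.t k A)
    have h := OmegaT.cyclicHomotopy_incl_mul s hs hw (OmegaT.one_mem_deg (k := k) (A := A))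
    rw [OmegaT.cyclicHomotopy_t_mul s hs (OmegaT.incl_mem hw)]
    simpa using h.symm
  · intro p p' q w hw z hz _
    change OmegaT.cyclicHomotopy s hs (OmegaT.t k A * (OmegaT.incl k A w * (OmegaT.t k A * z))) =
      OmegaT.cyclicHomotopy s hs (OmegaT.incl k A w * (OmegaT.t k A * z) * OmegaT.t k A)
    have hw' := OmegaT.incl_mem hw
    have hh := OmegaT.incl_mem (homotopy_mem s hs hw)
    have hE := OmegaT.homotopyBlocks_mem s hs hz
    rw [OmegaT.cyclicHomotopy_t_mul s hs (OmegaT.mul_mem hw' (OmegaT.t_mul_mem hz)), mul_assoc,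
      mul_assoc, OmegaT.cyclicHomotopy_incl_mul s hs hw (OmegaT.mul_mem hz OmegaT.t_mem),
      mul_assoc z, OmegaT.homotopyBlocks_mul_t_mul s hs hz, OmegaT.homotopyBlocks_incl_mul,
      OmegaT.homotopyBlocks_incl, Omega.parity_eq hw, map_negOnePow_smul, mul_add, map_add,
      mul_add, mul_add,
      map_add, smul_mul_assoc, mul_smul_comm, mul_smul_comm, map_negOnePow_smul,
      map_negOnePow_smul, smul_add, smul_smul, ← Int.negOnePow_add]
    -- The two terms are matched by exchanging `t h(w)` with `t z`, and `t w` with `t E(z)`.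
    have e1 := oDRt.cls_mul_comm (OmegaT.t_mul_mem hh) (OmegaT.t_mul_mem hz)
    have e2 := oDRt.cls_mul_comm (OmegaT.t_mul_mem hw') (OmegaT.t_mul_mem hE)
    simp only [mul_assoc] at e1 e2
    rw [e1, e2, smul_smul, ← Int.negOnePow_add, add_comm]
    congr 2
    · refine negOnePow_congr ⟨0, by ring⟩
    · refine negOnePow_congr ⟨-p', by ring⟩

theorem OmegaT.cyclicHomotopy_comm {p p' : ℤ} {q q' : ℕ} {x y : OmegaT k A}
    (hx : x ∈ OmegaT.deg k A (p, q)) (hy : y ∈ OmegaT.deg k A (p', q')) :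
    OmegaT.cyclicHomotopy s hs (x * y) =
      (p * p').negOnePow • OmegaT.cyclicHomotopy s hs (y * x) := by
  -- If letters `g` and a word `x` can each be moved cyclically past everything, so can `g x`: move
  -- `g` first, then `x`. Commutation with the generators therefore suffices.
  have hstep {g x y : OmegaT k A} {p₀ p p' : ℤ} {q₀ q q' : ℕ} (hg : g ∈ OmegaT.deg k A (p₀, q₀))
      (hgy : ∀ p q, ∀ y ∈ OmegaT.deg k A (p, q), OmegaT.cyclicHomotopy s hs (g * y) =
        (p₀ * p).negOnePow • OmegaT.cyclicHomotopy s hs (y * g))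
      (hx : x ∈ OmegaT.deg k A (p, q))
      (ih : ∀ p' q', ∀ y ∈ OmegaT.deg k A (p', q'), OmegaT.cyclicHomotopy s hs (x * y) =
        (p * p').negOnePow • OmegaT.cyclicHomotopy s hs (y * x))
      (hy : y ∈ OmegaT.deg k A (p', q')) : OmegaT.cyclicHomotopy s hs (g * x * y) =
        ((p₀ + p) * p').negOnePow • OmegaT.cyclicHomotopy s hs (y * (g * x)) := by
    rw [mul_assoc, hgy _ _ _ (OmegaT.mul_mem hx hy), mul_assoc, ih _ _ _ (OmegaT.mul_mem hy hg),
      smul_smul, ← Int.negOnePow_add, mul_assoc]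
    congr 1
    refine negOnePow_congr ⟨p₀ * p, by ring⟩
  induction hx using Submodule.span_induction generalizing p' q' y with
  | mem x hx =>
    dsimp only [Set.mem_ofPred_eq] at hx
    induction hx generalizing p' q' y with
    | one => simp
    | @of_mul a p q x hx ih =>
      have h := hstep (OmegaT.incl_mem (Omega.of_mem a))
        (fun p q y hy => OmegaT.cyclicHomotopy_incl_comm s hs (Omega.of_mem a) hy)
        (Submodule.subset_span hx) (fun p' q' y hy => ih hy) hy
      rwa [OmegaT.incl_of, zero_add] at h
    | @dOf_mul a p q x hx ih =>
      have h := hstep (OmegaT.incl_mem (Omega.dOf_mem a))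
        (fun p q y hy => OmegaT.cyclicHomotopy_incl_comm s hs (Omega.dOf_mem a) hy)
        (Submodule.subset_span hx) (fun p' q' y hy => ih hy) hy
      rwa [OmegaT.incl_dOf, add_comm] at h
    | @t_mul p q x hx ih =>
      have h := hstep OmegaT.t_mem
        (fun p q y hy => by simpa using OmegaT.cyclicHomotopy_t_comm s hs hy)
        (Submodule.subset_span hx) (fun p' q' y hy => ih hy) hy
      rwa [zero_add] at h
  | zero => simp
  | add x x' _ _ h h' => rw [add_mul, map_add, h hy, h' hy, mul_add, map_add, smul_add]
  | smul c x _ h =>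
    rw [smul_mul_assoc, map_smul, h hy, mul_smul_comm, map_smul, negOnePow_smul_comm]

theorem oDRt.rel_le_cyclicHomotopy :
    oDRt.rel k A ≤ LinearMap.ker (OmegaT.cyclicHomotopy s hs) := by
  refine sup_le (Submodule.span_le.2 ?_) ?_
  · rintro _ ⟨i, j, x, hx, y, hy, rfl⟩
    rw [SetLike.mem_coe, LinearMap.mem_ker, map_sub, map_negOnePow_smul,
      OmegaT.cyclicHomotopy_comm s hs hx hy, sub_self]
  · rintro _ ⟨f, rfl⟩
    rw [LinearMap.mem_ker, AlgHom.toLinearMap_apply, Polynomial.aeval_eq_sum_range, map_sum]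
    refine Finset.sum_eq_zero fun n _ => ?_
    rw [map_smul]
    rcases n with _ | n
    · have h := OmegaT.cyclicHomotopy_incl s hs (1 : Omega k A)
      rw [map_one] at h
      rw [pow_zero, h, smul_zero]
    · rw [pow_succ', OmegaT.cyclicHomotopy_t_mul s hs (OmegaT.t_pow_mem k A n),
        OmegaT.homotopyBlocks_t_pow, mul_zero, map_zero, smul_zero]

/-- The homotopy on the reduced extended de Rham complex. -/
def oDRt.homotopy : oDRt k A →ₗ[k] oDRt k A :=
  Submodule.liftQ _ (OmegaT.cyclicHomotopy s hs) (oDRt.rel_le_cyclicHomotopy s hs)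

theorem oDRt.homotopy_cls (x : OmegaT k A) :
    oDRt.homotopy s hs (oDRt.cls k A x) = OmegaT.cyclicHomotopy s hs x := rfl

end CyclicHomotopy

/-! ### Exactness of `d` in positive degree in `t`. -/

section Exactness

variable {k : Type u} [CommRing k] {A : Type v} [Ring A] [Algebra k A]
  (s : A →ₗ[k] k) (hs : s 1 = 1)

/-- The products `w₀ t w₁ ⋯ t w_q` of degree `p`, where each `w_i` is `1` or a form on which
`d h + h d` is the identity, with `m` factors of the second kind. -/
inductive IsBlockWord : ℤ → ℕ → ℕ → OmegaT k A → Prop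
  | one : IsBlockWord 0 0 0 1
  | incl {p : ℤ} {w : Omega k A} (hw : w ∈ Omega.deg k A p)
      (e : Omega.d k A (homotopy s hs w) + homotopy s hs (Omega.d k A w) = w) :
      IsBlockWord p 0 1 (OmegaT.incl k A w)
  | t_mul {p : ℤ} {q m : ℕ} {x : OmegaT k A} :
      IsBlockWord p q m x → IsBlockWord p (q + 1) m (OmegaT.t k A * x)
  | incl_mul {p p' : ℤ} {q m : ℕ} {w : Omega k A} {x : OmegaT k A} (hw : w ∈ Omega.deg k A p)
      (e : Omega.d k A (homotopy s hs w) + homotopy s hs (Omega.d k A w) = w) :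
      IsBlockWord p' q m x →
        IsBlockWord (p + p') (q + 1) (m + 1) (OmegaT.incl k A w * (OmegaT.t k A * x))

variable {s hs}

theorem IsBlockWord.mem_deg {p : ℤ} {q m : ℕ} {x : OmegaT k A} (hx : IsBlockWord s hs p q m x) :
    x ∈ OmegaT.deg k A (p, q) := by
  induction hx with
  | one => exact OmegaT.one_mem_deg
  | incl hw _ => exact OmegaT.incl_mem hw
  | t_mul _ ih => exact OmegaT.t_mul_mem ih
  | incl_mul hw _ _ ih =>
    have h := OmegaT.mul_mem (OmegaT.incl_mem hw) (OmegaT.t_mul_mem ih)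
    rwa [zero_add] at h

theorem IsBlockWord.le {p : ℤ} {q m : ℕ} {x : OmegaT k A} (hx : IsBlockWord s hs p q m x) :
    m ≤ q + 1 := by
  induction hx <;> omega

theorem IsBlockWord.eq_t_pow {p : ℤ} {q m : ℕ} {x : OmegaT k A} (hx : IsBlockWord s hs p q m x)
    (hm : m = 0) : x = OmegaT.t k A ^ q := by
  induction hx with
  | one => rw [pow_zero]
  | incl _ _ => omega
  | t_mul _ ih => rw [ih hm, pow_succ']
  | incl_mul => omega

/-- Both `d` and `E` obey signed Leibniz rules at the letters `t`, so the mixed terms of `d E + E d`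
cancel and what remains acts block by block: once for each block with `d h + h d = 1`, and by zero
for each block `1`. -/
theorem IsBlockWord.homotopy {p : ℤ} {q m : ℕ} {x : OmegaT k A}
    (hx : IsBlockWord s hs p q m x) :
    OmegaT.d k A (OmegaT.homotopyBlocks s hs x) + OmegaT.homotopyBlocks s hs (OmegaT.d k A x) =
      (m : k) • x := by
  induction hx with
  | one =>
    have h := OmegaT.homotopyBlocks_t_pow (A := A) s hs 0
    rw [pow_zero] at h
    simp [h, OmegaT.d_one]
  | incl hw e =>
    rw [OmegaT.homotopyBlocks_incl, OmegaT.d_incl, OmegaT.d_incl, OmegaT.homotopyBlocks_incl,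
      ← map_add, e, Nat.cast_one, one_smul]
  | t_mul hx ih =>
    rw [OmegaT.homotopyBlocks_t_mul, OmegaT.d_t_mul (OmegaT.homotopyBlocks_mem s hs hx.mem_deg),
      OmegaT.d_t_mul hx.mem_deg, OmegaT.homotopyBlocks_t_mul, ← mul_add, ih, mul_smul_comm]
  | @incl_mul p p' q m w x hw e hx ih =>
    have hz := hx.mem_deg
    have hE := OmegaT.homotopyBlocks_mem s hs hz
    have hw' := OmegaT.incl_mem hw
    have hh := homotopy_mem s hs hw
    rw [OmegaT.homotopyBlocks_incl_mul, OmegaT.d_mul hw' (OmegaT.t_mul_mem hz), map_add, map_add,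
      Omega.parity_eq hw, map_negOnePow_smul, map_negOnePow_smul, smul_mul_assoc,
      map_negOnePow_smul,
      OmegaT.d_mul (OmegaT.incl_mem hh) (OmegaT.t_mul_mem hz),
      OmegaT.d_mul hw' (OmegaT.t_mul_mem hE), OmegaT.d_t_mul hz, OmegaT.d_t_mul hE,
      OmegaT.d_incl, OmegaT.d_incl, OmegaT.homotopyBlocks_incl_mul,
      OmegaT.homotopyBlocks_incl_mul, Omega.parity_eq hw, Omega.parity_eq (Omega.d_mem hw),
      map_negOnePow_smul, map_negOnePow_smul, Int.negOnePow_succ, Int.negOnePow_sub,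
      Int.negOnePow_one]
    have e' := congrArg (OmegaT.incl k A) e
    rw [map_add] at e'
    have hc : ((m + 1 : ℕ) : k) • (OmegaT.incl k A w * (OmegaT.t k A * x)) =
        (OmegaT.incl k A (Omega.d k A (ExtendedDR.homotopy s hs w)) +
          OmegaT.incl k A (ExtendedDR.homotopy s hs (Omega.d k A w))) * (OmegaT.t k A * x) +
        OmegaT.incl k A w * (OmegaT.t k A *
          (OmegaT.d k A (OmegaT.homotopyBlocks s hs x) +
            OmegaT.homotopyBlocks s hs (OmegaT.d k A x))) := by
      rw [e', ih, Nat.cast_succ, add_smul, one_smul, mul_smul_comm, mul_smul_comm, add_comm]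
    rw [hc]
    rcases Int.units_eq_one_or p.negOnePow with e | e <;>
    · simp only [e, one_smul, Units.neg_smul, mul_neg, mul_one, neg_neg, neg_mul, add_mul, mul_add,
        smul_add]
      abel

theorem OmegaT.deg_le_blockWords (p : ℤ) (q : ℕ) :
    OmegaT.deg k A (p, q) ≤ Submodule.span k {x | ∃ m, IsBlockWord s hs p q m x} := by
  refine OmegaT.deg_le_of_blocks
    (fun p q => Submodule.span k {x | ∃ m, IsBlockWord s hs p q m x}) ?_ ?_ p q
  · intro p w hw
    have h : Omega.deg k A p ≤
        (Submodule.span k {x | ∃ m, IsBlockWord s hs p 0 m x}).comap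
          (OmegaT.incl k A).toLinearMap := by
      refine (Omega.deg_le_one_sup s hs p).trans (Submodule.span_le.2 ?_)
      rintro w (⟨rfl, rfl⟩ | ⟨hw, e⟩)
      · exact Submodule.subset_span ⟨0, by simpa using IsBlockWord.one⟩
      · exact Submodule.subset_span ⟨1, .incl hw e⟩
    exact h hw
  · intro p p' q w hw x hx ih
    have h1 {y : OmegaT k A} {m : ℕ} (hy : IsBlockWord s hs p' q m y) :
        OmegaT.incl k A w * (OmegaT.t k A * y) ∈
          Submodule.span k {x | ∃ m, IsBlockWord s hs (p + p') (q + 1) m x} := by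
      have h : Omega.deg k A p ≤
          (Submodule.span k {x | ∃ m, IsBlockWord s hs (p + p') (q + 1) m x}).comap
            (LinearMap.mulRight k (OmegaT.t k A * y) ∘ₗ (OmegaT.incl k A).toLinearMap) := by
        refine (Omega.deg_le_one_sup s hs p).trans (Submodule.span_le.2 ?_)
        rintro w (⟨rfl, rfl⟩ | ⟨hw, e⟩)
        · exact Submodule.subset_span ⟨m, by simpa using hy.t_mul⟩
        · exact Submodule.subset_span ⟨m + 1, .incl_mul hw e hy⟩
      exact h hw
    have h : Submodule.span k {x | ∃ m, IsBlockWord s hs p' q m x} ≤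
        (Submodule.span k {x | ∃ m, IsBlockWord s hs (p + p') (q + 1) m x}).comap
          (LinearMap.mulLeft k (OmegaT.incl k A w) ∘ₗ LinearMap.mulLeft k (OmegaT.t k A)) := by
      refine Submodule.span_le.2 ?_
      rintro y ⟨m, hy⟩
      exact h1 hy
    exact h ih

/-- Rotate the first block to the end, so that the cyclic word begins with `t`. -/
theorem oDRt.deg_le_t_mul (p : ℤ) (q : ℕ) : oDRt.deg k A p (q + 1) ≤
    (OmegaT.deg k A (p, q)).map (oDRt.cls k A ∘ₗ LinearMap.mulLeft k (OmegaT.t k A)) := by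
  rw [oDRt.deg, Submodule.map_le_iff_le_comap]
  -- The value in `t`-degree zero is irrelevant: a single step of the induction already exposes a
  -- `t`, and its hypothesis is discarded.
  let S : ℤ → ℕ → Submodule k (OmegaT k A)
    | _, 0 => ⊤
    | p, q + 1 => ((OmegaT.deg k A (p, q)).map
        (oDRt.cls k A ∘ₗ LinearMap.mulLeft k (OmegaT.t k A))).comap (oDRt.cls k A)
  refine OmegaT.deg_le_of_blocks S (fun _ _ _ => trivial) ?_ p (q + 1)
  intro p p' q w hw x hx _
  have h := oDRt.cls_mul_comm (OmegaT.incl_mem hw) (OmegaT.t_mul_mem hx)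
  have hx' := OmegaT.mul_mem hx (OmegaT.incl_mem hw)
  rw [add_comm p', add_zero] at hx'
  rw [mul_assoc] at h
  refine ⟨(p * p').negOnePow • (x * OmegaT.incl k A w), ?_, ?_⟩
  · rcases Int.units_eq_one_or (p * p').negOnePow with e | e
    · rwa [e, one_smul]
    · rw [e, Units.neg_smul, one_smul]
      exact neg_mem hx'
  · rw [map_negOnePow_smul, h]
    rfl

variable (s hs) in
/-- The span of the cyclic words in `Ω A` with at least one and at most `n` factors which are not
`1`. -/
def cyclicFiltration (p : ℤ) (q n : ℕ) : Submodule k (oDRt k A) :=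
  Submodule.span k {z | ∃ m x, IsBlockWord s hs p q m x ∧ 1 ≤ m ∧ m ≤ n ∧
    z = oDRt.cls k A (OmegaT.t k A * x)}

/-- Words without nontrivial blocks give `t ^ (q + 1)`, which dies in the quotient by `k[t]`. Hence
`m ≥ 1`, and `m ≤ q + 1` since a word with `q` letters `t` has `q + 1` blocks. -/
theorem oDRt.deg_le_cyclicFiltration (p : ℤ) (q : ℕ) :
    oDRt.deg k A p (q + 1) ≤ cyclicFiltration s hs p q (q + 1) := by
  refine (oDRt.deg_le_t_mul p q).trans ?_
  refine (Submodule.map_mono (OmegaT.deg_le_blockWords (s := s) (hs := hs) p q)).trans ?_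
  rw [Submodule.map_span_le]
  rintro x ⟨m, hx⟩
  change oDRt.cls k A (OmegaT.t k A * x) ∈ _
  rcases Nat.eq_zero_or_pos m with rfl | hm
  · rw [hx.eq_t_pow rfl, ← pow_succ', oDRt.cls_t_pow]
    exact zero_mem _
  · exact Submodule.subset_span ⟨m, x, hx, hm, hx.le, rfl⟩

variable [Algebra ℚ k]

theorem IsBlockWord.oDRt_homotopy {p : ℤ} {q m : ℕ} {x : OmegaT k A}
    (hx : IsBlockWord s hs p q m x) :
    oDRt.d k A (oDRt.homotopy s hs (oDRt.cls k A (OmegaT.t k A * x))) +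
      oDRt.homotopy s hs (oDRt.d k A (oDRt.cls k A (OmegaT.t k A * x))) =
    (m : k) • oDRt.cls k A (OmegaT.t k A * x) := by
  rw [oDRt.d_cls, OmegaT.d_t_mul hx.mem_deg, oDRt.homotopy_cls, oDRt.homotopy_cls,
    OmegaT.cyclicHomotopy_t_mul s hs hx.mem_deg,
    OmegaT.cyclicHomotopy_t_mul s hs (OmegaT.d_mem hx.mem_deg), oDRt.d_cls,
    OmegaT.d_t_mul (OmegaT.homotopyBlocks_mem s hs hx.mem_deg), ← map_add, ← mul_add, hx.homotopy,
    mul_smul_comm, map_smul]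

theorem homotopy_mem_of_mem_cyclicFiltration {p : ℤ} {q n : ℕ} {z : oDRt k A}
    (hz : z ∈ cyclicFiltration s hs p q n) :
    oDRt.homotopy s hs z ∈ oDRt.deg k A (p - 1) (q + 1) := by
  have h : cyclicFiltration s hs p q n ≤
      (oDRt.deg k A (p - 1) (q + 1)).comap (oDRt.homotopy s hs) := by
    refine Submodule.span_le.2 ?_
    rintro _ ⟨m, x, hx, -, -, rfl⟩
    rw [SetLike.mem_coe, Submodule.mem_comap, oDRt.homotopy_cls,
      OmegaT.cyclicHomotopy_t_mul s hs hx.mem_deg]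
    exact ⟨_, OmegaT.t_mul_mem (OmegaT.homotopyBlocks_mem s hs hx.mem_deg), rfl⟩
  exact h hz

/-- A generator with `m` nontrivial blocks is multiplied by `m - (n + 1)`: this kills those with `m
= n + 1` and leaves the others in the smaller step of the filtration. -/
theorem sub_mem_cyclicFiltration {p : ℤ} {q n : ℕ} {z : oDRt k A}
    (hz : z ∈ cyclicFiltration s hs p q (n + 1)) :
    oDRt.d k A (oDRt.homotopy s hs z) + oDRt.homotopy s hs (oDRt.d k A z) -
      ((n + 1 : ℕ) : k) • z ∈ cyclicFiltration s hs p q n := by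
  have h : cyclicFiltration s hs p q (n + 1) ≤ (cyclicFiltration s hs p q n).comap
      (oDRt.d k A ∘ₗ oDRt.homotopy s hs + oDRt.homotopy s hs ∘ₗ oDRt.d k A -
        ((n + 1 : ℕ) : k) • LinearMap.id) := by
    refine Submodule.span_le.2 ?_
    rintro _ ⟨m, x, hx, h1, hn, rfl⟩
    simp only [SetLike.mem_coe, Submodule.mem_comap, LinearMap.sub_apply, LinearMap.add_apply,
      LinearMap.comp_apply, LinearMap.smul_apply, LinearMap.id_apply]
    rw [hx.oDRt_homotopy, ← sub_smul]
    rcases Nat.lt_or_ge n m with hm | hm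
    · have : m = n + 1 := by omega
      rw [this, sub_self, zero_smul]
      exact zero_mem _
    · exact Submodule.smul_mem _ _ (Submodule.subset_span ⟨m, x, hx, h1, hm, rfl⟩)
  exact h hz

/-- Descent along the filtration replaces a decomposition into eigenspaces of `d H + H d`, so
nothing has to be known about linear relations between block words. For closed `z`, the element `d H
z - (n + 1) z` is closed and lies one step lower, hence equals some `d y`. -/
theorem exists_d_eq_of_mem_cyclicFiltration {p : ℤ} {q n : ℕ} {z : oDRt k A}
    (hz : z ∈ cyclicFiltration s hs p q n) (hd : oDRt.d k A z = 0) :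
    ∃ y ∈ oDRt.deg k A (p - 1) (q + 1), oDRt.d k A y = z := by
  induction n generalizing z with
  | zero =>
    have h : cyclicFiltration s hs p q 0 = ⊥ := by
      refine Submodule.span_eq_bot.2 ?_
      rintro _ ⟨m, x, -, h1, h2, -⟩
      omega
    rw [h, Submodule.mem_bot] at hz
    exact ⟨0, zero_mem _, by rw [map_zero, hz]⟩
  | succ n ih =>
    have hH := homotopy_mem_of_mem_cyclicFiltration hz
    have h := sub_mem_cyclicFiltration hz
    rw [hd, map_zero, add_zero] at h
    have hdd : oDRt.d k A (oDRt.d k A (oDRt.homotopy s hs z)) = 0 := by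
      obtain ⟨y, hy, e⟩ := hH
      rw [← e]
      exact (congrArg (oDRt.rel k A).mkQ (OmegaT.d_d hy)).trans (map_zero _)
    obtain ⟨y, hy, e⟩ := ih h (by rw [map_sub, hdd, map_smul, hd, smul_zero, sub_zero])
    -- Solve `d H z - (n + 1) z = d y` for `z`.
    refine ⟨algebraMap ℚ k (1 / (n + 1 : ℕ)) • (oDRt.homotopy s hs z - y),
      Submodule.smul_mem _ _ (sub_mem hH hy), ?_⟩
    have hc : algebraMap ℚ k (1 / (n + 1 : ℕ)) * ((n + 1 : ℕ) : k) = 1 := by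
      rw [← map_natCast (algebraMap ℚ k), ← map_mul, one_div_mul_cancel, map_one]
      exact Nat.cast_ne_zero.2 (Nat.succ_ne_zero n)
    rw [map_smul, map_sub, e, sub_sub_cancel, smul_smul, hc, one_smul]

/-- The components of positive degree in `t` of the reduced extended de Rham complex are exact
with respect to `d`. -/
theorem oDRt.exists_d_eq (s : A →ₗ[k] k) (hs : s 1 = 1) {p : ℤ} {q : ℕ} {z : oDRt k A}
    (hz : z ∈ oDRt.deg k A p (q + 1)) (hd : oDRt.d k A z = 0) :
    ∃ y ∈ oDRt.deg k A (p - 1) (q + 1), oDRt.d k A y = z :=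
  exists_d_eq_of_mem_cyclicFiltration (oDRt.deg_le_cyclicFiltration (s := s) (hs := hs) p q hz) hd

end Exactness

/-! ### The grading of the reduced de Rham complex and its inclusion as the part of degree zero in
`t`. -/

section Grading

variable {k : Type u} [CommRing k] {A : Type v} [Ring A] [Algebra k A]

variable (k A) in
/-- The homomorphism `Ω A → (Ω A)[X]` which multiplies forms of degree `p` by `X ^ p`. -/
def Omega.gradeHom : Omega k A →ₐ[k] Polynomial (Omega k A) :=
  Omega.lift ((Polynomial.CAlgHom (R := k)).comp (Omega.of k))
    { toFun := fun a => Polynomial.monomial 1 (Omega.dOf k a)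
      map_add' := fun a b => by rw [map_add, map_add]
      map_smul' := fun c a => by
        rw [map_smul, RingHom.id_apply, Polynomial.smul_monomial] }
    (fun a b => by
      simp only [LinearMap.coe_mk, AddHom.coe_mk, Omega.dOf_mul, map_add, AlgHom.comp_apply,
        Polynomial.CAlgHom_apply, Polynomial.C_mul_monomial, Polynomial.monomial_mul_C])

/-- Truncation by `toNat` loses nothing, since monomials have nonnegative degree. The powers of the
polynomial variable separate the components of `Ω A`. -/
theorem Omega.gradeHom_eq {p : ℤ} {x : Omega k A} (hx : x ∈ Omega.deg k A p) :
    Omega.gradeHom k A x = Polynomial.monomial p.toNat x := by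
  induction hx using Submodule.span_induction with
  | mem x hx =>
    induction hx with
    | one => simp
    | of_mul a _ ih =>
      rw [map_mul, ih, Omega.gradeHom, Omega.lift_of, AlgHom.comp_apply, Polynomial.CAlgHom_apply,
        Polynomial.C_mul_monomial]
    | dOf_mul a hx ih =>
      rw [map_mul, ih, Omega.gradeHom, Omega.lift_dOf, LinearMap.coe_mk, AddHom.coe_mk,
        Polynomial.monomial_mul_monomial, add_comm 1,
        Int.toNat_add (Omega.isMonomial_nonneg hx) one_pos.le, Int.toNat_one]
  | zero => simp
  | add x x' _ _ h h' => rw [map_add, h, h', map_add]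
  | smul c x _ h => rw [map_smul, h, Polynomial.smul_monomial]

variable (k A) in
/-- The projection of `Ω A` onto its component of degree `n`. -/
def Omega.proj (n : ℕ) : Omega k A →ₗ[k] Omega k A :=
  (Polynomial.lcoeff (Omega k A) n).restrictScalars k ∘ₗ (Omega.gradeHom k A).toLinearMap

theorem Omega.proj_self {n : ℕ} {x : Omega k A} (hx : x ∈ Omega.deg k A n) :
    Omega.proj k A n x = x := by
  change (Omega.gradeHom k A x).coeff n = x
  rw [Omega.gradeHom_eq hx, Int.toNat_natCast, Polynomial.coeff_monomial, if_pos rfl]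

theorem Omega.proj_of_ne {n : ℕ} {p : ℤ} {x : Omega k A} (hx : x ∈ Omega.deg k A p)
    (h : p ≠ n) : Omega.proj k A n x = 0 := by
  rcases lt_or_ge p 0 with hp | hp
  · rw [Omega.deg_eq_bot hp, Submodule.mem_bot] at hx
    rw [hx, map_zero]
  change (Omega.gradeHom k A x).coeff n = 0
  rw [Omega.gradeHom_eq hx, Polynomial.coeff_monomial, if_neg (by omega)]

/-- The submodule is spanned by homogeneous elements, and a projection either fixes or kills each of
them. -/
theorem oDR.rel_le_proj (n : ℕ) : oDR.rel k A ≤ (oDR.rel k A).comap (Omega.proj k A n) := by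
  have key {p : ℤ} {z : Omega k A} (hz : z ∈ Omega.deg k A p) (hr : z ∈ oDR.rel k A) :
      Omega.proj k A n z ∈ oDR.rel k A := by
    by_cases h : p = n
    · subst h
      rwa [Omega.proj_self hz]
    · rw [Omega.proj_of_ne hz h]
      exact zero_mem _
  refine sup_le (Submodule.span_le.2 ?_) ?_
  · rintro _ ⟨i, j, x, hx, y, hy, rfl⟩
    refine key (p := i + j) (sub_mem (Omega.mul_mem hx hy) ?_)
      (Submodule.mem_sup_left (Submodule.subset_span ⟨i, j, x, hx, y, hy, rfl⟩))
    have h := Omega.mul_mem hy hx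
    rw [add_comm] at h
    rcases Int.units_eq_one_or (id i * id j).negOnePow with e | e
    · rwa [e, one_smul]
    · rw [e, Units.neg_smul, one_smul]
      exact neg_mem h
  · rintro _ ⟨c, rfl⟩
    refine key (p := 0) ?_ (Submodule.mem_sup_right ⟨c, rfl⟩)
    rw [Algebra.linearMap_apply, Algebra.algebraMap_eq_smul_one]
    exact Submodule.smul_mem _ _ Omega.one_mem_deg

variable (k A) in
/-- The projection of the reduced de Rham complex onto its component of degree `n`. -/
def oDR.proj (n : ℕ) : oDR k A →ₗ[k] oDR k A :=
  Submodule.mapQ _ _ (Omega.proj k A n) (oDR.rel_le_proj n)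

theorem oDR.proj_self {n : ℕ} {x : oDR k A} (hx : x ∈ oDR.deg k A n) :
    oDR.proj k A n x = x := by
  obtain ⟨y, hy, rfl⟩ := hx
  exact congrArg (oDR.rel k A).mkQ (Omega.proj_self hy)

theorem oDR.proj_of_ne {n : ℕ} {p : ℤ} {x : oDR k A} (hx : x ∈ oDR.deg k A p) (h : p ≠ n) :
    oDR.proj k A n x = 0 := by
  obtain ⟨y, hy, rfl⟩ := hx
  exact (congrArg (oDR.rel k A).mkQ (Omega.proj_of_ne hy h)).trans (map_zero _)

theorem oDR.iSup_deg : ⨆ p, oDR.deg k A p = ⊤ := by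
  simp only [oDR.deg, ← Submodule.map_iSup, Omega.iSup_deg, Submodule.map_top,
    Submodule.range_mkQ]

theorem oDR.deg_eq_bot {p : ℤ} (hp : p < 0) : oDR.deg k A p = ⊥ := by
  rw [oDR.deg, Omega.deg_eq_bot hp, Submodule.map_bot]

theorem oDR.proj_mem (n : ℕ) (x : oDR k A) : oDR.proj k A n x ∈ oDR.deg k A n := by
  have h : ⨆ p, oDR.deg k A p ≤ (oDR.deg k A n).comap (oDR.proj k A n) := by
    refine iSup_le fun p y hy => ?_
    rw [Submodule.mem_comap]
    by_cases h : p = n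
    · subst h
      rwa [oDR.proj_self hy]
    · rw [oDR.proj_of_ne hy h]
      exact zero_mem _
  rw [oDR.iSup_deg] at h
  exact h trivial

theorem oDR.d_mem {p : ℤ} {x : oDR k A} (hx : x ∈ oDR.deg k A p) :
    oDR.d k A x ∈ oDR.deg k A (p + 1) :=
  (oDR.isMixed k A).d_mem p x hx

theorem oDR.linearMap_ext {N : Type*} [AddCommGroup N] [Module k N] {f g : oDR k A →ₗ[k] N}
    (h : ∀ p, ∀ x ∈ oDR.deg k A p, f x = g x) : f = g := by
  have h' : ⨆ p, oDR.deg k A p ≤ LinearMap.eqLocus f g := iSup_le h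
  rw [oDR.iSup_deg] at h'
  exact LinearMap.ext fun x => h' trivial

theorem oDR.proj_zero_d (x : oDR k A) : oDR.proj k A 0 (oDR.d k A x) = 0 := by
  refine LinearMap.congr_fun (oDR.linearMap_ext (f := oDR.proj k A 0 ∘ₗ oDR.d k A) (g := 0)
    fun p x hx => ?_) x
  rw [LinearMap.comp_apply, LinearMap.zero_apply]
  by_cases hp : p < 0
  · rw [oDR.deg_eq_bot hp, Submodule.mem_bot] at hx
    rw [hx, map_zero, map_zero]
  · exact oDR.proj_of_ne (oDR.d_mem hx) (by simp only [Nat.cast_zero]; omega)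

theorem oDR.proj_succ_d (n : ℕ) (x : oDR k A) :
    oDR.proj k A (n + 1) (oDR.d k A x) = oDR.d k A (oDR.proj k A n x) := by
  refine LinearMap.congr_fun (oDR.linearMap_ext (f := oDR.proj k A (n + 1) ∘ₗ oDR.d k A)
    (g := oDR.d k A ∘ₗ oDR.proj k A n) fun p x hx => ?_) x
  rw [LinearMap.comp_apply, LinearMap.comp_apply]
  by_cases h : p = n
  · subst h
    have hd : oDR.d k A x ∈ oDR.deg k A ((n + 1 : ℕ) : ℤ) := by
      rw [Nat.cast_succ]
      exact oDR.d_mem hx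
    rw [oDR.proj_self hx, oDR.proj_self hd]
  · rw [oDR.proj_of_ne hx h, map_zero]
    exact oDR.proj_of_ne (n := n + 1) (oDR.d_mem hx) (by rw [Nat.cast_succ]; omega)

/-- An exact element of degree `p` is the differential of an element of degree `p - 1`. -/
theorem oDR.exists_deg_of_mem_range {p : ℤ} {x : oDR k A} (hx : x ∈ oDR.deg k A p)
    (h : x ∈ LinearMap.range (oDR.d k A)) :
    ∃ y ∈ oDR.deg k A (p - 1), oDR.d k A y = x := by
  obtain ⟨y, rfl⟩ := h
  rcases lt_or_ge p 0 with hp | hp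
  · rw [oDR.deg_eq_bot hp, Submodule.mem_bot] at hx
    exact ⟨0, zero_mem _, by rw [map_zero, hx]⟩
  obtain ⟨n, rfl⟩ := Int.eq_ofNat_of_zero_le hp
  have e := oDR.proj_self hx
  rcases n with _ | n
  · rw [oDR.proj_zero_d] at e
    exact ⟨0, zero_mem _, by rw [map_zero, e]⟩
  · rw [oDR.proj_succ_d] at e
    exact ⟨oDR.proj k A n y, by simpa using oDR.proj_mem n y, e⟩

theorem oDR.rel_le_incl :
    oDR.rel k A ≤ (oDRt.rel k A).comap (OmegaT.incl k A).toLinearMap := by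
  refine sup_le (Submodule.span_le.2 ?_) ?_
  · rintro _ ⟨i, j, x, hx, y, hy, rfl⟩
    refine Submodule.mem_sup_left (Submodule.subset_span ⟨(i, 0), (j, 0), OmegaT.incl k A x,
      OmegaT.incl_mem hx, OmegaT.incl k A y, OmegaT.incl_mem hy, ?_⟩)
    rw [AlgHom.toLinearMap_apply, map_sub, map_mul, map_negOnePow_smul, map_mul]
    rfl
  · rintro _ ⟨c, rfl⟩
    refine Submodule.mem_sup_right ⟨Polynomial.C c, ?_⟩
    simp

variable (k A) in
/-- The inclusion of the reduced de Rham complex into the reduced extended de Rham complex. -/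
def oDR.incl : oDR k A →ₗ[k] oDRt k A :=
  Submodule.mapQ _ _ (OmegaT.incl k A).toLinearMap oDR.rel_le_incl

theorem oDR.incl_mem {p : ℤ} {x : oDR k A} (hx : x ∈ oDR.deg k A p) :
    oDR.incl k A x ∈ oDRt.deg k A p 0 := by
  obtain ⟨y, hy, rfl⟩ := hx
  exact ⟨OmegaT.incl k A y, OmegaT.incl_mem hy, rfl⟩

theorem oDRt.modT_incl (x : oDR k A) : oDRt.modT k A (oDR.incl k A x) = x := by
  obtain ⟨y, rfl⟩ := Submodule.mkQ_surjective _ x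
  exact congrArg (oDR.rel k A).mkQ (OmegaT.modT_incl y)

theorem oDRt.d_incl (x : oDR k A) :
    oDRt.d k A (oDR.incl k A x) = oDR.incl k A (oDR.d k A x) := by
  obtain ⟨y, rfl⟩ := Submodule.mkQ_surjective _ x
  exact congrArg (oDRt.rel k A).mkQ (OmegaT.d_incl y)

/-- A word with no `t` is a single block from `Ω A`; thus inclusion and reduction modulo `t`
identify `oDR` with the part of degree zero in `t`. -/
theorem oDRt.incl_modT {p : ℤ} {x : oDRt k A} (hx : x ∈ oDRt.deg k A p 0) :
    oDR.incl k A (oDRt.modT k A x) = x := by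
  have h : OmegaT.deg k A (p, 0) ≤ (Omega.deg k A p).map (OmegaT.incl k A).toLinearMap := by
    let S : ℤ → ℕ → Submodule k (OmegaT k A)
      | p, 0 => (Omega.deg k A p).map (OmegaT.incl k A).toLinearMap
      | _, _ + 1 => ⊤
    exact OmegaT.deg_le_of_blocks S (fun p w hw => ⟨w, hw, rfl⟩)
      (fun _ _ _ _ _ _ _ _ => trivial) p 0
  obtain ⟨y, hy, rfl⟩ := hx
  obtain ⟨w, -, rfl⟩ := h hy
  exact congrArg (oDR.incl k A) (oDRt.modT_incl ((oDR.rel k A).mkQ w))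

theorem oDRt.modT_d {p : ℤ} {x : oDRt k A} (hx : x ∈ oDRt.deg k A p 0) :
    oDRt.modT k A (oDRt.d k A x) = oDR.d k A (oDRt.modT k A x) := by
  conv_lhs => rw [← oDRt.incl_modT hx]
  rw [oDRt.d_incl, oDRt.modT_incl]

theorem oDRt.deg_eq_bot {p : ℤ} {q : ℕ} (hp : p < 0) : oDRt.deg k A p q = ⊥ := by
  rw [oDRt.deg, OmegaT.deg_eq_bot hp, Submodule.map_bot]

theorem oDRt.i_mem {p : ℤ} {q : ℕ} {x : oDRt k A} (hx : x ∈ oDRt.deg k A p q) :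
    oDRt.i k A x ∈ oDRt.deg k A (p - 1) (q + 1) := by
  obtain ⟨y, hy, rfl⟩ := hx
  exact ⟨OmegaT.i k A y, OmegaT.i_mem hy, rfl⟩

theorem oDRt.i_i {p : ℤ} {q : ℕ} {x : oDRt k A} (hx : x ∈ oDRt.deg k A p q) :
    oDRt.i k A (oDRt.i k A x) = 0 := by
  obtain ⟨y, hy, rfl⟩ := hx
  exact (congrArg (oDRt.rel k A).mkQ (OmegaT.i_i hy)).trans (map_zero _)

/-- On `Ω_t` the anticommutator of `d` and `i_t` is the commutator with `t`, which is zero in the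
quotient. -/
theorem oDRt.i_d {p : ℤ} {q : ℕ} {x : oDRt k A} (hx : x ∈ oDRt.deg k A p q) :
    oDRt.d k A (oDRt.i k A x) = -oDRt.i k A (oDRt.d k A x) := by
  obtain ⟨y, hy, rfl⟩ := hx
  have h := congrArg (oDRt.cls k A) (OmegaT.i_d hy)
  have h' := oDRt.cls_mul_comm hy (OmegaT.t_mem (k := k) (A := A))
  rw [mul_zero, Int.negOnePow_zero, one_smul] at h'
  rw [map_add, map_sub, h', sub_self, add_comm] at h
  exact eq_neg_of_add_eq_zero_left h

end Grading

/-! ### Solving for one power of `t` at a time. -/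

section Lifting

variable {k : Type u} [CommRing k] {A : Type v} [Ring A] [Algebra k A] [Algebra ℚ k]

/-- Solving `(i - u d) y = x` one power of `t` at a time, given the solution modulo `t`. -/
theorem oDRt.exists_lift (s : A →ₗ[k] k) (hs : s 1 = 1) {l m : ℤ} (e : m + 1 = l)
    (x : ℤ → ℕ → oDRt k A) (hx : ∀ r q, x r q ∈ oDRt.deg k A (m + 2 * r) q)
    (hdx : ∀ r q, oDRt.i k A (x r q) = oDRt.d k A (x (r - 1) (q + 1)))
    (y : ℤ → oDRt k A) (hy : ∀ r, y r ∈ oDRt.deg k A (l + 2 * r) 0)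
    (hdy : ∀ r, -oDRt.d k A (y (r - 1)) = x r 0) :
    ∃ Y : ℤ → ℕ → oDRt k A, (∀ r q, Y r q ∈ oDRt.deg k A (l + 2 * r) q) ∧ (∀ r, Y r 0 = y r) ∧
      ∀ r q, oDRt.i k A (Y r q) - oDRt.d k A (Y (r - 1) (q + 1)) = x r (q + 1) := by
  -- The second condition says that the obstruction `i z_r - x_{r, q+1}` to the next coefficient is
  -- `d`-closed, hence exact because it has positive degree in `t`.
  let good (q : ℕ) (z : ℤ → oDRt k A) : Prop :=
    (∀ r, z r ∈ oDRt.deg k A (l + 2 * r) q) ∧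
      ∀ r, oDRt.d k A (oDRt.i k A (z r)) = oDRt.d k A (x r (q + 1))
  have step (q : ℕ) (z : ℤ → oDRt k A) (hz : good q z) : ∃ z', good (q + 1) z' ∧
      ∀ r, oDRt.i k A (z r) - oDRt.d k A (z' (r - 1)) = x r (q + 1) := by
    have ex (r : ℤ) : ∃ w ∈ oDRt.deg k A (l + 2 * r) (q + 1),
        oDRt.d k A w = oDRt.i k A (z (r + 1)) - x (r + 1) (q + 1) := by
      have h1 := oDRt.i_mem (hz.1 (r + 1))
      have h2 := hx (r + 1) (q + 1)
      have e1 : l + 2 * (r + 1) - 1 = m + 2 * (r + 1) := by omega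
      rw [e1] at h1
      have h := oDRt.exists_d_eq s hs (sub_mem h1 h2)
        (by rw [map_sub, hz.2 (r + 1), sub_self])
      have e2 : m + 2 * (r + 1) - 1 = l + 2 * r := by omega
      rwa [e2] at h
    choose w hw hdw using ex
    refine ⟨w, ⟨hw, fun r => ?_⟩, fun r => ?_⟩
    -- The next obstruction is again closed: `d i w = -i d w = -i (i z - x) = i x`, and the cycle
    -- condition on `x` rewrites this as `d` of the coefficient one power of `t` higher.
    · have h := hdx (r + 1) (q + 1)
      rw [add_sub_cancel_right] at h
      rw [oDRt.i_d (hw r), hdw, map_sub, oDRt.i_i (hz.1 (r + 1)), h, zero_sub, neg_neg]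
    · rw [hdw, sub_add_cancel, sub_sub_cancel]
  choose! f hf hf' using step
  let Y (q : ℕ) : ℤ → oDRt k A := Nat.rec y f q
  have hY (q : ℕ) : good q (Y q) := by
    induction q with
    | zero =>
      -- At the start, closedness of the obstruction comes from the assumption that `y` solves the
      -- equation modulo `t`.
      refine ⟨hy, fun r => ?_⟩
      have h := hdx (r + 1) 0
      have h' := hdy (r + 1)
      rw [add_sub_cancel_right] at h h'
      change oDRt.d k A (oDRt.i k A (y r)) = _
      rw [oDRt.i_d (hy r), ← map_neg, h', h]
    | succ q ih => exact hf q _ ih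
  exact ⟨fun r q => Y q r, fun r q => (hY q).1 r, fun r => rfl, fun r q => hf' q _ (hY q) r⟩

end Lifting

/-! ### From families of coefficients to Laurent series with completed coefficients. -/

section LaurentLifting

variable {k : Type u} [CommRing k] {M : Type v} [AddCommGroup M] [Module k M]

/-- The homogeneous Laurent series with given coefficients, in a module that vanishes in negative
degrees. -/
def laurentMk (G : ℤ → Submodule k M) (hG : ∀ p < 0, G p = ⊥) (l : ℤ) (f : ℤ → M)
    (hf : ∀ r, f r ∈ G (l + 2 * r)) : laurentDeg k G l :=
  -- For `r < -|l|` the degree `l + 2 r` is negative, so the coefficient vanishes. The support is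
  -- bounded below with no further condition on `f`.
  ⟨HahnSeries.ofSuppBddBelow f ⟨-|l|, fun r hr => by
    by_contra h
    have hl : l + 2 * r < 0 := by
      have := le_abs_self l
      have := abs_nonneg l
      omega
    have h0 := hf r
    rw [hG _ hl, Submodule.mem_bot] at h0
    exact hr h0⟩, hf⟩

end LaurentLifting

section Completion

variable {k : Type u} [CommRing k] {A : Type v} [Ring A] [Algebra k A]

theorem hDRt.deg_eq_bot {p : ℤ} (hp : p < 0) : hDRt.deg k A p = ⊥ := by
  refine (Submodule.eq_bot_iff _).2 fun x hx => funext fun q => ?_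
  have h : x q ∈ oDRt.deg k A p q := hx q trivial
  rw [oDRt.deg_eq_bot hp] at h
  exact h

/-- The contraction raises the degree in `t`, hence contributes nothing modulo `t`. -/
theorem laurentMap_modT_laurentD {l : ℤ} {x : HahnSeries ℤ (ℕ → oDRt k A)}
    (hx : x ∈ laurentDeg k (hDRt.deg k A) l) :
    laurentMap (hDRt.modT k A) (laurentD (hDRt.i k A) (hDRt.d k A) x) =
      laurentD 0 (oDR.d k A) (laurentMap (hDRt.modT k A) x) := by
  ext r
  change oDRt.modT k A (0 - oDRt.d k A (x.coeff (r - 1) 0)) =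
    0 - oDR.d k A (oDRt.modT k A (x.coeff (r - 1) 0))
  rw [zero_sub, zero_sub, map_neg, oDRt.modT_d (hx (r - 1) 0 trivial)]

/-- One lifting property serves both halves of the quasi-isomorphism. With `x = 0` it lifts cycles
of the reduced complex; for a cycle `x` it turns a primitive of the reduction into a primitive of
`x`. -/
theorem exists_laurentD_eq [Algebra ℚ k] (s : A →ₗ[k] k) (hs : s 1 = 1) {l m : ℤ} (e : m + 1 = l)
    {x : HahnSeries ℤ (ℕ → oDRt k A)} (hx : x ∈ laurentDeg k (hDRt.deg k A) m)
    (hdx : laurentD (hDRt.i k A) (hDRt.d k A) x = 0)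
    {y : HahnSeries ℤ (oDR k A)} (hy : y ∈ laurentDeg k (oDR.deg k A) l)
    (hdy : laurentD 0 (oDR.d k A) y = laurentMap (hDRt.modT k A) x) :
    ∃ Y ∈ laurentDeg k (hDRt.deg k A) l, laurentD (hDRt.i k A) (hDRt.d k A) Y = x ∧
      laurentMap (hDRt.modT k A) Y = y := by
  obtain ⟨Y, hY, hY0, hdY⟩ := oDRt.exists_lift s hs e (fun r q => x.coeff r q)
    (fun r q => hx r q trivial)
    (fun r q => by
      have h := congrFun (congrArg (fun z => HahnSeries.coeff z r) hdx) (q + 1)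
      exact sub_eq_zero.1 h)
    (fun r => oDR.incl k A (y.coeff r)) (fun r => oDR.incl_mem (hy r))
    (fun r => by
      have h : 0 - oDR.d k A (y.coeff (r - 1)) = oDRt.modT k A (x.coeff r 0) :=
        congrArg (fun z => HahnSeries.coeff z r) hdy
      rw [← oDRt.incl_modT (hx r 0 trivial), ← h, zero_sub, map_neg, oDRt.d_incl])
  let Z := laurentMk (hDRt.deg k A) (fun p hp => hDRt.deg_eq_bot hp) l Y
    (fun r q _ => hY r q)
  refine ⟨Z.1, Z.2, ?_, ?_⟩
  · ext r q
    rcases q with _ | q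
    · change 0 - oDRt.d k A (Y (r - 1) 0) = x.coeff r 0
      have h : 0 - oDR.d k A (y.coeff (r - 1)) = oDRt.modT k A (x.coeff r 0) :=
        congrArg (fun z => HahnSeries.coeff z r) hdy
      rw [hY0, ← oDRt.incl_modT (hx r 0 trivial), ← h, oDRt.d_incl, map_sub, map_zero]
    · exact hdY r q
  · ext r
    change oDRt.modT k A (Y r 0) = y.coeff r
    rw [hY0, oDRt.modT_incl]

end Completion

open CategoryTheory

/-! ### Cycles and homology of a chain complex of modules, by elements. -/

section ChainComplex

variable {k : Type u} [CommRing k] (K : ChainComplex (ModuleCat.{v} k) ℤ)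

theorem homologyπ_surjective (l : ℤ) : Function.Surjective (K.homologyπ l).hom :=
  (ModuleCat.epi_iff_surjective _).1 inferInstance

theorem iCycles_injective (l : ℤ) : Function.Injective (K.iCycles l).hom :=
  (ModuleCat.mono_iff_injective _).1 inferInstance

theorem d_iCycles_apply {l m : ℤ} (z : K.cycles l) :
    (K.d l m).hom ((K.iCycles l).hom z) = 0 :=
  congrArg (fun f => f.hom z) (K.iCycles_d l m)

theorem exists_cycle {l m : ℤ} (e : m + 1 = l) {x : K.X l} (hx : (K.d l m).hom x = 0) :
    ∃ z : K.cycles l, (K.iCycles l).hom z = x := by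
  have hm : (ComplexShape.down ℤ).next l = m := (ComplexShape.down ℤ).next_eq' e
  have hex : (ShortComplex.mk _ _ (K.iCycles_d l m)).Exact :=
    ShortComplex.exact_of_f_is_kernel _ (K.cyclesIsKernel l m hm)
  exact (ShortComplex.moduleCat_exact_iff _).1 hex x hx

theorem homologyπ_eq_zero_iff {l m : ℤ} (e : l + 1 = m) (z : K.cycles l) :
    (K.homologyπ l).hom z = 0 ↔ ∃ y : K.X m, (K.d m l).hom y = (K.iCycles l).hom z := by
  have hm : (ComplexShape.down ℤ).prev l = m := (ComplexShape.down ℤ).prev_eq' e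
  have hex : (ShortComplex.mk _ _ (K.toCycles_comp_homologyπ m l)).Exact :=
    ShortComplex.exact_of_g_is_cokernel _ (K.homologyIsCokernel m l hm)
  have hd (y : K.X m) : (K.iCycles l).hom ((K.toCycles m l).hom y) = (K.d m l).hom y :=
    congrArg (fun f => f.hom y) (K.toCycles_i m l)
  constructor
  · intro h
    obtain ⟨y, hy⟩ := (ShortComplex.moduleCat_exact_iff _).1 hex z h
    exact ⟨y, by rw [← hd]; exact congrArg _ hy⟩
  · rintro ⟨y, hy⟩
    rw [← hd] at hy
    rw [← iCycles_injective K l hy]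
    exact congrArg (fun f => f.hom y) (K.toCycles_comp_homologyπ m l)

/-- A surjection from the cycles whose kernel consists of the boundaries identifies the homology. -/
theorem exists_homology_equiv {N : Type*} [AddCommGroup N] [Module k N] {l m : ℤ} (e : l + 1 = m)
    (Φ : K.cycles l →ₗ[k] N) (hΦ : Function.Surjective Φ)
    (hker : ∀ z, Φ z = 0 ↔ ∃ y : K.X m, (K.d m l).hom y = (K.iCycles l).hom z) :
    ∃ E : K.homology l ≃ₗ[k] N, ∀ z, E ((K.homologyπ l).hom z) = Φ z := by
  have h : LinearMap.ker (K.homologyπ l).hom = LinearMap.ker Φ := by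
    ext z
    rw [LinearMap.mem_ker, LinearMap.mem_ker, homologyπ_eq_zero_iff K e, hker]
  refine ⟨((K.homologyπ l).hom.quotKerEquivOfSurjective (homologyπ_surjective K l)).symm ≪≫ₗ
    Submodule.quotEquivOfEq _ _ h ≪≫ₗ Φ.quotKerEquivOfSurjective hΦ, fun z => ?_⟩
  have h1 : (K.homologyπ l).hom z =
      (K.homologyπ l).hom.quotKerEquivOfSurjective (homologyπ_surjective K l)
        (Submodule.Quotient.mk z) := rfl
  rw [LinearEquiv.trans_apply, LinearEquiv.trans_apply, h1, LinearEquiv.symm_apply_apply]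
  rfl

end ChainComplex

section LaurentComplex

variable {k : Type u} [CommRing k] {M : Type v} [AddCommGroup M] [Module k M]
  {G : ℤ → Submodule k M} {i d : M →ₗ[k] M}

theorem laurentComplex_d (h : IsMixed G i d) {l m : ℤ} (e : m + 1 = l)
    (x : (laurentComplex h).X l) :
    (((laurentComplex h).d l m).hom x : laurentDeg k G m).1 =
      laurentD i d (x : laurentDeg k G l).1 := by
  have e' : (laurentComplex h).d l m =
      ModuleCat.ofHom ((laurentD i d).restrict (fun _ hx => h.laurentD_mem e hx)) := dif_pos e
  rw [e']
  rfl

end LaurentComplex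

/-! ### Comparison of the extended complex with Laurent series in the de Rham homology. -/

section Periodic

variable (k : Type u) [CommRing k] (A : Type v) [Ring A] [Algebra k A]

/-- Reduction modulo `t` as a morphism of complexes. -/
def extPerComplex.modT : extPerComplex k A ⟶ perComplex k A where
  f := perModT k A
  comm' := by
    rintro l m (e : m + 1 = l)
    refine ModuleCat.hom_ext (LinearMap.ext fun x => Subtype.ext ?_)
    refine (laurentComplex_d (oDR.isMixed k A) e ((perModT k A l).hom x)).trans ?_
    refine (laurentMap_modT_laurentD x.2).symm.trans ?_
    exact congrArg (laurentMap (hDRt.modT k A)) (laurentComplex_d (hDRt.isMixed k A) e x).symm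

/-- The Laurent series that underlies an element of degree `l` of `extPerComplex`. -/
def extPerComplex.toLaurent (l : ℤ) :
    (extPerComplex k A).X l →ₗ[k] HahnSeries ℤ (ℕ → oDRt k A) :=
  (laurentDeg k (hDRt.deg k A) l).subtype

variable {k A}

theorem perComplex.toLaurent_d {l m : ℤ} (e : m + 1 = l) (x : (perComplex k A).X l) :
    perComplex.toLaurent k A m (((perComplex k A).d l m).hom x) =
      laurentD 0 (oDR.d k A) (perComplex.toLaurent k A l x) :=
  laurentComplex_d (oDR.isMixed k A) e x

theorem extPerComplex.toLaurent_d {l m : ℤ} (e : m + 1 = l) (x : (extPerComplex k A).X l) :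
    extPerComplex.toLaurent k A m (((extPerComplex k A).d l m).hom x) =
      laurentD (hDRt.i k A) (hDRt.d k A) (extPerComplex.toLaurent k A l x) :=
  laurentComplex_d (hDRt.isMixed k A) e x

theorem perComplex.toLaurent_injective (l : ℤ) :
    Function.Injective (perComplex.toLaurent k A l) :=
  Subtype.val_injective

theorem extPerComplex.toLaurent_injective (l : ℤ) :
    Function.Injective (extPerComplex.toLaurent k A l) :=
  Subtype.val_injective

theorem perComplex.coeff_d {l m : ℤ} (e : m + 1 = l) (x : (perComplex k A).X l) (r : ℤ) :
    (perComplex.toLaurent k A m (((perComplex k A).d l m).hom x)).coeff r =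
      -oDR.d k A ((perComplex.toLaurent k A l x).coeff (r - 1)) := by
  rw [perComplex.toLaurent_d e, laurentD_coeff, LinearMap.zero_apply, zero_sub]

/-- The differential `-u d` does not mix coefficients: the coefficient of `u ^ r` reappears,
differentiated, at `u ^ (r + 1)`. -/
theorem perComplex.d_coeff_eq_zero {l : ℤ} (z : (perComplex k A).cycles l) (r : ℤ) :
    oDR.d k A ((perComplex.toLaurent k A l (((perComplex k A).iCycles l).hom z)).coeff r) = 0 := by
  have h := perComplex.coeff_d (sub_add_cancel l 1) (((perComplex k A).iCycles l).hom z) (r + 1)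
  rw [d_iCycles_apply, map_zero, add_sub_cancel_right] at h
  exact neg_eq_zero.1 h.symm

variable (k A) in
/-- The class of a cycle in the Laurent series with coefficients in the de Rham homology. -/
def perComplex.classMap (l : ℤ) : (perComplex k A).cycles l →ₗ[k] laurentDeg k (oHD.deg k A) l where
  toFun z :=
    ⟨{ coeff := fun r => oHD.mk k A
          ⟨(perComplex.toLaurent k A l (((perComplex k A).iCycles l).hom z)).coeff r,
            perComplex.d_coeff_eq_zero z r⟩
       isPWO_support' := (perComplex.toLaurent k A l
          (((perComplex k A).iCycles l).hom z)).isPWO_support.mono fun r hr h0 => hr (by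
            change oHD.mk k A _ = 0
            rw [← map_zero (oHD.mk k A)]
            exact congrArg _ (Subtype.ext h0)) },
      fun r => ⟨_, (((perComplex k A).iCycles l).hom z).2 r, rfl⟩⟩
  map_add' z z' := by
    refine Subtype.ext (HahnSeries.ext (funext fun r => ?_))
    refine Eq.trans ?_ (map_add (oHD.mk k A) _ _)
    refine congrArg (oHD.mk k A) (Subtype.ext ?_)
    simp
  map_smul' c z := by
    refine Subtype.ext (HahnSeries.ext (funext fun r => ?_))
    refine Eq.trans ?_ (map_smul (oHD.mk k A) _ _)
    refine congrArg (oHD.mk k A) (Subtype.ext ?_)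
    simp

/-- Homogeneous representatives can be chosen separately for each power of `u`, the Laurent
condition being automatic by degree. -/
theorem perComplex.classMap_surjective (l : ℤ) :
    Function.Surjective (perComplex.classMap k A l) := by
  intro v
  have h (r : ℤ) : ∃ x : LinearMap.ker (oDR.d k A), x.1 ∈ oDR.deg k A (l + 2 * r) ∧
      oHD.mk k A x = v.1.coeff r := by
    obtain ⟨x, hx, e⟩ := v.2 r
    exact ⟨x, hx, e⟩
  choose x hx e using h
  let y : (perComplex k A).X l :=
    laurentMk (oDR.deg k A) (fun p hp => oDR.deg_eq_bot hp) l (fun r => (x r).1) hx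
  have hy : ((perComplex k A).d l (l - 1)).hom y = 0 := by
    refine perComplex.toLaurent_injective _ (HahnSeries.ext (funext fun r => ?_))
    rw [perComplex.coeff_d (sub_add_cancel l 1), map_zero]
    exact neg_eq_zero.2 (x (r - 1)).2
  obtain ⟨z, hz⟩ := exists_cycle (perComplex k A) (by omega) hy
  refine ⟨z, Subtype.ext (HahnSeries.ext (funext fun r => ?_))⟩
  rw [← e]
  refine congrArg (oHD.mk k A) (Subtype.ext ?_)
  change (perComplex.toLaurent k A l _).coeff r = _
  rw [hz]
  rfl

/-- Since `oHD` is the quotient by the whole image of `d`, a vanishing class only provides some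
primitive; `oDR.exists_deg_of_mem_range` makes it homogeneous, and the chosen primitives then
assemble into a Laurent series. -/
theorem perComplex.classMap_eq_zero_iff {l m : ℤ} (e : l + 1 = m) (z : (perComplex k A).cycles l) :
    perComplex.classMap k A l z = 0 ↔
      ∃ y : (perComplex k A).X m, ((perComplex k A).d m l).hom y =
        ((perComplex k A).iCycles l).hom z := by
  have key : perComplex.classMap k A l z = 0 ↔ ∀ r,
      (perComplex.toLaurent k A l (((perComplex k A).iCycles l).hom z)).coeff r ∈
        LinearMap.range (oDR.d k A) := by
    rw [Subtype.ext_iff, HahnSeries.ext_iff, funext_iff]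
    refine forall_congr' fun r => ?_
    exact Submodule.Quotient.mk_eq_zero _
  rw [key]
  constructor
  · intro h
    have ex (r : ℤ) : ∃ y ∈ oDR.deg k A (m + 2 * r), -oDR.d k A y =
        (perComplex.toLaurent k A l (((perComplex k A).iCycles l).hom z)).coeff (r + 1) := by
      obtain ⟨y, hy, hd⟩ := oDR.exists_deg_of_mem_range
        ((((perComplex k A).iCycles l).hom z).2 (r + 1)) (h (r + 1))
      have e1 : l + 2 * (r + 1) - 1 = m + 2 * r := by omega
      rw [e1] at hy
      exact ⟨-y, neg_mem hy, by rw [map_neg, neg_neg]; exact hd⟩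
    choose y hy hd using ex
    refine ⟨laurentMk (oDR.deg k A) (fun p hp => oDR.deg_eq_bot hp) m y hy,
      perComplex.toLaurent_injective _ (HahnSeries.ext (funext fun r => ?_))⟩
    refine (perComplex.coeff_d e _ r).trans ((hd (r - 1)).trans ?_)
    rw [sub_add_cancel]
  · rintro ⟨y, hy⟩ r
    rw [← hy, perComplex.coeff_d e]
    exact neg_mem ⟨_, rfl⟩

theorem extPerComplex.exists_d_eq [Algebra ℚ k] (s : A →ₗ[k] k) (hs : s 1 = 1) {l m : ℤ}
    (e : m + 1 = l) {x : (extPerComplex k A).X m}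
    (hx : ((extPerComplex k A).d m (m - 1)).hom x = 0) {y : (perComplex k A).X l}
    (hy : ((perComplex k A).d l m).hom y = (perModT k A m).hom x) :
    ∃ Y : (extPerComplex k A).X l, ((extPerComplex k A).d l m).hom Y = x ∧
      (perModT k A l).hom Y = y := by
  have hx' := congrArg (extPerComplex.toLaurent k A (m - 1)) hx
  rw [extPerComplex.toLaurent_d (sub_add_cancel m 1), map_zero] at hx'
  have hy' := congrArg (perComplex.toLaurent k A m) hy
  rw [perComplex.toLaurent_d e] at hy'
  obtain ⟨Y, hY, h1, h2⟩ := exists_laurentD_eq s hs e x.2 hx' y.2 hy'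
  refine ⟨⟨Y, hY⟩, extPerComplex.toLaurent_injective m ?_, Subtype.ext h2⟩
  exact (extPerComplex.toLaurent_d e _).trans h1

theorem extPerComplex.iCycles_cyclesMap (l : ℤ) (z : (extPerComplex k A).cycles l) :
    ((perComplex k A).iCycles l).hom
      ((HomologicalComplex.cyclesMap (extPerComplex.modT k A) l).hom z) =
      (perModT k A l).hom (((extPerComplex k A).iCycles l).hom z) :=
  congrArg (fun f => f.hom z) (HomologicalComplex.cyclesMap_i (extPerComplex.modT k A) l)

theorem extPerComplex.cyclesMap_surjective [Algebra ℚ k] (s : A →ₗ[k] k) (hs : s 1 = 1) (l : ℤ) :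
    Function.Surjective (HomologicalComplex.cyclesMap (extPerComplex.modT k A) l).hom := by
  intro z
  -- A lift of a cycle that solves the equation with right-hand side zero is itself a cycle.
  obtain ⟨Y, hY, hYz⟩ := extPerComplex.exists_d_eq s hs (m := l - 1) (by omega) (x := 0)
    (map_zero _) (y := ((perComplex k A).iCycles l).hom z)
    (by rw [d_iCycles_apply, map_zero])
  obtain ⟨z', rfl⟩ := exists_cycle (extPerComplex k A) (by omega) hY
  refine ⟨z', iCycles_injective (perComplex k A) l ?_⟩
  rw [extPerComplex.iCycles_cyclesMap, hYz]

theorem extPerComplex.classMap_eq_zero_iff [Algebra ℚ k] (s : A →ₗ[k] k) (hs : s 1 = 1) {l m : ℤ}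
    (e : l + 1 = m) (z : (extPerComplex k A).cycles l) :
    perComplex.classMap k A l
      ((HomologicalComplex.cyclesMap (extPerComplex.modT k A) l).hom z) = 0 ↔
      ∃ y : (extPerComplex k A).X m, ((extPerComplex k A).d m l).hom y =
        ((extPerComplex k A).iCycles l).hom z := by
  rw [perComplex.classMap_eq_zero_iff e, extPerComplex.iCycles_cyclesMap]
  constructor
  · rintro ⟨y, hy⟩
    obtain ⟨Y, hY, -⟩ := extPerComplex.exists_d_eq s hs e (d_iCycles_apply _ z) hy
    exact ⟨Y, hY⟩
  · rintro ⟨y, hy⟩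
    refine ⟨(perModT k A m).hom y, ?_⟩
    rw [← hy]
    exact congrArg (fun f => f.hom y) ((extPerComplex.modT k A).comm m l)

end Periodic

end ExtendedDR

end

/-! ### The quasi-isomorphism and the explicit isomorphism on homology. -/

theorem propositionp (k : Type u) [CommRing k] [Algebra ℚ k] (A : Type v) [Ring A] [Algebra k A]
    (hA : ∃ s : A →ₗ[k] k, s 1 = 1) :
    ∃ f : ExtendedDR.extPerComplex k A ⟶ ExtendedDR.perComplex k A,
      (∀ l : ℤ, f.f l = ExtendedDR.perModT k A l) ∧
      QuasiIso f ∧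
      ∀ l : ℤ, ∃ e : (ExtendedDR.extPerComplex k A).homology l ≃ₗ[k]
          ExtendedDR.laurentDeg k (ExtendedDR.oHD.deg k A) l,
        ∀ (z : (ExtendedDR.extPerComplex k A).cycles l) (r : ℤ),
          ∃ h : (ExtendedDR.cycleModT k A l z).coeff r ∈ LinearMap.ker (ExtendedDR.oDR.d k A),
            (e (((ExtendedDR.extPerComplex k A).homologyπ l).hom z)).1.coeff r =
              ExtendedDR.oHD.mk k A ⟨(ExtendedDR.cycleModT k A l z).coeff r, h⟩ := by
  obtain ⟨s, hs⟩ := hA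
  have he (l : ℤ) := ExtendedDR.exists_homology_equiv (ExtendedDR.extPerComplex k A) rfl
    (ExtendedDR.perComplex.classMap k A l ∘ₗ
      (HomologicalComplex.cyclesMap (ExtendedDR.extPerComplex.modT k A) l).hom)
    ((ExtendedDR.perComplex.classMap_surjective l).comp
      (ExtendedDR.extPerComplex.cyclesMap_surjective s hs l))
    (ExtendedDR.extPerComplex.classMap_eq_zero_iff s hs rfl)
  refine ⟨ExtendedDR.extPerComplex.modT k A, fun l => rfl, ⟨fun l => ?_⟩, fun l => ?_⟩
  · obtain ⟨e, he⟩ := he l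
    obtain ⟨e', he'⟩ := ExtendedDR.exists_homology_equiv (ExtendedDR.perComplex k A) rfl
      (ExtendedDR.perComplex.classMap k A l) (ExtendedDR.perComplex.classMap_surjective l)
      (ExtendedDR.perComplex.classMap_eq_zero_iff rfl)
    -- Both homologies are identified with the same Laurent series, compatibly with reduction modulo
    -- `t`, so the induced map is `e` followed by the inverse of `e'`.
    have h : (HomologicalComplex.homologyMap (ExtendedDR.extPerComplex.modT k A) l).hom =
        (e.trans e'.symm).toLinearMap := by
      ext x
      obtain ⟨z, rfl⟩ := ExtendedDR.homologyπ_surjective _ l x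
      refine (congrArg (fun f => f.hom z)
        (HomologicalComplex.homologyπ_naturality (ExtendedDR.extPerComplex.modT k A) l)).trans ?_
      refine e'.injective ((he' _).trans ((he z).symm.trans ?_))
      simp
    rw [quasiIsoAt_iff_isIso_homologyMap, CategoryTheory.ConcreteCategory.isIso_iff_bijective]
    exact (congrArg (fun g => Function.Bijective g) (congrArg DFunLike.coe h)).mpr
      (e.trans e'.symm).bijective
  · obtain ⟨e, he⟩ := he l
    refine ⟨e, fun z r => ?_⟩
    have hz : ExtendedDR.cycleModT k A l z = ExtendedDR.perComplex.toLaurent k A l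
        (((ExtendedDR.perComplex k A).iCycles l).hom
          ((HomologicalComplex.cyclesMap (ExtendedDR.extPerComplex.modT k A) l).hom z)) := by
      rw [ExtendedDR.extPerComplex.iCycles_cyclesMap]
      rfl
    refine ⟨by rw [hz]; exact ExtendedDR.perComplex.d_coeff_eq_zero _ r, ?_⟩
    rw [he]
    exact congrArg (ExtendedDR.oHD.mk k A)
      (Subtype.ext (congrArg (fun x => HahnSeries.coeff x r) hz.symm))
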